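/- **Theorem 5.1 (Fixed-Norm LWE to CLWE).** *Notation.* For $s>0$ let $\rho_s(x)=\exp(-\pi (x/s)^2)$. Let $D_s$ be the Gaussian distribution on $\mathbb R$ with density $\rho_s(x)/s$, and let $D_{\mathbb Z,s}$ be the distribution on $\mathbb Z$ with mass $\rho_s(k)/\sum_{j\in\mathbb Z}\rho_s(j)$ at $k$. Identify $\mathbb Z_q$ with $\{0,\dots,q-1\}$ and $\mathbb T=\mathbb R/\mathbb Z$ with $[0,1)$, and let $U(\cdot)$ denote uniform distributions. For a distribution $\mathcal S$ on $\mathbb Z^n$, $\mathsf{LWE}(m,\mathbb Z_q^n,\mathcal S,D_{\mathbb Z,\sigma})$ is the distribution of $(\mathbf a_i,\ \langle \mathbf a_i,\mathbf s\rangle+e_i \bmod q)_{i\le m}$ with one secret $\mathbf s\sim\mathcal S$ and independent $\mathbf a_i\sim U(\mathbb Z_q^n)$, $e_i\sim D_{\mathbb Z,\sigma}$. For $r>0$, $\mathsf{CLWE}(m,D_1^n,\frac1r\mathcal S,\gamma,\beta)$ is the distribution of $(\mathbf a_i,\ \gamma\langle \mathbf a_i,\mathbf s/r\rangle+e_i \bmod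 1)_{i\le m}$ with one secret $\mathbf s\sim\mathcal S$ and independent $\mathbf a_i\sim D_1^n$, $e_i\sim D_\beta$. *Algorithms* are programs of a randomized real RAM: natural-number registers (addition, truncated subtraction, comparison; used for counting and addressing), real registers and memory cells with exact arithmetic $+,-,\times,\div$, real constants and comparison (no floor operation), conditionals and while loops, and instructions that draw a fresh sample from $U([0,1))$ or from $D_1$. Every instruction and every test costs one step, and so does unfolding a sequential composition. A program is given the public parameters $(\lambda,n,m,q,r,\sigma,\gamma,\beta)$ and the $m$ samples. It is a *$B$-time distinguisher with advantage at least $\epsilon$* between two distributions if it always halts within $B$ steps on the inputs of the respective format, and the probabilities (over the input and the internal randomness) that it outputs $1$ differ by at least $\epsilon$ in absolute value. *Statement.* There are universal constants $C>0$ and $c\in\mathbb N$ and a polynomial $p$ in five variables such that for every function $f$ with $f(\lambda)=\omega(\log\lambda)$ there is a negligible function $\nu$ (that is, $\lambda^k\nu(\lambda)\to0$ for all $k$) for which the following holds. For every program $D$ there is a program $D'$, longer than $D$ by at most $c$, such that for all $\lambda\in\mathbb N$, all integers $n\ge 0$ and $m,q\ge1$, all reals $r\ge1$ and $\sigma>0$,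 every distribution $\mathcal S$ over $\mathbb Z^n$ all of whose support has $\ell_2$-norm exactly $r$, all $T\in\mathbb N$ and all $\epsilon\in\mathbb R$: if $$\gamma=r\sqrt{\ln m+\ln n+f(\lambda)},\qquad \beta=C\,\frac{\sigma}{q},\qquad \sigma\ge 3r\sqrt{\ln m+\ln n+f(\lambda)},$$ and if $D$ is a $T$-time distinguisher between $$\mathsf{CLWE}\big(m,D_1^n,\tfrac1r\mathcal S,\gamma,\beta\big)\quad\text{and}\quad D_1^{n\times m}\times U(\mathbb T^m)$$ with advantage at least $\epsilon$, then $D'$ is a $\big(T+p(n,m,\log q,\log\sigma,\log\lambda)\big)$-time distinguisher between $$\mathsf{LWE}\big(m,\mathbb Z_q^n,\mathcal S,D_{\mathbb Z,\sigma}\big)\quad\text{and}\quad U(\mathbb Z_q^{n\times m}\times\mathbb Z_q^m)$$ with advantage at least $\epsilon-\nu(\lambda)$. Here a square root of a negative number is read as $0$, and $\ln 0=\log 0=0$ (the former can only matter for the finitely many $\lambda$ with $f(\lambda)<0$, the latter only for $\lambda=0$, because $n=0$ admits no such $\mathcal S$). In particular, if there is no LWE distinguisher running in time $T+p(n,m,\log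 q,\log\sigma,\log\lambda)$ with advantage at least $\epsilon-\nu(\lambda)$, then there is no $T$-time CLWE distinguisher with advantage $\epsilon$. -/

import Mathlib

open MeasureTheory ProbabilityTheory Filter

noncomputable section

namespace CLWE

/-! ### Gaussian and uniform distributions -/

/-- The Gaussian function `ρ_s(x) = exp(-π (x/s)²)`. -/
def rho (s x : ℝ) : ℝ := Real.exp (-Real.pi * (x / s) ^ 2)

/-- The continuous Gaussian `D_s` of width `s`, i.e. with density `ρ_s(x)/s`; this is the
centered Gaussian of variance `s²/(2π)`. -/
def contGaussian (s : ℝ) : Measure ℝ := gaussianReal 0 (s ^ 2 / (2 * Real.pi)).toNNReal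

instance (s : ℝ) : IsProbabilityMeasure (contGaussian s) := by
  unfold contGaussian; infer_instance

/-- The discrete Gaussian `D_{ℤ,s}`: mass `ρ_s(k) / ρ_s(ℤ)` at each integer `k`
(as a measure on the reals). -/
def discGaussian (s : ℝ) : Measure ℝ :=
  Measure.sum fun k : ℤ =>
    ENNReal.ofReal (rho s k / ∑' j : ℤ, rho s j) • Measure.dirac (k : ℝ)

/-- The uniform distribution on `ℤ_q`, represented by `{0, …, q-1}` inside the reals. -/
def unifZq (q : ℕ) : Measure ℝ :=
  ∑ k ∈ Finset.range q, (q : ENNReal)⁻¹ • Measure.dirac (k : ℝ)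

/-- The uniform distribution on the torus `𝕋 = ℝ/ℤ`, represented by `[0,1)`. -/
def unifTorus : Measure ℝ := volume.restrict (Set.Ico 0 1)

instance : IsProbabilityMeasure unifTorus := ⟨by simp [unifTorus]⟩

/-- The representative in `[0,q)` of a real number modulo `q`. -/
def modQ (q : ℕ) (x : ℝ) : ℝ := q * Int.fract (x / q)

/-! ### LWE and CLWE -/

/-- `m` samples `(a_i, b_i)` in dimension `n`. -/
abbrev Samples (n m : ℕ) : Type := Fin m → (Fin n → ℝ) × ℝ

/-- The distribution obtained by first drawing `s ∼ S` and then drawing from `μ s`. -/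
def mixture {α β : Type*} [MeasurableSpace β] (S : PMF α) (μ : α → Measure β) : Measure β :=
  Measure.sum fun s => S s • μ s

/-- `LWE(m, 𝒜, S, ℰ)` with modulus `q`: a common secret `s ∼ S`, and `m` independent samples
`(a, ⟨a, s⟩ + e mod q)` with `a ∼ 𝒜`, `e ∼ ℰ`. -/
def lwe {n : ℕ} (m q : ℕ) (A : Measure (Fin n → ℝ)) (S : PMF (Fin n → ℤ)) (E : Measure ℝ) :
    Measure (Samples n m) :=
  mixture S fun s => Measure.pi fun _ : Fin m =>
    (A.prod E).map fun ae => (ae.1, modQ q (∑ j, ae.1 j * (s j : ℝ) + ae.2))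

/-- `CLWE(m, 𝒜, S, γ, β)`: a common secret `s ∼ S`, and `m` independent samples
`(a, γ ⟨a, s⟩ + e mod 1)` with `a ∼ 𝒜`, `e ∼ D_β`. -/
def clwe {n : ℕ} (m : ℕ) (A : Measure (Fin n → ℝ)) (S : PMF (Fin n → ℝ)) (γ β : ℝ) :
    Measure (Samples n m) :=
  mixture S fun s => Measure.pi fun _ : Fin m =>
    (A.prod (contGaussian β)).map fun ae =>
      (ae.1, Int.fract (γ * ∑ j, ae.1 j * s j + ae.2))

/-- `m` independent samples `(a, b)` with independent `a ∼ 𝒜` and `b ∼ ℬ`. -/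
def nullSamples {n : ℕ} (m : ℕ) (A : Measure (Fin n → ℝ)) (B : Measure ℝ) :
    Measure (Samples n m) :=
  Measure.pi fun _ : Fin m => A.prod B

/-- The distribution `(1/r)·S`. -/
def scaleSecret {n : ℕ} (r : ℝ) (S : PMF (Fin n → ℤ)) : PMF (Fin n → ℝ) :=
  S.map fun s j => (s j : ℝ) / r

/-- The decoded inputs of an LWE distinguisher: all entries are in `{0, …, q-1}`. -/
def lweInputs (n m q : ℕ) : Set (Samples n m) :=
  {x | ∀ i, (∀ j, ∃ k < q, (x i).1 j = (k : ℝ)) ∧ ∃ k < q, (x i).2 = (k : ℝ)}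

/-- The inputs of a CLWE distinguisher: `a_i ∈ ℝⁿ` and `b_i ∈ [0,1)`. -/
def clweInputs (n m : ℕ) : Set (Samples n m) :=
  {x | ∀ i, (x i).2 ∈ Set.Ico (0 : ℝ) 1}

/-! ### The machine model

A randomized real RAM.  It has index registers holding natural numbers (used for counting and
addressing), real registers, and a memory of real cells addressed through index registers.
Arithmetic on reals is exact, each instruction and each test costs one step, and there is
no rounding (floor) instruction.  Two instructions draw fresh randomness: a uniform real
number in `[0,1)`, and a real number distributed according to `D_1`. -/

inductive Instr : Type
  /-- `idx i := c` -/
  | idxConst (i c : ℕ)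
  /-- `idx i := idx j + idx k` -/
  | idxAdd (i j k : ℕ)
  /-- `idx i := idx j - idx k` (truncated at `0`) -/
  | idxSub (i j k : ℕ)
  /-- `reg a := c` -/
  | regConst (a : ℕ) (c : ℝ)
  /-- `reg a := idx i` -/
  | regOfIdx (a i : ℕ)
  /-- `reg a := reg b + reg c` -/
  | regAdd (a b c : ℕ)
  /-- `reg a := reg b - reg c` -/
  | regSub (a b c : ℕ)
  /-- `reg a := reg b * reg c` -/
  | regMul (a b c : ℕ)
  /-- `reg a := reg b / reg c` (which is `0` when `reg c = 0`) -/
  | regDiv (a b c : ℕ)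
  /-- `reg a := mem (idx i)` -/
  | load (a i : ℕ)
  /-- `mem (idx i) := reg a` -/
  | store (i a : ℕ)
  /-- `reg a :=` a fresh uniform number in `[0,1)` -/
  | unif (a : ℕ)
  /-- `reg a :=` a fresh number distributed according to `D_1` -/
  | gauss (a : ℕ)

inductive Cond : Type
  /-- `idx i < idx j` -/
  | idxLt (i j : ℕ)
  /-- `reg a < reg b` -/
  | regLt (a b : ℕ)

inductive Prog : Type
  | instr (c : Instr)
  | seq (P Q : Prog)
  | ite (t : Cond) (P Q : Prog)
  /-- While `t` holds, repeat `P`. -/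
  | loop (t : Cond) (P : Prog)

/-- The length of a program. -/
def Prog.size : Prog → ℕ
  | .instr _ => 1
  | .seq P Q => P.size + Q.size + 1
  | .ite _ P Q => P.size + Q.size + 1
  | .loop _ P => P.size + 1

structure State : Type where
  idx : ℕ → ℕ
  reg : ℕ → ℝ
  mem : ℕ → ℝ
  /-- the number of cells of the random tape that have been consumed -/
  pos : ℕ

/-- A random tape; its `k`-th cell holds a uniform and a Gaussian number, of which the
`k`-th randomized instruction of a run uses the one that it asks for. -/
abbrev Tape : Type := ℕ → ℝ × ℝ

/-- All cells of the tape are independent. -/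
def tapeMeasure : Measure Tape :=
  Measure.infinitePi fun _ : ℕ => unifTorus.prod (contGaussian 1)

/-- The tapes whose uniform entries do lie in `[0,1)`. -/
def validTapes : Set Tape := {ω | ∀ k, (ω k).1 ∈ Set.Ico (0 : ℝ) 1}

def State.setIdx (s : State) (i v : ℕ) : State := { s with idx := Function.update s.idx i v }

def State.setReg (s : State) (a : ℕ) (v : ℝ) : State :=
  { s with reg := Function.update s.reg a v }

def Instr.exec (ω : Tape) (s : State) : Instr → State
  | .idxConst i c => s.setIdx i c
  | .idxAdd i j k => s.setIdx i (s.idx j + s.idx k)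
  | .idxSub i j k => s.setIdx i (s.idx j - s.idx k)
  | .regConst a c => s.setReg a c
  | .regOfIdx a i => s.setReg a (s.idx i)
  | .regAdd a b c => s.setReg a (s.reg b + s.reg c)
  | .regSub a b c => s.setReg a (s.reg b - s.reg c)
  | .regMul a b c => s.setReg a (s.reg b * s.reg c)
  | .regDiv a b c => s.setReg a (s.reg b / s.reg c)
  | .load a i => s.setReg a (s.mem (s.idx i))
  | .store i a => { s with mem := Function.update s.mem (s.idx i) (s.reg a) }
  | .unif a => { s.setReg a (ω s.pos).1 with pos := s.pos + 1 }
  | .gauss a => { s.setReg a (ω s.pos).2 with pos := s.pos + 1 }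

def Cond.Holds (s : State) : Cond → Prop
  | .idxLt i j => s.idx i < s.idx j
  | .regLt a b => s.reg a < s.reg b

open Classical in
/-- One step of the machine.  A configuration is the list of the programs that remain to be
executed, together with the state; the machine has halted when that list is empty. -/
def step (ω : Tape) : List Prog × State → List Prog × State
  | ([], s) => ([], s)
  | (.instr c :: K, s) => (K, c.exec ω s)
  | (.seq P Q :: K, s) => (P :: Q :: K, s)
  | (.ite t P Q :: K, s) => (if t.Holds s then P :: K else Q :: K, s)
  | (.loop t P :: K, s) => (if t.Holds s then P :: .loop t P :: K else K, s)

/-- The public parameters of an LWE or CLWE instance. -/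
structure Params : Type where
  /-- the security parameter -/
  lam : ℕ
  /-- the dimension -/
  n : ℕ
  /-- the number of samples -/
  m : ℕ
  /-- the LWE modulus -/
  q : ℕ
  /-- the norm of the LWE secrets -/
  r : ℝ
  /-- the width of the LWE errors -/
  σ : ℝ
  γ : ℝ
  /-- the width of the CLWE errors -/
  β : ℝ

/-- The samples are stored one after the other, sample `i` in the cells
`i(n+1), …, i(n+1)+n` with `b_i` in the last of them; all other cells hold `0`. -/
def initMem {n m : ℕ} (x : Samples n m) (k : ℕ) : ℝ :=
  if hi : k / (n + 1) < m then
    if hj : k % (n + 1) < n then (x ⟨k / (n + 1), hi⟩).1 ⟨k % (n + 1), hj⟩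
    else (x ⟨k / (n + 1), hi⟩).2
  else 0

/-- In the initial state the first index registers hold `λ, n, m, q`, the first real registers
hold `r, σ, γ, β`, and all other registers hold `0`. -/
def initState (par : Params) (x : Samples par.n par.m) : State where
  idx
    | 0 => par.lam
    | 1 => par.n
    | 2 => par.m
    | 3 => par.q
    | _ => 0
  reg
    | 0 => par.r
    | 1 => par.σ
    | 2 => par.γ
    | 3 => par.β
    | _ => 0
  mem := initMem x
  pos := 0

/-- The configuration of the machine after `t` steps of the run of `P`. -/
def runFor (P : Prog) (par : Params) (x : Samples par.n par.m) (ω : Tape) (t : ℕ) :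
    List Prog × State :=
  (step ω)^[t] ([P], initState par x)

/-- `P` halts after at most `B` steps. -/
def HaltsWithin (P : Prog) (par : Params) (x : Samples par.n par.m) (ω : Tape) (B : ℝ) : Prop :=
  ∃ t : ℕ, (t : ℝ) ≤ B ∧ (runFor P par x ω t).1 = []

/-- `P` halts with output `1`; the output is the content of the index register `0`. -/
def Accepts (P : Prog) (par : Params) (x : Samples par.n par.m) (ω : Tape) : Prop :=
  ∃ t : ℕ, (runFor P par x ω t).1 = [] ∧ (runFor P par x ω t).2.idx 0 = 1

/-- The probability that `P` outputs `1`, over an input drawn from `μ` and the internal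
randomness. -/
def acceptProb (P : Prog) (par : Params) (μ : Measure (Samples par.n par.m)) : ℝ :=
  (μ.prod tapeMeasure).real {z | Accepts P par z.1 z.2}

/-- `P` is a `B`-time distinguisher between `μ` and `ν`, for inputs from the set `I`, with
advantage at least `ε`. -/
def IsDistinguisher (P : Prog) (par : Params) (I : Set (Samples par.n par.m))
    (μ ν : Measure (Samples par.n par.m)) (B ε : ℝ) : Prop :=
  (∀ x ∈ I, ∀ ω ∈ validTapes, HaltsWithin P par x ω B) ∧
    ε ≤ |acceptProb P par μ - acceptProb P par ν|

/-- `P` is a `B`-time distinguisher, with advantage at least `ε`, between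
`LWE(m, ℤ_qⁿ, S, D_{ℤ,σ})` and `U(ℤ_q^{n×m} × ℤ_q^m)`. -/
def IsLWEDistinguisher (P : Prog) (par : Params) (S : PMF (Fin par.n → ℤ)) (B ε : ℝ) : Prop :=
  IsDistinguisher P par (lweInputs par.n par.m par.q)
    (lwe par.m par.q (Measure.pi fun _ => unifZq par.q) S (discGaussian par.σ))
    (nullSamples par.m (Measure.pi fun _ => unifZq par.q) (unifZq par.q)) B ε

/-- `P` is a `B`-time distinguisher, with advantage at least `ε`, between
`CLWE(m, D_1ⁿ, (1/r)·S, γ, β)` and `D_1^{n×m} × U(𝕋^m)`. -/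
def IsCLWEDistinguisher (P : Prog) (par : Params) (S : PMF (Fin par.n → ℤ)) (B ε : ℝ) : Prop :=
  IsDistinguisher P par (clweInputs par.n par.m)
    (clwe par.m (Measure.pi fun _ => contGaussian 1) (scaleSecret par.r S) par.γ par.β)
    (nullSamples par.m (Measure.pi fun _ => contGaussian 1) unifTorus) B ε

/-! ### Asymptotics -/

/-- `f(λ) = ω(log λ)`. -/
def IsOmegaLog (f : ℕ → ℝ) : Prop :=
  Tendsto (fun l : ℕ => f l / Real.log l) atTop atTop

/-- `ν(λ) = negl(λ)`: `ν` decays faster than every inverse polynomial. -/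
def Negligible (ν : ℕ → ℝ) : Prop :=
  Asymptotics.SuperpolynomialDecay atTop (fun l : ℕ => (l : ℝ)) ν

/-- The value of the polynomial `p` at `(n, m, log q, log σ, log λ)`. -/
def polyTime (p : MvPolynomial (Fin 5) ℕ) (par : Params) : ℝ :=
  MvPolynomial.aeval
    (![(par.n : ℝ), (par.m : ℝ), Real.log par.q, Real.log par.σ, Real.log par.lam]) p

end CLWE

end

open MeasureTheory ProbabilityTheory Filter

noncomputable section

namespace CLWE

/-! ### Gaussian sums over the integers -/

/-! Put `α = σ/q`, `ρ = α/r` and `w = γ/r`, so that `w² = ln m + ln n + f(λ)`. The reduction treats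
the entries of an LWE sample `(a, b)` separately. It blurs `a_j/q` by a Gaussian of width `ρ` modulo
1, draws `y_j` from the discrete Gaussian of width `w` on the coset of ℤ so obtained, and outputs
`y_j/w`; it blurs `b/q` by a Gaussian of width `α`.

For uniform `a_j`, unfolding modulo 1 shows that `y_j` and a lift `z/q` of `a_j/q` have joint weight
close to `dens w y * dens ρ (y - z/q) / q`. The choice of lift does not matter for `b`, because the
secret is integral. Hence `y_j` is nearly `D_w`, and given `y_j` the number `(a_j/q) s_j` is `y_j
s_j` plus a discrete noise of width `|s_j| ρ`. In the presence of a further Gaussian noise, a sum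
over `(1/q)ℤ` is nearly an integral, so this discrete noise acts like a continuous one. The squares
of the widths add up to `α² + ρ²‖s‖² + (σ/q)² = 3α²`; as `‖s‖ = r` exactly, the result does not
depend on `s`, and `C = √3`. The main term is `∑ y_j s_j = γ ⟨y/w, s/r⟩`. Uniform samples are
handled by the same computation with secret 0.

All comparisons are one-sided: the law of the output is shown to dominate a constant near 1 times a
truncated target law. Such bounds multiply along coordinates, and a common part of mass `1 - δ`
bounds the statistical distance by `δ` (`Overlap.abs_sub_le`). The analytic input is Poisson
summation with error `4 exp(-π w²)` (`abs_cosKernel_sub_one_le`), combined with completing the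
square in `le_tsum_dens_mul_dens`. Coordinates are exchanged one at a time in
`le_lintegral_coordLaw` and `le_lintegral_pi_coordLaw`; `overlap_lweSample` and `overlap_nullSample`
collect the losses for one sample. Over all `nm` entries the lattice errors are `O(nm exp(-w²)) =
O(exp(-f(λ)))`.

The machine can neither round nor exponentiate. Fractional parts are found by subtracting powers of
two, correctly on a bounded range. A proposal `x` is accepted with probability `exp(-π(x/w)²)` by
comparing `(x/w)²` with the squared radius of a pair of Gaussians (`contGaussian_prod_radius`). A
fixed number of trials keeps the running time deterministic; its failures and all tails cost `nm
exp(-K)` up to constants, where `K ≥ nm + (log λ)²`. Finally the scratch registers are cleared, so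
that the given distinguisher starts from a genuine initial state with an unused, independent rest of
the tape (`runs_reduction`, `map_chunks`). -/

lemma rho_pos (s x : ℝ) : 0 < rho s x := Real.exp_pos _

lemma rho_le_one (s x : ℝ) : rho s x ≤ 1 := by
  unfold rho
  rw [Real.exp_le_one_iff]
  have := Real.pi_pos
  have := sq_nonneg (x / s)
  nlinarith

@[fun_prop]
lemma measurable_rho (s : ℝ) : Measurable (rho s) := by
  unfold rho; fun_prop

lemma rho_neg (s x : ℝ) : rho s (-x) = rho s x := by simp [rho, neg_div]

/-- The kernel is `1 + 2 ∑_{n ≥ 1} cos(2πan) exp(-πn²t)`. With `x = exp(-πt) ≤ 1/2` and `n² ≥ n`,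
the tail is at most the geometric sum `2x/(1-x) ≤ 4x`. Uniformity in `a` makes the Gaussian sums
over all cosets of ℤ comparable. -/
lemma abs_cosKernel_sub_one_le (a : ℝ) {t : ℝ} (ht : 1 ≤ t) :
    |HurwitzZeta.cosKernel a t - 1| ≤ 4 * Real.exp (-Real.pi * t) := by
  have hs := HurwitzZeta.hasSum_nat_cosKernel₀ a (zero_lt_one.trans_le ht)
  set x := Real.exp (-Real.pi * t) with hx
  have hx0 : 0 < x := Real.exp_pos _
  have hx1 : x ≤ 1 / 2 := by
    rw [hx]
    have h1 : -Real.pi * t ≤ -1 := by nlinarith [Real.pi_gt_three]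
    refine (Real.exp_le_exp.2 h1).trans ?_
    rw [Real.exp_neg, inv_eq_one_div]
    gcongr
    linarith [Real.add_one_le_exp (1 : ℝ)]
  have hg : HasSum (fun n : ℕ => 2 * x * x ^ n) (2 * x * (1 - x)⁻¹) :=
    (hasSum_geometric_of_lt_one hx0.le (by linarith)).mul_left _
  have key : ‖HurwitzZeta.cosKernel a t - 1‖ ≤ 2 * x * (1 - x)⁻¹ := by
    rw [← hs.tsum_eq]
    refine tsum_of_norm_bounded hg fun n => ?_
    have h2 : Real.exp (-Real.pi * ((n : ℝ) + 1) ^ 2 * t) ≤ x * x ^ n := by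
      rw [hx, ← Real.exp_nat_mul, ← Real.exp_add]
      apply Real.exp_le_exp.2
      have : (0 : ℝ) ≤ n := Nat.cast_nonneg n
      have h3 : 0 ≤ Real.pi * t := by positivity
      nlinarith [mul_nonneg h3 (by nlinarith : (0 : ℝ) ≤ n ^ 2 + n)]
    rw [norm_mul, norm_mul, Real.norm_eq_abs, Real.norm_eq_abs, Real.norm_eq_abs, Real.abs_exp,
      abs_two]
    calc 2 * |Real.cos _| * Real.exp (-Real.pi * ((n : ℝ) + 1) ^ 2 * t)
        ≤ 2 * 1 * (x * x ^ n) := by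
          gcongr
          exact Real.abs_cos_le_one _
      _ = 2 * x * x ^ n := by ring
  rw [Real.norm_eq_abs] at key
  refine key.trans ?_
  have : (1 - x)⁻¹ ≤ 2 := by
    rw [inv_le_comm₀ (by linarith) (by norm_num)]
    linarith
  nlinarith

/-- This is Poisson summation: the functional equation turns the theta series at `1/s²` with a shift
into the one at `s²` with a phase. -/
lemma hasSum_rho (c : ℝ) {s : ℝ} (hs : 0 < s) :
    HasSum (fun k : ℤ => rho s (k + c)) (s * HurwitzZeta.cosKernel c (s ^ 2)) := by
  have h := HurwitzZeta.hasSum_int_evenKernel c (t := 1 / s ^ 2) (by positivity)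
  rw [HurwitzZeta.evenKernel_functional_equation] at h
  convert h using 1
  · ext k
    unfold rho
    congr 1
    field_simp
  · rw [one_div_one_div, ← Real.sqrt_eq_rpow, Real.sqrt_div zero_le_one, Real.sqrt_one,
      Real.sqrt_sq hs.le, one_div_one_div]

lemma summable_rho (c : ℝ) {s : ℝ} (hs : 0 < s) : Summable (fun k : ℤ => rho s (k + c)) :=
  (hasSum_rho c hs).summable

/-- The error is expressed through a lower bound `w` for the width, so that one quantity `exp(-πw²)`
serves for all the lattice sums of the reduction. -/
lemma tsum_rho_le (c : ℝ) {s w : ℝ} (hw : 1 ≤ w) (hs : w ≤ s) :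
    ∑' k : ℤ, rho s (k + c) ≤ s * (1 + 4 * Real.exp (-Real.pi * w ^ 2)) := by
  rw [(hasSum_rho c (by linarith)).tsum_eq]
  have h := (abs_le.1 (abs_cosKernel_sub_one_le c (t := s ^ 2) (by nlinarith))).2
  have h2 : Real.exp (-Real.pi * s ^ 2) ≤ Real.exp (-Real.pi * w ^ 2) := by
    apply Real.exp_le_exp.2
    have : w ^ 2 ≤ s ^ 2 := by gcongr
    nlinarith [Real.pi_pos]
  apply mul_le_mul_of_nonneg_left _ (by linarith)
  linarith

lemma le_tsum_rho (c : ℝ) {s w : ℝ} (hw : 1 ≤ w) (hs : w ≤ s) :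
    s * (1 - 4 * Real.exp (-Real.pi * w ^ 2)) ≤ ∑' k : ℤ, rho s (k + c) := by
  rw [(hasSum_rho c (by linarith)).tsum_eq]
  have h := (abs_le.1 (abs_cosKernel_sub_one_le c (t := s ^ 2) (by nlinarith))).1
  have h2 : Real.exp (-Real.pi * s ^ 2) ≤ Real.exp (-Real.pi * w ^ 2) := by
    apply Real.exp_le_exp.2
    have : w ^ 2 ≤ s ^ 2 := by gcongr
    nlinarith [Real.pi_pos]
  apply mul_le_mul_of_nonneg_left _ (by linarith)
  linarith

/-- The density of `D_s`, as an extended nonnegative real. -/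
def dens (s x : ℝ) : ENNReal := ENNReal.ofReal (rho s x / s)

@[fun_prop]
lemma measurable_dens (s : ℝ) : Measurable (dens s) := by
  unfold dens; fun_prop

lemma contGaussian_eq {s : ℝ} (hs : 0 < s) : contGaussian s = volume.withDensity (dens s) := by
  have hv : (s ^ 2 / (2 * Real.pi)).toNNReal ≠ 0 := by
    simp only [ne_eq, Real.toNNReal_eq_zero, not_le]; positivity
  rw [contGaussian, gaussianReal_of_var_ne_zero _ hv]
  congr 1
  ext x
  rw [gaussianPDF, dens, gaussianPDFReal, Real.coe_toNNReal _ (by positivity), rho]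
  congr 1
  have h1 : 2 * Real.pi * (s ^ 2 / (2 * Real.pi)) = s ^ 2 := by field_simp
  rw [h1, Real.sqrt_sq hs.le, sub_zero, div_eq_inv_mul (Real.exp _)]
  congr 2
  have := Real.pi_pos.ne'
  field_simp

lemma lintegral_contGaussian {s : ℝ} (hs : 0 < s) {f : ℝ → ENNReal} (hf : Measurable f) :
    ∫⁻ x, f x ∂contGaussian s = ∫⁻ x, dens s x * f x := by
  rw [contGaussian_eq hs, lintegral_withDensity_eq_lintegral_mul _ (measurable_dens s) hf]
  rfl

lemma contGaussian_map_mul (s c : ℝ) :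
    (contGaussian s).map (c * ·) = contGaussian (c * s) := by
  rw [contGaussian, gaussianReal_map_const_mul, contGaussian, mul_zero]
  congr 1
  ext
  simp only [NNReal.coe_mul, NNReal.coe_mk]
  rw [Real.coe_toNNReal _ (by positivity), Real.coe_toNNReal _ (by positivity)]
  ring

/-- Completing the square in a product of two Gaussian functions. -/
lemma rho_mul_rho {ρ α : ℝ} (hρ : 0 < ρ) (hα : 0 < α) (y b t x : ℝ) :
    rho ρ (y - x) * rho α (b - x * t) =
      rho (√(α ^ 2 + t ^ 2 * ρ ^ 2)) (b - y * t) *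
        rho (ρ * α / √(α ^ 2 + t ^ 2 * ρ ^ 2))
          (x - (y + t * ρ ^ 2 * (b - y * t) / (α ^ 2 + t ^ 2 * ρ ^ 2))) := by
  have h0 : 0 < α ^ 2 + t ^ 2 * ρ ^ 2 := by positivity
  have h1 := Real.sq_sqrt h0.le
  have h2 : 0 < √(α ^ 2 + t ^ 2 * ρ ^ 2) := Real.sqrt_pos.2 h0
  unfold rho
  rw [← Real.exp_add, ← Real.exp_add]
  congr 1
  simp only [div_pow, mul_pow, h1]
  field_simp
  ring

/-- Summing a Gaussian in `b - x t` over `x ∈ (1/q)ℤ` with Gaussian weights around `y` yields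
nearly a wider Gaussian in `b - y t`. -/
lemma le_tsum_dens_mul_dens {ρ α w : ℝ} {q : ℕ} (hq : 0 < q) (hρ : 0 < ρ) (hα : 0 < α)
    (hw : 1 ≤ w) (t y b : ℝ) (h : w ≤ q * (ρ * α / √(α ^ 2 + t ^ 2 * ρ ^ 2))) :
    ENNReal.ofReal (1 - 4 * Real.exp (-Real.pi * w ^ 2)) *
        dens (√(α ^ 2 + t ^ 2 * ρ ^ 2)) (b - y * t) ≤
      ∑' z : ℤ, (q : ENNReal)⁻¹ * dens ρ (y - z / q) * dens α (b - z / q * t) := by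
  set η := √(α ^ 2 + t ^ 2 * ρ ^ 2) with hη
  have hη0 : 0 < η := Real.sqrt_pos.2 (by positivity)
  -- As a function of `x = z/q`, the product of the two Gaussians is a Gaussian of width `τ` centred
  -- at `d`. In units of `1/q` its width is `q * τ`, which hypothesis `h` keeps above `w`.
  set τ := ρ * α / η with hτ
  have hτ0 : 0 < τ := by positivity
  have hq' : (0 : ℝ) < q := by exact_mod_cast hq
  set d := y + t * ρ ^ 2 * (b - y * t) / (α ^ 2 + t ^ 2 * ρ ^ 2) with hd
  have hterm : ∀ z : ℤ, (q : ENNReal)⁻¹ * dens ρ (y - z / q) * dens α (b - z / q * t) =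
      ENNReal.ofReal (rho η (b - y * t) / (q * ρ * α) * rho (q * τ) (z + -(q * d))) := by
    intro z
    have e1 : rho (q * τ) (z + -(q * d)) = rho τ (z / q - d) := by
      unfold rho
      congr 3
      field_simp
      ring
    have e2 := rho_mul_rho hρ hα y b t (z / q)
    rw [← hη, ← hd, ← hτ] at e2
    have e3 : (q : ENNReal)⁻¹ = ENNReal.ofReal ((q : ℝ)⁻¹) := by
      rw [ENNReal.ofReal_inv_of_pos hq', ENNReal.ofReal_natCast]
    have := rho_pos ρ (y - z / q)
    have := rho_pos α (b - z / q * t)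
    rw [dens, dens, e3, ← ENNReal.ofReal_mul (by positivity), ← ENNReal.ofReal_mul (by positivity),
      e1]
    congr 1
    calc _ = (rho ρ (y - z / q) * rho α (b - z / q * t)) / (q * ρ * α) := by field_simp
      _ = _ := by rw [e2]; ring
  have hpos := rho_pos η (b - y * t)
  simp_rw [hterm]
  rw [← ENNReal.ofReal_tsum_of_nonneg (fun z => by have := rho_pos (q * τ) (z + -(q * d)); positivity)
    ((summable_rho _ (by positivity)).mul_left _), tsum_mul_left, dens,
    ← ENNReal.ofReal_mul' (by positivity)]
  apply ENNReal.ofReal_le_ofReal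
  have h1 := le_tsum_rho (-(q * d)) hw h
  -- The lattice sum contributes about `q * τ = q * ρ * α / η`; against the prefactor `1 / (q * ρ *
  -- α)` this leaves the normalisation `1 / η`.
  calc _ = rho η (b - y * t) / (q * ρ * α) *
        (q * τ * (1 - 4 * Real.exp (-Real.pi * w ^ 2))) := by
        rw [hτ]; field_simp
    _ ≤ _ := by gcongr

/-- The Gaussian sums over `(1/q)ℤ` are nearly constant. -/
lemma le_tsum_dens {α w : ℝ} {q : ℕ} (hq : 0 < q) (hα : 0 < α)
    (hw : 1 ≤ w) (b : ℝ) (h : w ≤ q * α) :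
    ENNReal.ofReal (1 - 4 * Real.exp (-Real.pi * w ^ 2)) ≤
      ∑' z : ℤ, (q : ENNReal)⁻¹ * dens α (b - z / q) := by
  have hq' : (0 : ℝ) < q := by exact_mod_cast hq
  have e3 : (q : ENNReal)⁻¹ = ENNReal.ofReal ((q : ℝ)⁻¹) := by
    rw [ENNReal.ofReal_inv_of_pos hq', ENNReal.ofReal_natCast]
  have hterm : ∀ z : ℤ, (q : ENNReal)⁻¹ * dens α (b - z / q) =
      ENNReal.ofReal (1 / (q * α) * rho (q * α) (z + -(q * b))) := by
    intro z
    have e1 : rho (q * α) (z + -(q * b)) = rho α (b - z / q) := by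
      rw [← rho_neg]
      unfold rho
      congr 3
      field_simp
      ring
    rw [dens, e3, ← ENNReal.ofReal_mul (by positivity), e1]
    congr 1
    field_simp
  simp_rw [hterm]
  rw [← ENNReal.ofReal_tsum_of_nonneg
    (fun z => by have := rho_pos (q * α) (z + -(q * b)); positivity)
    ((summable_rho _ (by positivity)).mul_left _), tsum_mul_left]
  apply ENNReal.ofReal_le_ofReal
  have h1 := le_tsum_rho (-(q * b)) hw h
  calc _ = 1 / (q * α) * (q * α * (1 - 4 * Real.exp (-Real.pi * w ^ 2))) := by field_simp
    _ ≤ _ := by gcongr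

/-- The event that rejection sampling with two Gaussians accepts. -/
lemma contGaussian_prod_radius {t : ℝ} (ht : 0 ≤ t) :
    ((contGaussian 1).prod (contGaussian 1)) {g | t < g.1 ^ 2 + g.2 ^ 2} =
      ENNReal.ofReal (Real.exp (-Real.pi * t)) := by
  rw [contGaussian_eq one_pos, prod_withDensity (measurable_dens 1) (measurable_dens 1),
    withDensity_apply _ (measurableSet_lt (by fun_prop) (by fun_prop)),
    ← lintegral_indicator (measurableSet_lt (by fun_prop) (by fun_prop)),
    ← Measure.volume_eq_prod, ← lintegral_comp_polarCoord_symm]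
  -- The density depends on the radius only, so in polar coordinates the angle contributes `2π`, and
  -- `r exp(-πr²)` has the antiderivative `-exp(-πr²)/(2π)`.
  have hpol : ∀ p : ℝ × ℝ, (polarCoord.symm p).1 ^ 2 + (polarCoord.symm p).2 ^ 2 = p.1 ^ 2 := by
    intro p
    simp only [polarCoord_symm_apply]
    nlinarith [Real.sin_sq_add_cos_sq p.2]
  have hint : ∀ p ∈ polarCoord.target, ENNReal.ofReal p.1 •
      ({g : ℝ × ℝ | t < g.1 ^ 2 + g.2 ^ 2}.indicator (fun z => dens 1 z.1 * dens 1 z.2)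
        (polarCoord.symm p)) =
      (Set.Ioi √t).indicator (fun r => ENNReal.ofReal (r * Real.exp (-Real.pi * r ^ 2))) p.1 := by
    intro p hp
    have hp1 : 0 < p.1 := by
      simp only [polarCoord_target, Set.mem_prod, Set.mem_Ioi] at hp; exact hp.1
    simp only [Set.indicator_apply, Set.mem_ofPred_eq, hpol, Set.mem_Ioi, Real.sqrt_lt' hp1]
    split_ifs with h
    · rw [smul_eq_mul, dens, dens, ← ENNReal.ofReal_mul (by positivity [rho_pos 1 (polarCoord.symm p).1]),
        ← ENNReal.ofReal_mul hp1.le]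
      congr 2
      simp only [rho, div_one]
      rw [← Real.exp_add, ← hpol p]
      congr 1
      ring
    · simp
  rw [setLIntegral_congr_fun polarCoord.open_target.measurableSet hint, polarCoord_target,
    Measure.volume_eq_prod, ← Measure.prod_restrict,
    lintegral_prod _ (by
      apply Measurable.aemeasurable
      exact (Measurable.indicator (by fun_prop) measurableSet_Ioi).comp measurable_fst)]
  simp only [lintegral_const, Measure.restrict_apply MeasurableSet.univ, Set.univ_inter,
    Real.volume_Ioo]
  rw [lintegral_mul_const _ (Measurable.indicator (by fun_prop) measurableSet_Ioi),
    setLIntegral_indicator measurableSet_Ioi,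
    Set.inter_eq_left.2 (Set.Ioi_subset_Ioi (Real.sqrt_nonneg t))]
  have hderiv : ∀ x ∈ Set.Ici √t, HasDerivAt
      (fun r : ℝ => -(1 / (2 * Real.pi)) * Real.exp (-Real.pi * r ^ 2))
      (x * Real.exp (-Real.pi * x ^ 2)) x := by
    intro x _
    have h := (((hasDerivAt_pow 2 x).const_mul (-Real.pi)).exp).const_mul (-(1 / (2 * Real.pi)))
    refine h.congr_deriv ?_
    have := mul_inv_cancel₀ Real.pi_pos.ne'
    simp only [Nat.cast_ofNat, Nat.add_one_sub_one, pow_one, one_div, mul_inv]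
    linear_combination (x * Real.exp (-Real.pi * x ^ 2)) * this
  have hlim : Tendsto (fun r : ℝ => -(1 / (2 * Real.pi)) * Real.exp (-Real.pi * r ^ 2)) atTop
      (nhds (-(1 / (2 * Real.pi)) * 0)) := by
    apply Tendsto.const_mul
    apply Real.tendsto_exp_atBot.comp
    exact (tendsto_pow_atTop two_ne_zero).const_mul_atTop_of_neg (by linarith [Real.pi_pos])
  have hnn : ∀ x ∈ Set.Ioi √t, 0 ≤ x * Real.exp (-Real.pi * x ^ 2) := by
    intro x hx
    have : 0 ≤ x := (Real.sqrt_nonneg t).trans (le_of_lt hx)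
    positivity
  rw [← ofReal_integral_eq_lintegral_ofReal
      (integrableOn_Ioi_deriv_of_nonneg' hderiv hnn hlim)
      ((ae_restrict_iff' measurableSet_Ioi).2 (Eventually.of_forall hnn)),
    integral_Ioi_of_hasDerivAt_of_nonneg' hderiv hnn hlim, ← ENNReal.ofReal_mul']
  · rw [Real.sq_sqrt ht]
    congr 1
    have := Real.pi_pos.ne'
    linear_combination Real.exp (-Real.pi * t) * mul_inv_cancel₀ this
  · linarith [Real.pi_pos]

/-! ### Running programs -/

/-- Started in the state `s`, the program `P` terminates in the state `s'` within `B` steps. -/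
def Runs (ω : Tape) (P : Prog) (s s' : State) (B : ℕ) : Prop :=
  ∃ t ≤ B, ∀ K, (step ω)^[t] (P :: K, s) = (K, s')

section Runs

variable {ω : Tape} {P Q : Prog} {s s' s'' : State} {t : Cond} {A B : ℕ}

lemma Runs.mono (h : Runs ω P s s' A) (hAB : A ≤ B) : Runs ω P s s' B := by
  obtain ⟨u, hu, h⟩ := h
  exact ⟨u, hu.trans hAB, h⟩

lemma Runs.instr (ω : Tape) (c : Instr) (s : State) : Runs ω (.instr c) s (c.exec ω s) 1 :=
  ⟨1, le_rfl, fun _ => rfl⟩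

lemma Runs.seq (h1 : Runs ω P s s' A) (h2 : Runs ω Q s' s'' B) :
    Runs ω (.seq P Q) s s'' (A + B + 1) := by
  obtain ⟨u, hu, h1⟩ := h1
  obtain ⟨v, hv, h2⟩ := h2
  refine ⟨v + u + 1, by omega, fun K => ?_⟩
  rw [Function.iterate_succ_apply]
  change (step ω)^[v + u] (P :: Q :: K, s) = _
  rw [Function.iterate_add_apply, h1, h2]

lemma Runs.ite (hP : t.Holds s → Runs ω P s s' A) (hQ : ¬ t.Holds s → Runs ω Q s s' A) :
    Runs ω (.ite t P Q) s s' (A + 1) := by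
  by_cases h : t.Holds s
  · obtain ⟨u, hu, h1⟩ := hP h
    refine ⟨u + 1, by omega, fun K => ?_⟩
    rw [Function.iterate_succ_apply]
    simp only [step, h, if_true, h1]
  · obtain ⟨u, hu, h1⟩ := hQ h
    refine ⟨u + 1, by omega, fun K => ?_⟩
    rw [Function.iterate_succ_apply]
    simp only [step, h, if_false, h1]

lemma Runs.loop_exit (ω : Tape) (P : Prog) (h : ¬ t.Holds s) : Runs ω (.loop t P) s s 1 := by
  refine ⟨1, le_rfl, fun K => ?_⟩
  simp [step, h]

lemma Runs.loop_iter (h : t.Holds s) (h1 : Runs ω P s s' A) (h2 : Runs ω (.loop t P) s' s'' B) :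
    Runs ω (.loop t P) s s'' (A + 1 + B) := by
  obtain ⟨u, hu, h1⟩ := h1
  obtain ⟨v, hv, h2⟩ := h2
  refine ⟨v + u + 1, by omega, fun K => ?_⟩
  rw [Function.iterate_succ_apply]
  have : step ω (.loop t P :: K, s) = (P :: .loop t P :: K, s) := by simp [step, h]
  rw [this, Function.iterate_add_apply, h1, h2]

/-- A sequence of instructions. -/
def block : Instr → List Instr → Prog
  | c, [] => .instr c
  | c, d :: l => .seq (.instr c) (block d l)

lemma Runs.block (ω : Tape) (c : Instr) (l : List Instr) (s : State) :
    Runs ω (block c l) s ((c :: l).foldl (fun s c => c.exec ω s) s) (2 * l.length + 1) := by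
  induction l generalizing c s with
  | nil => exact Runs.instr ω c s
  | cons d l ih =>
    refine ((Runs.instr ω c s).seq (ih d _)).mono ?_
    simp only [List.length_cons]
    omega

end Runs

/-! ### States given by lists of register values -/

/-- Replace an entry of a list, padding with zeros. -/
def padSet {α : Type*} [Zero α] : List α → ℕ → α → List α
  | [], 0, v => [v]
  | [], i + 1, v => 0 :: padSet [] i v
  | _ :: l, 0, v => v :: l
  | x :: l, i + 1, v => x :: padSet l i v

/-- With register files given by explicit lists, a register update becomes a computation on lists,
and the effect of straight-line code can mostly be checked by `rfl`. -/
lemma update_getD {α : Type*} [Zero α] (l : List α) (i : ℕ) (v : α) :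
    Function.update (fun j => l.getD j 0) i v = fun j => (padSet l i v).getD j 0 := by
  induction l generalizing i with
  | nil =>
    induction i with
    | zero => ext j; cases j <;> simp [padSet]
    | succ i ih =>
      ext j
      cases j with
      | zero => simp [padSet]
      | succ j =>
        have := congrFun ih j
        simpa [padSet, Function.update_apply] using this
  | cons x l ih =>
    cases i with
    | zero => ext j; cases j <;> simp [padSet]
    | succ i =>
      ext j
      cases j with
      | zero => simp [padSet]
      | succ j =>
        have := congrFun (ih i) j
        simpa [padSet, Function.update_apply] using this

/-- Contents of the index registers, of the real registers, of the memory, and the position on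
the tape. -/
structure Content : Type where
  il : List ℕ
  rl : List ℝ
  mem : ℕ → ℝ
  pos : ℕ

/-- The state with the given contents; all other registers hold `0`. -/
def Content.toState (s : Content) : State :=
  ⟨fun i => s.il.getD i 0, fun a => s.rl.getD a 0, s.mem, s.pos⟩

/-- Execution of an instruction in terms of the contents. -/
def Content.exec (ω : Tape) : Content → Instr → Content
  | ⟨il, rl, mem, pos⟩, .idxConst i c => ⟨padSet il i c, rl, mem, pos⟩
  | ⟨il, rl, mem, pos⟩, .idxAdd i j k => ⟨padSet il i (il.getD j 0 + il.getD k 0), rl, mem, pos⟩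
  | ⟨il, rl, mem, pos⟩, .idxSub i j k => ⟨padSet il i (il.getD j 0 - il.getD k 0), rl, mem, pos⟩
  | ⟨il, rl, mem, pos⟩, .regConst a c => ⟨il, padSet rl a c, mem, pos⟩
  | ⟨il, rl, mem, pos⟩, .regOfIdx a i => ⟨il, padSet rl a (il.getD i 0 : ℕ), mem, pos⟩
  | ⟨il, rl, mem, pos⟩, .regAdd a b c => ⟨il, padSet rl a (rl.getD b 0 + rl.getD c 0), mem, pos⟩
  | ⟨il, rl, mem, pos⟩, .regSub a b c => ⟨il, padSet rl a (rl.getD b 0 - rl.getD c 0), mem, pos⟩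
  | ⟨il, rl, mem, pos⟩, .regMul a b c => ⟨il, padSet rl a (rl.getD b 0 * rl.getD c 0), mem, pos⟩
  | ⟨il, rl, mem, pos⟩, .regDiv a b c => ⟨il, padSet rl a (rl.getD b 0 / rl.getD c 0), mem, pos⟩
  | ⟨il, rl, mem, pos⟩, .load a i => ⟨il, padSet rl a (mem (il.getD i 0)), mem, pos⟩
  | ⟨il, rl, mem, pos⟩, .store i a =>
      ⟨il, rl, Function.update mem (il.getD i 0) (rl.getD a 0), pos⟩
  | ⟨il, rl, mem, pos⟩, .unif a => ⟨il, padSet rl a (ω pos).1, mem, pos + 1⟩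
  | ⟨il, rl, mem, pos⟩, .gauss a => ⟨il, padSet rl a (ω pos).2, mem, pos + 1⟩

lemma Content.exec_toState (ω : Tape) (s : Content) (c : Instr) :
    c.exec ω s.toState = (s.exec ω c).toState := by
  cases c <;>
    simp only [Instr.exec, Content.exec, Content.toState, State.setIdx, State.setReg, update_getD]

lemma Content.foldl_exec_toState (ω : Tape) (l : List Instr) (s : Content) :
    l.foldl (fun s c => c.exec ω s) s.toState = (l.foldl (Content.exec ω) s).toState := by
  induction l generalizing s with
  | nil => rfl
  | cons c l ih => rw [List.foldl_cons, List.foldl_cons, exec_toState, ih]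

lemma Runs.block_of_eq {ω : Tape} {c : Instr} {l : List Instr} {s s' : Content}
    (h : (c :: l).foldl (Content.exec ω) s = s') :
    Runs ω (CLWE.block c l) s.toState s'.toState (2 * l.length + 1) := by
  rw [← h, ← Content.foldl_exec_toState]
  exact Runs.block ω c l _

/-! ### The random functions computed by the reduction -/

/-- The tape without its first `k` cells. -/
def shift (k : ℕ) (ω : Tape) : Tape := fun i => ω (k + i)

lemma shift_shift (j k : ℕ) (ω : Tape) : shift j (shift k ω) = shift (k + j) ω := by
  ext i <;> simp [shift, add_assoc]

@[simp] lemma shift_zero (ω : Tape) : shift 0 ω = ω := by ext i <;> simp [shift]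

/-- Add a random integer with `k` bits. -/
def addBits : ℕ → Tape → ℝ → ℝ
  | 0, _, x => x
  | k + 1, ω, x => addBits k (shift 1 ω) (if (ω 0).1 < 1 / 2 then x + 2 ^ k else x)

/-- One trial of rejection sampling from the discrete Gaussian of width `w` on
`(ℤ + c) ∩ [-2ᵇ, 2ᵇ)`, where `y` is the previously accepted value. -/
def trial (b : ℕ) (w c : ℝ) (ω : Tape) (y : ℝ) : ℝ :=
  if addBits (b + 1) ω (c - 2 ^ b) * addBits (b + 1) ω (c - 2 ^ b) <
      ((ω (b + 1)).2 * (ω (b + 1)).2 + (ω (b + 2)).2 * (ω (b + 2)).2) * w * w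
    then addBits (b + 1) ω (c - 2 ^ b) else y

/-- The last accepted value in `M` trials of rejection sampling. -/
def sampler (b : ℕ) (w c : ℝ) : ℕ → Tape → ℝ → ℝ
  | 0, _, y => y
  | M + 1, ω, y => sampler b w c M (shift (b + 3) ω) (trial b w c ω y)

/-- The fractional part, truncated to `0` outside of `[-B, B)`. -/
def truncFract (B x : ℝ) : ℝ := if -B ≤ x ∧ x < B then Int.fract x else 0

/-- The bits of `x` from `2ᵇ` down to `1` are removed. -/
def removeBits : ℕ → ℝ → ℝ
  | 0, x => if x < 1 then x else x - 1
  | b + 1, x => removeBits b (if x < 2 ^ (b + 1) then x else x - 2 ^ (b + 1))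

/-- Without a floor instruction, arguments out of range must be recognised from the result of the
bit removal. A negative number stays negative, and a number that is at least `2 ^ (b + 1)` stays at
least 1; two final tests therefore suffice. -/
lemma removeBits_neg (b : ℕ) {x : ℝ} (hx : x < 0) : removeBits b x < 0 := by
  induction b with
  | zero => simp [removeBits, hx.trans zero_lt_one, hx]
  | succ b ih =>
    rw [removeBits, if_pos (hx.trans (by positivity))]
    exact ih

lemma one_le_removeBits (b : ℕ) {x : ℝ} (hx : 2 ^ (b + 1) ≤ x) : 1 ≤ removeBits b x := by
  induction b generalizing x with
  | zero =>
    norm_num at hx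
    rw [removeBits, if_neg (by linarith)]
    linarith
  | succ b ih =>
    have h2 : (2 : ℝ) ^ (b + 1 + 1) = 2 ^ (b + 1) + 2 ^ (b + 1) := by ring
    have : (0 : ℝ) < 2 ^ (b + 1) := by positivity
    rw [removeBits, if_neg (by linarith)]
    exact ih (by linarith)

lemma removeBits_eq_fract (b : ℕ) {x : ℝ} (h0 : 0 ≤ x) (hx : x < 2 ^ (b + 1)) :
    removeBits b x = Int.fract x := by
  induction b generalizing x with
  | zero =>
    norm_num at hx
    rw [removeBits]
    split_ifs with h
    · exact (Int.fract_eq_self.2 ⟨h0, h⟩).symm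
    · rw [← Int.fract_sub_one, Int.fract_eq_self.2 ⟨by linarith, by linarith⟩]
  | succ b ih =>
    rw [removeBits]
    split_ifs with h
    · exact ih h0 h
    · have h2 : (2 : ℝ) ^ (b + 1 + 1) = 2 ^ (b + 1) + 2 ^ (b + 1) := by ring
      rw [ih (by linarith) (by linarith)]
      have : x - 2 ^ (b + 1) = x - ((2 ^ (b + 1) : ℤ) : ℝ) := by push_cast; rfl
      rw [this, Int.fract_sub_intCast]

/-- Adding the integer `2 ^ b` keeps the fractional part and moves the window `[-2ᵇ, 2ᵇ)` to the
range `[0, 2ᵇ⁺¹)` in which `removeBits` is exact. -/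
lemma truncFract_eq_removeBits (b : ℕ) (x : ℝ) :
    truncFract (2 ^ b) x =
      if removeBits b (x + 2 ^ b) < 0 then 0 else
        if removeBits b (x + 2 ^ b) < 1 then removeBits b (x + 2 ^ b) else 0 := by
  have h2 : (2 : ℝ) ^ (b + 1) = 2 ^ b + 2 ^ b := by ring
  rw [truncFract]
  by_cases h1 : x + 2 ^ b < 0
  · rw [if_neg (fun h => by linarith [h.1]), if_pos (removeBits_neg b h1)]
  by_cases h3 : x + 2 ^ b < 2 ^ (b + 1)
  · have : x + 2 ^ b = x + ((2 ^ b : ℤ) : ℝ) := by push_cast; rfl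
    rw [removeBits_eq_fract b (by linarith) h3, if_pos ⟨by linarith, by linarith⟩,
      if_neg (not_lt.2 (Int.fract_nonneg _)), if_pos (Int.fract_lt_one _), this,
      Int.fract_add_intCast]
  · have := one_le_removeBits b (not_lt.1 h3)
    rw [if_neg (fun h => by linarith [h.2]), if_neg (by linarith), if_neg (by linarith)]

lemma truncFract_mem (B x : ℝ) : truncFract B x ∈ Set.Ico (0 : ℝ) 1 := by
  unfold truncFract
  split_ifs
  · exact ⟨Int.fract_nonneg _, Int.fract_lt_one _⟩
  · simp

/-! ### The reduction as a program -/

/-- Double register 19, starting at 1, until it is at least register 22; count in register 21. -/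
def doublingLoop : Prog :=
  .loop (.regLt 19 22) (block (.regAdd 19 19 19) [.regAdd 21 21 4])

/-- An instruction without effect once the index register 5 holds `1`. -/
def nop : Prog := .instr (.idxConst 5 1)

/-- Replace register 18 by its fractional part, given the power of two `B` in register 13. -/
def fractProg : Prog :=
  .seq (block (.regAdd 19 13 24) [.regAdd 18 18 13])
    (.seq
      (.loop (.regLt 5 19)
        (.seq (.ite (.regLt 18 19) nop (.instr (.regSub 18 18 19))) (.instr (.regMul 19 19 5))))
      (.seq (.ite (.regLt 18 24) (.instr (.regConst 18 0)) nop)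
        (.ite (.regLt 18 4) nop (.instr (.regConst 18 0)))))

/-- Add random bits, of values from register 19 down to 1, to register 23. -/
def bitsLoop : Prog :=
  .loop (.regLt 5 19)
    (.seq (.instr (.unif 22))
      (.seq (.ite (.regLt 22 5) (.instr (.regAdd 23 23 19)) nop) (.instr (.regMul 19 19 5))))

/-- One trial of rejection sampling. -/
def trialProg : Prog :=
  .seq (block (.regSub 23 18 12) [.regAdd 19 12 24])
    (.seq bitsLoop
      (.seq (block (.gauss 22) [.regMul 22 22 22, .gauss 19, .regMul 19 19 19, .regAdd 22 22 19,
          .regMul 22 22 11, .regMul 22 22 11, .regMul 19 23 23])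
        (.seq (.ite (.regLt 19 22) (.instr (.regAdd 20 23 24)) nop) (.instr (.regAdd 21 21 4)))))

/-- Rejection sampling into register 20. -/
def samplerProg : Prog :=
  .seq (block (.regConst 20 0) [.regConst 21 0]) (.loop (.regLt 21 10) trialProg)

/-- Process one memory cell. -/
def cellProg : Prog :=
  .seq (block (.load 18 4) [.regDiv 18 18 6, .gauss 22])
    (.seq (.ite (.regLt 16 7) (.instr (.regMul 22 14 22)) (.instr (.regMul 22 15 22)))
      (.seq (.instr (.regAdd 18 18 22))
        (.seq fractProg
          (.seq samplerProg
            (.seq (.ite (.regLt 16 7) (block (.regDiv 18 20 11) [.regAdd 16 16 4])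
                (block (.regConst 16 0) [.idxConst 5 1]))
              (block (.store 4 18) [.idxAdd 4 4 5, .regOfIdx 17 4]))))))

/-- The parameters of the reduction are computed. -/
def setupProg : Prog :=
  .seq (block (.regConst 4 1) [.regConst 5 (1 / 2), .idxConst 5 1, .regOfIdx 6 3, .regOfIdx 7 1,
      .regOfIdx 17 2, .regAdd 8 7 4, .regMul 8 8 17, .regMul 9 7 17, .regConst 19 1,
      .regOfIdx 22 0, .regConst 21 0])
    (.seq doublingLoop
      (.seq (block (.regMul 21 21 21) [.regAdd 9 9 21, .regAdd 9 9 4, .regConst 10 400,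
          .regMul 10 10 9, .regMul 10 10 9, .regDiv 11 2 0, .regDiv 15 1 6, .regDiv 14 15 0,
          .regMul 22 9 11, .regAdd 22 22 4, .regConst 19 1, .regConst 21 0])
        (.seq doublingLoop
          (.seq (block (.regAdd 12 19 24) [.regMul 22 9 15, .regAdd 22 22 4, .regAdd 22 22 4,
              .regConst 19 1, .regConst 21 0])
            (.seq doublingLoop
              (block (.regAdd 13 19 24) [.regConst 16 0, .regConst 17 0, .regConst 23 0]))))))

/-- All scratch registers are reset to `0`. -/
def cleanupProg : Prog :=
  block (.idxConst 4 0) [.idxConst 5 0, .regConst 4 0, .regConst 5 0, .regConst 6 0,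
    .regConst 7 0, .regConst 8 0, .regConst 9 0, .regConst 10 0, .regConst 11 0, .regConst 12 0,
    .regConst 13 0, .regConst 14 0, .regConst 15 0, .regConst 16 0, .regConst 17 0,
    .regConst 18 0, .regConst 19 0, .regConst 20 0, .regConst 21 0, .regConst 22 0,
    .regConst 23 0, .regConst 24 0]

/-- The reduction from LWE to CLWE. -/
def reduction : Prog :=
  .seq setupProg (.seq (.loop (.regLt 17 8) cellProg) cleanupProg)

/-! ### Correctness of the program -/

section Correctness

variable {ω : Tape} {il : List ℕ} {mem : ℕ → ℝ} {p : ℕ}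
  {r σ γ β q n T K M w N B ρ α j t x h y c u d : ℝ}

/-- The contents of the real registers. -/
def regs (r σ γ β q n T K M w N B ρ α j t x h y c u d : ℝ) : List ℝ :=
  [r, σ, γ, β, 1, 1 / 2, q, n, T, K, M, w, N, B, ρ, α, j, t, x, h, y, c, u, d, 0]

lemma runs_nop (ω : Tape) (l m n q a : ℕ) (rl : List ℝ) (mem : ℕ → ℝ) (p : ℕ) :
    Runs ω nop (Content.toState ⟨[l, m, n, q, a, 1], rl, mem, p⟩)
      (Content.toState ⟨[l, m, n, q, a, 1], rl, mem, p⟩) 1 :=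
  Runs.block_of_eq (c := .idxConst 5 1) (l := []) rfl

lemma Runs.instr_of_eq {ω : Tape} {c : Instr} {s s' : Content} (h : s.exec ω c = s') :
    Runs ω (.instr c) s.toState s'.toState 1 :=
  Runs.block_of_eq (c := c) (l := []) h

/-- A round costs one test and a block of three steps. The second hypothesis excludes an early exit;
the starting exponent `i` is free for the sake of the induction. -/
lemma runs_doublingLoop (k : ℕ) (i : ℕ) (hk : u ≤ 2 ^ (i + k))
    (hk' : ∀ i' < i + k, (2 : ℝ) ^ i' < u) :
    Runs ω doublingLoop
      (Content.toState ⟨il, regs r σ γ β q n T K M w N B ρ α j t x (2 ^ i) y i u d, mem, p⟩)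
      (Content.toState ⟨il, regs r σ γ β q n T K M w N B ρ α j t x (2 ^ (i + k)) y (i + k : ℕ) u d,
        mem, p⟩) (4 * k + 1) := by
  induction k generalizing i with
  | zero => exact Runs.loop_exit ω _ (show ¬ ((2 : ℝ) ^ i < u) from not_lt.2 hk)
  | succ k ih =>
    have e : i + (k + 1) = i + 1 + k := by ring
    rw [e] at hk hk' ⊢
    refine (Runs.loop_iter ?_
      (Runs.block_of_eq (s' := ⟨il, regs r σ γ β q n T K M w N B ρ α j t x (2 ^ (i + 1)) y
        (i + 1 : ℕ) u d, mem, p⟩) ?_) (ih (i + 1) hk hk')).mono ?_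
    · exact hk' i (by omega)
    · rw [pow_succ, mul_two, Nat.cast_add_one]
      rfl
    · simp only [List.length_cons, List.length_nil]
      omega

variable {l m' n' q' a : ℕ}

/-- Register 5 holds `1/2` and has two roles: it is the factor that halves register 19, and the
bound at which the loop stops once the bit of value 1 has been treated. -/
lemma runs_removeBits (b : ℕ) (x : ℝ) :
    Runs ω (.loop (.regLt 5 19)
        (.seq (.ite (.regLt 18 19) nop (.instr (.regSub 18 18 19))) (.instr (.regMul 19 19 5))))
      (Content.toState ⟨[l, m', n', q', a, 1],
        regs r σ γ β q n T K M w N B ρ α j t x (2 ^ b) y c u d, mem, p⟩)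
      (Content.toState ⟨[l, m', n', q', a, 1],
        regs r σ γ β q n T K M w N B ρ α j t (removeBits b x) (1 / 2) y c u d, mem, p⟩)
      (5 * b + 6) := by
  have body : ∀ (b : ℕ) (x : ℝ),
      Runs ω (.seq (.ite (.regLt 18 19) nop (.instr (.regSub 18 18 19))) (.instr (.regMul 19 19 5)))
      (Content.toState ⟨[l, m', n', q', a, 1],
        regs r σ γ β q n T K M w N B ρ α j t x (2 ^ b) y c u d, mem, p⟩)
      (Content.toState ⟨[l, m', n', q', a, 1],
        regs r σ γ β q n T K M w N B ρ α j t (if x < 2 ^ b then x else x - 2 ^ b)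
          (2 ^ b * (1 / 2)) y c u d, mem, p⟩) 4 := by
    intro b x
    refine Runs.seq (A := 2) (B := 1) (s' := Content.toState ⟨[l, m', n', q', a, 1],
        regs r σ γ β q n T K M w N B ρ α j t (if x < 2 ^ b then x else x - 2 ^ b)
          (2 ^ b) y c u d, mem, p⟩) (Runs.ite (A := 1) ?_ ?_) (Runs.instr_of_eq ?_)
    · intro h
      rw [if_pos (show x < 2 ^ b from h)]
      exact runs_nop ..
    · intro h
      rw [if_neg (show ¬ (x < 2 ^ b) from h)]
      exact Runs.instr_of_eq rfl
    · rfl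
  induction b generalizing x with
  | zero =>
    refine (Runs.loop_iter ?_ (body 0 x)
      (s'' := Content.toState ⟨[l, m', n', q', a, 1],
        regs r σ γ β q n T K M w N B ρ α j t (removeBits 0 x) (1 / 2) y c u d, mem, p⟩)
      (B := 1) ?_).mono (by omega)
    · exact (show (1 / 2 : ℝ) < 2 ^ 0 by norm_num)
    rw [removeBits, pow_zero, one_mul]
    exact Runs.loop_exit ω _ (show ¬ ((1 / 2 : ℝ) < 1 / 2) from lt_irrefl _)
  | succ b ih =>
    have h1 : (1 / 2 : ℝ) < 2 ^ (b + 1) := by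
      have : (1 : ℝ) ≤ 2 ^ (b + 1) := one_le_pow₀ (by norm_num)
      linarith
    refine (Runs.loop_iter ?_ (body (b + 1) x) (B := 5 * b + 6) ?_).mono (by omega)
    · exact h1
    have e : (2 : ℝ) ^ (b + 1) * (1 / 2) = 2 ^ b := by ring
    rw [e, removeBits]
    exact ih _

lemma runs_fractProg (b : ℕ) (x : ℝ) :
    Runs ω fractProg
      (Content.toState ⟨[l, m', n', q', a, 1],
        regs r σ γ β q n T K M w N (2 ^ b) ρ α j t x h y c u d, mem, p⟩)
      (Content.toState ⟨[l, m', n', q', a, 1],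
        regs r σ γ β q n T K M w N (2 ^ b) ρ α j t (truncFract (2 ^ b) x) (1 / 2) y c u d, mem, p⟩)
      (5 * b + 16) := by
  rw [truncFract_eq_removeBits]
  refine ((Runs.block_of_eq (s' := ⟨[l, m', n', q', a, 1],
        regs r σ γ β q n T K M w N (2 ^ b) ρ α j t (x + 2 ^ b) (2 ^ b) y c u d, mem, p⟩) ?_).seq
      ((runs_removeBits b _).seq (Runs.seq (A := 2) (B := 2) (s' := Content.toState
        ⟨[l, m', n', q', a, 1], regs r σ γ β q n T K M w N (2 ^ b) ρ α j t
          (if removeBits b (x + 2 ^ b) < 0 then 0 else removeBits b (x + 2 ^ b)) (1 / 2)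
          y c u d, mem, p⟩) (Runs.ite ?_ ?_) (Runs.ite ?_ ?_)))).mono
    (by simp only [List.length_cons, List.length_nil]; omega)
  -- Registers are copied by adding register 24, which holds 0. Since `v + 0 = v` is not
  -- definitional for reals, the copied value is first generalised.
  · have key : ∀ v : ℝ, (2 : ℝ) ^ b + 0 = v → [.regAdd 19 13 24, .regAdd 18 18 13].foldl
        (Content.exec ω) ⟨[l, m', n', q', a, 1],
          regs r σ γ β q n T K M w N (2 ^ b) ρ α j t x h y c u d, mem, p⟩ =
        ⟨[l, m', n', q', a, 1], regs r σ γ β q n T K M w N (2 ^ b) ρ α j t (x + 2 ^ b) v y c u d,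
          mem, p⟩ := by
      rintro _ rfl
      rfl
    exact key _ (add_zero _)
  · intro h
    rw [if_pos (show removeBits b (x + 2 ^ b) < 0 from h)]
    exact Runs.instr_of_eq rfl
  · intro h
    rw [if_neg (show ¬ (removeBits b (x + 2 ^ b) < 0) from h)]
    exact runs_nop ..
  · intro h
    have h : (if removeBits b (x + 2 ^ b) < 0 then 0 else removeBits b (x + 2 ^ b)) < 1 := h
    split_ifs at h ⊢
    all_goals exact runs_nop ..
  · intro h
    have h : ¬ (if removeBits b (x + 2 ^ b) < 0 then 0 else removeBits b (x + 2 ^ b)) < 1 := h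
    split_ifs at h ⊢
    · norm_num at h
    · exact Runs.instr_of_eq rfl

/-- What remains in scratch registers is irrelevant to the later course of the program, so it is
left existentially quantified here and in the lemmas that follow. -/
lemma runs_bitsLoop (b : ℕ) (d u : ℝ) (p : ℕ) : ∃ u',
    Runs ω bitsLoop
      (Content.toState ⟨[l, m', n', q', a, 1],
        regs r σ γ β q n T K M w N B ρ α j t x (2 ^ b) y c u d, mem, p⟩)
      (Content.toState ⟨[l, m', n', q', a, 1],
        regs r σ γ β q n T K M w N B ρ α j t x (1 / 2) y c u' (addBits (b + 1) (shift p ω) d),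
        mem, p + (b + 1)⟩)
      (7 * b + 8) := by
  have body : ∀ (b : ℕ) (d u : ℝ) (p : ℕ),
      Runs ω (.seq (.instr (.unif 22))
          (.seq (.ite (.regLt 22 5) (.instr (.regAdd 23 23 19)) nop) (.instr (.regMul 19 19 5))))
      (Content.toState ⟨[l, m', n', q', a, 1],
        regs r σ γ β q n T K M w N B ρ α j t x (2 ^ b) y c u d, mem, p⟩)
      (Content.toState ⟨[l, m', n', q', a, 1],
        regs r σ γ β q n T K M w N B ρ α j t x (2 ^ b * (1 / 2)) y c (ω p).1
          (if (ω p).1 < 1 / 2 then d + 2 ^ b else d), mem, p + 1⟩) 6 := by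
    intro b d u p
    refine Runs.seq (A := 1) (B := 4) (s' := Content.toState ⟨[l, m', n', q', a, 1],
        regs r σ γ β q n T K M w N B ρ α j t x (2 ^ b) y c (ω p).1 d, mem, p + 1⟩)
      (Runs.instr_of_eq rfl) (Runs.seq (A := 2) (B := 1) (s' := Content.toState
        ⟨[l, m', n', q', a, 1], regs r σ γ β q n T K M w N B ρ α j t x (2 ^ b) y c (ω p).1
          (if (ω p).1 < 1 / 2 then d + 2 ^ b else d), mem, p + 1⟩) (Runs.ite (A := 1) ?_ ?_)
        (Runs.instr_of_eq ?_))
    · intro h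
      rw [if_pos (show (ω p).1 < 1 / 2 from h)]
      exact Runs.instr_of_eq rfl
    · intro h
      rw [if_neg (show ¬ ((ω p).1 < 1 / 2) from h)]
      exact runs_nop ..
    · rfl
  have e0 : ∀ p, (shift p ω 0).1 = (ω p).1 := fun p => by simp [shift]
  induction b generalizing d u p with
  | zero =>
    refine ⟨(ω p).1, (Runs.loop_iter ?_ (body 0 d u p)
      (s'' := Content.toState ⟨[l, m', n', q', a, 1],
        regs r σ γ β q n T K M w N B ρ α j t x (1 / 2) y c (ω p).1
          (addBits (0 + 1) (shift p ω) d), mem, p + (0 + 1)⟩)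
      (B := 1) ?_).mono (by omega)⟩
    · exact (show (1 / 2 : ℝ) < 2 ^ 0 by norm_num)
    rw [addBits, addBits, pow_zero, one_mul, e0]
    exact Runs.loop_exit ω _ (show ¬ ((1 / 2 : ℝ) < 1 / 2) from lt_irrefl _)
  | succ b ih =>
    have h1 : (1 / 2 : ℝ) < 2 ^ (b + 1) := by
      have : (1 : ℝ) ≤ 2 ^ (b + 1) := one_le_pow₀ (by norm_num)
      linarith
    obtain ⟨u', hu'⟩ := ih (if (ω p).1 < 1 / 2 then d + 2 ^ (b + 1) else d) (ω p).1 (p + 1)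
    refine ⟨u', (Runs.loop_iter ?_ (body (b + 1) d u p) (B := 7 * b + 8) ?_).mono (by omega)⟩
    · exact h1
    have e : (2 : ℝ) ^ (b + 1) * (1 / 2) = 2 ^ b := by ring
    have e3 : p + (b + 1 + 1) = p + 1 + (b + 1) := by ring
    rw [e, addBits, shift_shift, e0, e3]
    exact hu'

lemma runs_trialProg (b : ℕ) (h y c u d : ℝ) (p : ℕ) : ∃ h' u' d',
    Runs ω trialProg
      (Content.toState ⟨[l, m', n', q', a, 1],
        regs r σ γ β q n T K M w (2 ^ b) B ρ α j t x h y c u d, mem, p⟩)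
      (Content.toState ⟨[l, m', n', q', a, 1],
        regs r σ γ β q n T K M w (2 ^ b) B ρ α j t x h' (trial b w x (shift p ω) y) (c + 1) u' d',
        mem, p + (b + 3)⟩)
      (7 * b + 34) := by
  obtain ⟨u1, h1⟩ := runs_bitsLoop (ω := ω) (l := l) (m' := m') (n' := n') (q' := q') (a := a) (r := r)
    (σ := σ) (γ := γ) (β := β) (q := q) (n := n) (T := T) (K := K) (M := M) (w := w) (N := 2 ^ b)
    (B := B) (ρ := ρ) (α := α) (j := j) (t := t) (x := x) (y := y) (c := c) (mem := mem)
    b (x - 2 ^ b) u p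
  set e := addBits (b + 1) (shift p ω) (x - 2 ^ b) with he
  have e1 : (shift p ω (b + 1)).2 = (ω (p + (b + 1))).2 := rfl
  have e2 : (shift p ω (b + 2)).2 = (ω (p + (b + 1) + 1)).2 := rfl
  refine ⟨e * e, ((ω (p + (b + 1))).2 * (ω (p + (b + 1))).2 +
    (ω (p + (b + 1) + 1)).2 * (ω (p + (b + 1) + 1)).2) * w * w, e, ?_⟩
  refine ((Runs.block_of_eq (s' := ⟨[l, m', n', q', a, 1],
        regs r σ γ β q n T K M w (2 ^ b) B ρ α j t x (2 ^ b) y c u (x - 2 ^ b), mem, p⟩) ?_).seq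
      (h1.seq ((Runs.block_of_eq (s' := ⟨[l, m', n', q', a, 1],
        regs r σ γ β q n T K M w (2 ^ b) B ρ α j t x (e * e) y c
          (((ω (p + (b + 1))).2 * (ω (p + (b + 1))).2 +
            (ω (p + (b + 1) + 1)).2 * (ω (p + (b + 1) + 1)).2) * w * w) e, mem, p + (b + 3)⟩)
          ?_).seq (Runs.seq (A := 2) (B := 1) (s' := Content.toState ⟨[l, m', n', q', a, 1],
        regs r σ γ β q n T K M w (2 ^ b) B ρ α j t x (e * e) (trial b w x (shift p ω) y) c
          (((ω (p + (b + 1))).2 * (ω (p + (b + 1))).2 +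
            (ω (p + (b + 1) + 1)).2 * (ω (p + (b + 1) + 1)).2) * w * w) e, mem, p + (b + 3)⟩)
          (Runs.ite (A := 1) ?_ ?_) (Runs.instr_of_eq ?_))))).mono
    (by simp only [List.length_cons, List.length_nil]; omega)
  · have key : ∀ v : ℝ, (2 : ℝ) ^ b + 0 = v → [.regSub 23 18 12, .regAdd 19 12 24].foldl
        (Content.exec ω) ⟨[l, m', n', q', a, 1],
          regs r σ γ β q n T K M w (2 ^ b) B ρ α j t x h y c u d, mem, p⟩ =
        ⟨[l, m', n', q', a, 1], regs r σ γ β q n T K M w (2 ^ b) B ρ α j t x v y c u (x - 2 ^ b),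
          mem, p⟩ := by
      rintro _ rfl
      rfl
    exact key _ (add_zero _)
  · rfl
  · intro h
    have h : e * e < ((ω (p + (b + 1))).2 * (ω (p + (b + 1))).2 +
        (ω (p + (b + 1) + 1)).2 * (ω (p + (b + 1) + 1)).2) * w * w := h
    have e3 : trial b w x (shift p ω) y = e + 0 := by
      rw [trial, e1, e2, ← he, if_pos h, add_zero]
    rw [e3]
    exact Runs.instr_of_eq rfl
  · intro h
    have h : ¬ (e * e < ((ω (p + (b + 1))).2 * (ω (p + (b + 1))).2 +
        (ω (p + (b + 1) + 1)).2 * (ω (p + (b + 1) + 1)).2) * w * w) := h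
    have e3 : trial b w x (shift p ω) y = y := by
      rw [trial, e1, e2, ← he, if_neg h]
    rw [e3]
    exact runs_nop ..
  · rfl

end Correctness

/-- The value that the reduction computes from an entry `x` of some `a_i`. -/
def aCell (q w ρ : ℝ) (b b' M : ℕ) (x : ℝ) (ω : Tape) : ℝ :=
  sampler b w (truncFract (2 ^ b') (x / q + ρ * (ω 0).2)) M (shift 1 ω) 0 / w

/-- The value that the reduction computes from some `b_i`. -/
def bCell (q α : ℝ) (b' : ℕ) (x : ℝ) (ω : Tape) : ℝ :=
  truncFract (2 ^ b') (x / q + α * (ω 0).2)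

section Correctness

variable {ω : Tape} {il : List ℕ} {mem : ℕ → ℝ} {p : ℕ}
  {r σ γ β q n T K M w N B ρ α j t x h y c u d : ℝ} {l m' n' q' a : ℕ}

lemma runs_samplerLoop (b k i : ℕ) (h y u d : ℝ) (p : ℕ) : ∃ h' u' d',
    Runs ω (.loop (.regLt 21 10) trialProg)
      (Content.toState ⟨[l, m', n', q', a, 1],
        regs r σ γ β q n T K (i + k : ℕ) w (2 ^ b) B ρ α j t x h y i u d, mem, p⟩)
      (Content.toState ⟨[l, m', n', q', a, 1],
        regs r σ γ β q n T K (i + k : ℕ) w (2 ^ b) B ρ α j t x h'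
          (sampler b w x k (shift p ω) y) (i + k : ℕ) u' d', mem, p + k * (b + 3)⟩)
      (k * (7 * b + 35) + 1) := by
  induction k generalizing i h y u d p with
  | zero =>
    refine ⟨h, u, d, ?_⟩
    rw [zero_mul, zero_mul]
    exact Runs.loop_exit ω _ (show ¬ ((i : ℝ) < (i + 0 : ℕ)) from lt_irrefl _)
  | succ k ih =>
    obtain ⟨h1, u1, d1, hr1⟩ := runs_trialProg (ω := ω) (l := l) (m' := m') (n' := n') (q' := q')
      (a := a) (r := r) (σ := σ) (γ := γ) (β := β) (q := q) (n := n) (T := T) (K := K)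
      (M := (i + (k + 1) : ℕ)) (w := w) (B := B) (ρ := ρ) (α := α) (j := j) (t := t) (x := x)
      (mem := mem) b h y i u d p
    obtain ⟨h2, u2, d2, hr2⟩ := ih (i + 1) h1 (trial b w x (shift p ω) y) u1 d1 (p + (b + 3))
    refine ⟨h2, u2, d2, ?_⟩
    have e1 : i + 1 + k = i + (k + 1) := by ring
    have e2 : p + (b + 3) + k * (b + 3) = p + (k + 1) * (b + 3) := by ring
    rw [e1, e2, Nat.cast_add_one, ← shift_shift] at hr2
    refine (Runs.loop_iter ?_ hr1 hr2).mono ?_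
    · exact show (i : ℝ) < (i + (k + 1) : ℕ) by exact_mod_cast (by omega)
    · ring_nf
      omega

lemma runs_samplerProg (b k : ℕ) (h y c u d : ℝ) (p : ℕ) : ∃ h' u' d',
    Runs ω samplerProg
      (Content.toState ⟨[l, m', n', q', a, 1],
        regs r σ γ β q n T K k w (2 ^ b) B ρ α j t x h y c u d, mem, p⟩)
      (Content.toState ⟨[l, m', n', q', a, 1],
        regs r σ γ β q n T K k w (2 ^ b) B ρ α j t x h'
          (sampler b w x k (shift p ω) 0) k u' d', mem, p + k * (b + 3)⟩)
      (k * (7 * b + 35) + 5) := by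
  obtain ⟨h1, u1, d1, hr1⟩ := runs_samplerLoop (ω := ω) (l := l) (m' := m') (n' := n') (q' := q')
      (a := a) (r := r) (σ := σ) (γ := γ) (β := β) (q := q) (n := n) (T := T) (K := K)
      (w := w) (B := B) (ρ := ρ) (α := α) (j := j) (t := t) (x := x)
      (mem := mem) b k 0 h 0 u d p
  rw [Nat.zero_add, Nat.cast_zero] at hr1
  refine ⟨h1, u1, d1, ((Runs.block_of_eq rfl).seq hr1).mono ?_⟩
  simp only [List.length_cons, List.length_nil]
  omega

/-- The sampler also runs on the cells holding some `b_i`, where its result is discarded. Every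
memory cell therefore consumes the same number of tape cells, and the piece of tape belonging to
cell `i` starts at `i` times a fixed length. -/
lemma runs_cellProg (b b' k jn : ℕ) (x h y c u d : ℝ) (p : ℕ) : ∃ x' h' y' c' u' d',
    Runs ω cellProg
      (Content.toState ⟨[l, n', m', q', a, 1],
        regs r σ γ β q n' T K k w (2 ^ b) (2 ^ b') ρ α jn t x h y c u d, mem, p⟩)
      (Content.toState ⟨[l, n', m', q', a + 1, 1],
        regs r σ γ β q n' T K k w (2 ^ b) (2 ^ b') ρ α ((if jn < n' then jn + 1 else 0 : ℕ) : ℝ)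
          (a + 1 : ℕ) x' h' y' c' u' d',
        Function.update mem a (if jn < n' then aCell q w ρ b b' k (mem a) (shift p ω)
          else bCell q α b' (mem a) (shift p ω)), p + (1 + k * (b + 3))⟩)
      (k * (7 * b + 35) + 5 * b' + 50) := by
  set v := mem a / q + (if jn < n' then ρ else α) * (ω p).2 with hv
  set f := truncFract (2 ^ b') v with hf
  obtain ⟨h1, u1, d1, hr1⟩ := runs_samplerProg (ω := ω) (l := l) (m' := n') (n' := m') (q' := q')
      (a := a) (r := r) (σ := σ) (γ := γ) (β := β) (q := q) (n := n') (T := T) (K := K)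
      (w := w) (B := 2 ^ b') (ρ := ρ) (α := α) (j := jn) (t := t) (x := f)
      (mem := mem) b k (1 / 2) y c ((if jn < n' then ρ else α) * (ω p).2) d (p + 1)
  set y1 := sampler b w f k (shift (p + 1) ω) 0 with hy1
  refine ⟨if jn < n' then y1 / w else f, h1, y1, k, u1, d1, ?_⟩
  have e0 : (shift p ω 0).2 = (ω p).2 := by simp [shift]
  refine (Runs.seq (Runs.block_of_eq (s' := ⟨[l, n', m', q', a, 1],
        regs r σ γ β q n' T K k w (2 ^ b) (2 ^ b') ρ α jn t (mem a / q) h y c (ω p).2 d, mem,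
          p + 1⟩) ?_)
    (Runs.seq (s' := Content.toState ⟨[l, n', m', q', a, 1],
        regs r σ γ β q n' T K k w (2 ^ b) (2 ^ b') ρ α jn t (mem a / q) h y c
          ((if jn < n' then ρ else α) * (ω p).2) d, mem, p + 1⟩) (Runs.ite (A := 1) ?_ ?_)
    (Runs.seq (Runs.instr_of_eq (s' := ⟨[l, n', m', q', a, 1],
        regs r σ γ β q n' T K k w (2 ^ b) (2 ^ b') ρ α jn t v h y c
          ((if jn < n' then ρ else α) * (ω p).2) d, mem, p + 1⟩) ?_)
    (Runs.seq (runs_fractProg ..)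
    (Runs.seq hr1
    (Runs.seq (s' := Content.toState ⟨[l, n', m', q', a, 1],
        regs r σ γ β q n' T K k w (2 ^ b) (2 ^ b') ρ α ((if jn < n' then jn + 1 else 0 : ℕ) : ℝ) t
          (if jn < n' then y1 / w else f) h1 y1 k u1 d1, mem, p + 1 + k * (b + 3)⟩)
      (Runs.ite (A := 3) ?_ ?_)
      (Runs.block_of_eq ?_))))))).mono ?_
  · rfl
  · intro hh
    have hh : (jn : ℝ) < n' := hh
    rw [if_pos (by exact_mod_cast hh)]
    exact Runs.instr_of_eq rfl
  · intro hh
    have hh : ¬ ((jn : ℝ) < n') := hh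
    rw [if_neg (by exact_mod_cast hh)]
    exact Runs.instr_of_eq rfl
  · rfl
  · intro hh
    have hh : (jn : ℝ) < n' := hh
    rw [if_pos (by exact_mod_cast hh), if_pos (by exact_mod_cast hh), Nat.cast_add_one]
    exact Runs.block_of_eq rfl
  · intro hh
    have hh : ¬ ((jn : ℝ) < n') := hh
    rw [if_neg (by exact_mod_cast hh), if_neg (by exact_mod_cast hh), Nat.cast_zero]
    exact Runs.block_of_eq rfl
  · have e1 : (if jn < n' then aCell q w ρ b b' k (mem a) (shift p ω)
          else bCell q α b' (mem a) (shift p ω)) = if jn < n' then y1 / w else f := by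
      split_ifs with hh
      · rw [aCell, hy1, hf, hv, if_pos hh, e0, shift_shift]
      · rw [bCell, hf, hv, if_neg hh, e0]
    rw [e1, ← add_assoc]
    rfl
  · simp only [List.length_cons, List.length_nil]
    omega

/-- The memory after the reduction. -/
def newMem (q w ρ α : ℝ) (n b b' k : ℕ) (mem : ℕ → ℝ) (ω : Tape) (i : ℕ) : ℝ :=
  if i % (n + 1) < n then aCell q w ρ b b' k (mem i) (shift (i * (1 + k * (b + 3))) ω)
    else bCell q α b' (mem i) (shift (i * (1 + k * (b + 3))) ω)

/-- Register 16 tracks the position inside the current sample. This is its update rule, which needs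
no division. -/
lemma succ_mod_succ (i n : ℕ) :
    (i + 1) % (n + 1) = if i % (n + 1) < n then i % (n + 1) + 1 else 0 := by
  have h := Nat.mod_lt i (Nat.succ_pos n)
  rw [Nat.add_mod]
  split_ifs with h1
  · by_cases hn : n = 0
    · omega
    · rw [Nat.mod_eq_of_lt (a := 1) (by omega), Nat.mod_eq_of_lt (by omega)]
  · have h2 : i % (n + 1) = n := by
      have : i % (n + 1) < n + 1 := h
      omega
    by_cases hn : n = 0
    · subst hn; simp [Nat.mod_one]
    · rw [h2, Nat.mod_eq_of_lt (a := 1) (by omega), Nat.mod_self]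

lemma runs_cellLoop (b b' k len i : ℕ) (mem₀ : ℕ → ℝ) (x h y c u d : ℝ) :
    ∃ j' x' h' y' c' u' d',
    Runs ω (.loop (.regLt 17 8) cellProg)
      (Content.toState ⟨[l, n', m', q', i, 1],
        regs r σ γ β q n' (i + len : ℕ) K k w (2 ^ b) (2 ^ b') ρ α (i % (n' + 1) : ℕ) i x h y c u d,
        fun a => if a < i then newMem q w ρ α n' b b' k mem₀ ω a else mem₀ a,
        i * (1 + k * (b + 3))⟩)
      (Content.toState ⟨[l, n', m', q', i + len, 1],
        regs r σ γ β q n' (i + len : ℕ) K k w (2 ^ b) (2 ^ b') ρ α j' (i + len : ℕ)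
          x' h' y' c' u' d',
        fun a => if a < i + len then newMem q w ρ α n' b b' k mem₀ ω a else mem₀ a,
        (i + len) * (1 + k * (b + 3))⟩)
      (len * (k * (7 * b + 35) + 5 * b' + 51) + 1) := by
  induction len generalizing i x h y c u d with
  | zero =>
    refine ⟨(i % (n' + 1) : ℕ), x, h, y, c, u, d, ?_⟩
    rw [zero_mul]
    exact Runs.loop_exit ω _ (show ¬ ((i : ℝ) < (i + 0 : ℕ)) from lt_irrefl _)
  | succ len ih =>
    obtain ⟨x1, h1, y1, c1, u1, d1, hr1⟩ := runs_cellProg (ω := ω) (l := l) (m' := m') (n' := n')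
      (q' := q') (a := i) (r := r) (σ := σ) (γ := γ) (β := β) (q := q) (T := (i + (len + 1) : ℕ))
      (K := K) (w := w) (ρ := ρ) (α := α) (t := i)
      (mem := fun a => if a < i then newMem q w ρ α n' b b' k mem₀ ω a else mem₀ a)
      b b' k (i % (n' + 1)) x h y c u d (i * (1 + k * (b + 3)))
    obtain ⟨j2, x2, h2, y2, c2, u2, d2, hr2⟩ := ih (i + 1) x1 h1 y1 c1 u1 d1
    refine ⟨j2, x2, h2, y2, c2, u2, d2, ?_⟩
    have e1 : i + 1 + len = i + (len + 1) := by ring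
    rw [e1] at hr2
    have e2 : Function.update
        (fun a => if a < i then newMem q w ρ α n' b b' k mem₀ ω a else mem₀ a) i
        (if i % (n' + 1) < n' then aCell q w ρ b b' k
            ((fun a => if a < i then newMem q w ρ α n' b b' k mem₀ ω a else mem₀ a) i)
            (shift (i * (1 + k * (b + 3))) ω)
          else bCell q α b' ((fun a => if a < i then newMem q w ρ α n' b b' k mem₀ ω a
            else mem₀ a) i) (shift (i * (1 + k * (b + 3))) ω)) =
        fun a => if a < i + 1 then newMem q w ρ α n' b b' k mem₀ ω a else mem₀ a := by
      ext a
      rw [Function.update_apply]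
      simp only [lt_irrefl, if_false]
      by_cases ha : a = i
      · rw [if_pos ha, ha, if_pos (Nat.lt_succ_self i), newMem]
      · rw [if_neg ha]
        simp only [show a < i + 1 ↔ a < i by omega]
    have e3 : i * (1 + k * (b + 3)) + (1 + k * (b + 3)) = (i + 1) * (1 + k * (b + 3)) := by ring
    rw [e2, e3, ← succ_mod_succ] at hr1
    refine (Runs.loop_iter ?_ hr1 hr2).mono ?_
    · exact show (i : ℝ) < (i + (len + 1) : ℕ) by exact_mod_cast (by omega)
    · ring_nf
      omega

lemma runs_doublingLoop_clog {u : ℝ} :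
    Runs ω doublingLoop
      (Content.toState ⟨il, regs r σ γ β q n T K M w N B ρ α j t x 1 y 0 u d, mem, p⟩)
      (Content.toState ⟨il, regs r σ γ β q n T K M w N B ρ α j t x (2 ^ Nat.clog 2 ⌈u⌉₊) y
        (Nat.clog 2 ⌈u⌉₊) u d, mem, p⟩) (4 * Nat.clog 2 ⌈u⌉₊ + 1) := by
  have h := runs_doublingLoop (ω := ω) (il := il) (mem := mem) (p := p) (r := r) (σ := σ)
    (γ := γ) (β := β) (q := q) (n := n) (T := T) (K := K) (M := M) (w := w) (N := N) (B := B)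
    (ρ := ρ) (α := α) (j := j) (t := t) (x := x) (y := y) (u := u) (d := d)
    (Nat.clog 2 ⌈u⌉₊) 0 ?_ ?_
  · rw [Nat.zero_add, pow_zero, Nat.cast_zero] at h
    exact h
  · have h1 := (Nat.clog_le_iff_le_pow (b := 2) (by norm_num)).1 (le_refl (Nat.clog 2 ⌈u⌉₊))
    rw [Nat.zero_add]
    exact (Nat.ceil_le.1 h1).trans (by norm_cast)
  · intro i hi
    rw [Nat.zero_add] at hi
    have h1 : 2 ^ i < ⌈u⌉₊ := by
      by_contra hc
      exact absurd ((Nat.clog_le_iff_le_pow (b := 2) (by norm_num)).2 (not_lt.1 hc)) (by omega)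
    have := Nat.lt_ceil.1 h1
    exact_mod_cast this

/-- The distinguisher that runs next is only known to work from an initial state, in which all these
registers hold 0. -/
lemma runs_cleanup :
    Runs ω cleanupProg
      (Content.toState ⟨[l, n', m', q', a, 1], regs r σ γ β q n T K M w N B ρ α j t x h y c u d,
        mem, p⟩)
      (Content.toState ⟨[l, n', m', q', 0, 0],
        [r, σ, γ, β, 0, 0, 0, 0, 0, 0, 0, 0, 0, 0, 0, 0, 0, 0, 0, 0, 0, 0, 0, 0, 0], mem, p⟩)
      45 :=
  Runs.block_of_eq rfl

end Correctness

/-! ### The parameters of the reduction -/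

/-- The bit length of `λ`. -/
def Params.logLam (par : Params) : ℕ := Nat.clog 2 ⌈(par.lam : ℝ)⌉₊

/-- The parameter that controls tails and failure probabilities. -/
def Params.K (par : Params) : ℕ := par.n * par.m + par.logLam * par.logLam + 1

/-- The number of trials in rejection sampling. -/
def Params.trials (par : Params) : ℕ := 400 * par.K * par.K

/-- The width of the discrete Gaussians to be sampled. -/
def Params.w (par : Params) : ℝ := par.γ / par.r

/-- The width of the Gaussian noise that is added to `b/q`. -/
def Params.α (par : Params) : ℝ := par.σ / par.q

/-- The width of the Gaussian noise that is added to the entries of `a/q`. -/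
def Params.ρ (par : Params) : ℝ := par.α / par.r

/-- The discrete Gaussian samples are less than `2 ^ bitsN` in absolute value. -/
def Params.bitsN (par : Params) : ℕ := Nat.clog 2 ⌈par.K * par.w + 1⌉₊

/-- Fractional parts are computed for numbers less than `2 ^ bitsB` in absolute value. -/
def Params.bitsB (par : Params) : ℕ := Nat.clog 2 ⌈par.K * par.α + 1 + 1⌉₊

/-- The number of cells of the tape that are used for one memory cell. -/
def Params.chunk (par : Params) : ℕ := 1 + par.trials * (par.bitsN + 3)

/-- The output of the reduction. -/
def reduce (par : Params) (x : Samples par.n par.m) (ω : Tape) : Samples par.n par.m := fun i =>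
  (fun j => aCell par.q par.w par.ρ par.bitsN par.bitsB par.trials ((x i).1 j)
    (shift (j * par.chunk) (shift (i * ((par.n + 1) * par.chunk)) ω)),
  bCell par.q par.α par.bitsB (x i).2
    (shift (par.n * par.chunk) (shift (i * ((par.n + 1) * par.chunk)) ω)))

/-- A bound for the running time of the reduction. -/
def reductionTime (par : Params) : ℕ :=
  par.n.succ * par.m * (par.trials * (7 * par.bitsN + 35) + 5 * par.bitsB + 51) +
    4 * (par.logLam + par.bitsN + par.bitsB) + 200

/-- The contents of the initial state. -/
def initContent (par : Params) (mem : ℕ → ℝ) (pos : ℕ) : Content :=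
  ⟨[par.lam, par.n, par.m, par.q, 0, 0],
    [par.r, par.σ, par.γ, par.β, 0, 0, 0, 0, 0, 0, 0, 0, 0, 0, 0, 0, 0, 0, 0, 0, 0, 0, 0, 0, 0],
    mem, pos⟩

lemma initContent_toState (par : Params) (x : Samples par.n par.m) (pos : ℕ) :
    (initContent par (initMem x) pos).toState = { initState par x with pos := pos } := by
  unfold initContent Content.toState initState
  congr 1
  · ext i
    match i with
    | 0 | 1 | 2 | 3 | 4 | 5 => rfl
    | i + 6 => simp
  · ext i
    match i with
    | 0 | 1 | 2 | 3 => rfl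
    | i + 4 =>
      change List.getD (List.replicate 21 0) i 0 = 0
      rcases lt_or_ge i 21 with hi | hi
      · rw [List.getD_replicate _ hi]
      · rw [List.getD_eq_default _ _ (by simpa using hi)]

lemma initMem_reduce (par : Params) (x : Samples par.n par.m) (ω : Tape) :
    initMem (reduce par x ω) = fun a => if a < (par.n + 1) * par.m then
      newMem par.q par.w par.ρ par.α par.n par.bitsN par.bitsB par.trials (initMem x) ω a
      else initMem x a := by
  ext a
  have hdm := Nat.div_add_mod a (par.n + 1)
  have hiff : a / (par.n + 1) < par.m ↔ a < (par.n + 1) * par.m := by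
    rw [Nat.div_lt_iff_lt_mul (Nat.succ_pos _), mul_comm]
  by_cases ha : a < (par.n + 1) * par.m
  · have h1 := hiff.2 ha
    rw [if_pos ha, newMem]
    simp only [initMem, h1, dif_pos]
    split_ifs with h2
    · simp only [reduce, shift_shift]
      congr 2
      rw [← Params.chunk]
      conv_rhs => rw [← hdm]
      ring
    · simp only [reduce, shift_shift]
      congr 2
      have h3 := Nat.mod_lt a (Nat.succ_pos par.n)
      have h4 : a % (par.n + 1) = par.n := by
        have : a % (par.n + 1) < par.n + 1 := h3
        omega
      rw [h4] at hdm
      rw [← Params.chunk]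
      conv_rhs => rw [← hdm]
      ring
  · rw [if_neg ha, initMem, initMem, dif_neg (mt hiff.1 ha), dif_neg (mt hiff.1 ha)]

lemma runs_setup (ω : Tape) (par : Params) (mem : ℕ → ℝ) : ∃ h c u,
    Runs ω setupProg (initContent par mem 0).toState
      (Content.toState ⟨[par.lam, par.n, par.m, par.q, 0, 1],
        regs par.r par.σ par.γ par.β par.q par.n (par.n.succ * par.m : ℕ) par.K par.trials par.w
          (2 ^ par.bitsN) (2 ^ par.bitsB) par.ρ par.α 0 0 0 h 0 c u 0, mem, 0⟩)
      (4 * (par.logLam + par.bitsN + par.bitsB) + 120) := by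
  set l := par.logLam with hl
  -- These are the values left behind by the third doubling loop.
  refine ⟨2 ^ par.bitsB, par.bitsB, par.K * par.α + 1 + 1, ?_⟩
  have eK : (par.n : ℝ) * par.m + (l : ℝ) * l + 1 = par.K := by
    rw [Params.K]; push_cast; rfl
  have eM : (400 : ℝ) * par.K * par.K = par.trials := by
    rw [Params.trials]; push_cast; rfl
  have eT : ((par.n : ℝ) + 1) * par.m = (par.n.succ * par.m : ℕ) := by
    push_cast; rfl
  refine (Runs.seq (A := 23) (Runs.block_of_eq (s' := ⟨[par.lam, par.n, par.m, par.q, 0, 1],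
        regs par.r par.σ par.γ par.β par.q par.n (par.n.succ * par.m : ℕ) (par.n * par.m) 0 0
          0 0 0 0 0 par.m 0 1 0 0 par.lam 0, mem, 0⟩) ?_)
    (Runs.seq (A := 4 * l + 1) runs_doublingLoop_clog
    (Runs.seq (A := 25) (Runs.block_of_eq (s' := ⟨[par.lam, par.n, par.m, par.q, 0, 1],
        regs par.r par.σ par.γ par.β par.q par.n (par.n.succ * par.m : ℕ) par.K par.trials par.w
          0 0 par.ρ par.α 0 par.m 0 1 0 0 (par.K * par.w + 1) 0, mem, 0⟩) ?_)
    (Runs.seq (A := 4 * par.bitsN + 1) runs_doublingLoop_clog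
    (Runs.seq (A := 11) (Runs.block_of_eq (s' := ⟨[par.lam, par.n, par.m, par.q, 0, 1],
        regs par.r par.σ par.γ par.β par.q par.n (par.n.succ * par.m : ℕ) par.K par.trials par.w
          (2 ^ par.bitsN) 0 par.ρ par.α 0 par.m 0 1 0 0 (par.K * par.α + 1 + 1) 0, mem, 0⟩) ?_)
    (Runs.seq (A := 4 * par.bitsB + 1) runs_doublingLoop_clog
    (Runs.block_of_eq ?_))))))).mono ?_
  · rw [← eT]
    rfl
  · rw [← eM, ← eK]
    rfl
  · have key : ∀ v : ℝ, (2 : ℝ) ^ par.bitsN + 0 = v →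
        [.regAdd 12 19 24, .regMul 22 9 15, .regAdd 22 22 4, .regAdd 22 22 4, .regConst 19 1,
          .regConst 21 0].foldl (Content.exec ω) ⟨[par.lam, par.n, par.m, par.q, 0, 1],
        regs par.r par.σ par.γ par.β par.q par.n (par.n.succ * par.m : ℕ) par.K par.trials par.w
          0 0 par.ρ par.α 0 par.m 0 (2 ^ par.bitsN) 0 par.bitsN (par.K * par.w + 1) 0, mem, 0⟩ =
        ⟨[par.lam, par.n, par.m, par.q, 0, 1],
        regs par.r par.σ par.γ par.β par.q par.n (par.n.succ * par.m : ℕ) par.K par.trials par.w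
          v 0 par.ρ par.α 0 par.m 0 1 0 0 (par.K * par.α + 1 + 1) 0, mem, 0⟩ := by
      rintro _ rfl
      rfl
    exact key _ (add_zero _)
  · have key : ∀ v : ℝ, (2 : ℝ) ^ par.bitsB + 0 = v →
        [.regAdd 13 19 24, .regConst 16 0, .regConst 17 0, .regConst 23 0].foldl
          (Content.exec ω) ⟨[par.lam, par.n, par.m, par.q, 0, 1],
        regs par.r par.σ par.γ par.β par.q par.n (par.n.succ * par.m : ℕ) par.K par.trials par.w
          (2 ^ par.bitsN) 0 par.ρ par.α 0 par.m 0 (2 ^ par.bitsB) 0 par.bitsB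
          (par.K * par.α + 1 + 1) 0, mem, 0⟩ =
        ⟨[par.lam, par.n, par.m, par.q, 0, 1],
        regs par.r par.σ par.γ par.β par.q par.n (par.n.succ * par.m : ℕ) par.K par.trials par.w
          (2 ^ par.bitsN) v par.ρ par.α 0 0 0 (2 ^ par.bitsB) 0 par.bitsB
          (par.K * par.α + 1 + 1) 0, mem, 0⟩ := by
      rintro _ rfl
      rfl
    exact key _ (add_zero _)
  · simp only [List.length_cons, List.length_nil]
    omega

/-- The final state is the initial state for the reduced samples except for the position on the
tape. A program that follows thus behaves as on the input `reduce par x ω` with the shifted tape. -/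
theorem runs_reduction (ω : Tape) (par : Params) (x : Samples par.n par.m) :
    Runs ω reduction (initState par x)
      { initState par (reduce par x ω) with pos := par.m * ((par.n + 1) * par.chunk) }
      (reductionTime par) := by
  have h0 : initState par x = (initContent par (initMem x) 0).toState := by
    rw [initContent_toState]; rfl
  rw [h0, ← initContent_toState]
  obtain ⟨h, c, u, hs⟩ := runs_setup ω par (initMem x)
  obtain ⟨j', x', h', y', c', u', d', hc⟩ := runs_cellLoop (ω := ω) (l := par.lam) (m' := par.m)
    (n' := par.n) (q' := par.q) (r := par.r) (σ := par.σ) (γ := par.γ) (β := par.β) (q := par.q)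
    (K := par.K) (w := par.w) (ρ := par.ρ) (α := par.α)
    par.bitsN par.bitsB par.trials (par.n.succ * par.m) 0 (initMem x) 0 h 0 c u 0
  rw [Nat.zero_mod, Nat.zero_add, Nat.zero_mul] at hc
  simp only [Nat.not_lt_zero, if_false] at hc
  rw [initMem_reduce]
  have e : par.m * ((par.n + 1) * par.chunk) =
      par.n.succ * par.m * (1 + par.trials * (par.bitsN + 3)) := by
    rw [Params.chunk, Nat.succ_eq_add_one]
    ring
  rw [e]
  rw [Nat.cast_zero] at hc
  refine (hs.seq (hc.seq runs_cleanup)).mono ?_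
  rw [reductionTime]
  omega

/-! ### Composition of the reduction with a distinguisher -/

/-- The state of a machine that has consumed `R` further cells of its tape. -/
def State.addPos (R : ℕ) (s : State) : State := { s with pos := R + s.pos }

/-- A step reads the tape at the current position only, so starting `R` cells further on amounts to
shifting the tape by `R`. -/
lemma step_addPos (R : ℕ) (ω : Tape) (K : List Prog) (s : State) :
    step ω (K, s.addPos R) =
      ((step (shift R ω) (K, s)).1, (step (shift R ω) (K, s)).2.addPos R) := by
  match K with
  | [] => rfl
  | .instr c :: K => cases c <;> rfl
  | .seq P Q :: K => rfl
  | .ite t P Q :: K =>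
    have : t.Holds (s.addPos R) ↔ t.Holds s := by cases t <;> rfl
    by_cases h : t.Holds s
    · have h' := this.2 h
      simp only [step, h, h', if_true]
    · have h' := mt this.1 h
      simp only [step, h, h', if_false]
  | .loop t P :: K =>
    have : t.Holds (s.addPos R) ↔ t.Holds s := by cases t <;> rfl
    by_cases h : t.Holds s
    · have h' := this.2 h
      simp only [step, h, h', if_true]
    · have h' := mt this.1 h
      simp only [step, h, h', if_false]

lemma iterate_step_addPos (R : ℕ) (ω : Tape) (t : ℕ) (K : List Prog) (s : State) :
    (step ω)^[t] (K, s.addPos R) =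
      (((step (shift R ω))^[t] (K, s)).1, ((step (shift R ω))^[t] (K, s)).2.addPos R) := by
  induction t generalizing K s with
  | zero => rfl
  | succ t ih => rw [Function.iterate_succ_apply, step_addPos, ih, Function.iterate_succ_apply]

lemma iterate_step_nil (ω : Tape) (t : ℕ) (s : State) : (step ω)^[t] ([], s) = ([], s) :=
  Function.iterate_fixed rfl t

section Compose

variable {par : Params} {P D : Prog} {x x' : Samples par.n par.m} {ω : Tape} {R B : ℕ}

lemma Runs.exists_runFor
    (h : Runs ω P (initState par x) { initState par x' with pos := R } B) :
    ∃ t₀ ≤ B + 1, ∀ t, runFor (.seq P D) par x ω (t + t₀) =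
      ((runFor D par x' (shift R ω) t).1, (runFor D par x' (shift R ω) t).2.addPos R) := by
  obtain ⟨t₀, ht₀, h⟩ := h
  refine ⟨t₀ + 1, by omega, fun t => ?_⟩
  have h1 : (step ω)^[t₀ + 1] ([.seq P D], initState par x) =
      ([D], (initState par x').addPos R) := by
    rw [Function.iterate_succ_apply]
    exact h [D]
  rw [runFor, Function.iterate_add_apply, h1, iterate_step_addPos]
  rfl

lemma Runs.accepts_seq (h : Runs ω P (initState par x) { initState par x' with pos := R } B) :
    Accepts (.seq P D) par x ω ↔ Accepts D par x' (shift R ω) := by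
  obtain ⟨t₀, -, h⟩ := h.exists_runFor (D := D)
  constructor
  · rintro ⟨t, ht1, ht2⟩
    refine ⟨t, ?_⟩
    -- The accepting time `t` is not known to exceed `t₀`. As halted configurations are fixed by
    -- `step`, running `t₀` further steps changes nothing.
    have h1 : runFor (.seq P D) par x ω (t + t₀) = runFor (.seq P D) par x ω t := by
      have h2 : runFor (.seq P D) par x ω t = ([], (runFor (.seq P D) par x ω t).2) := by
        rw [← ht1]
      rw [add_comm, runFor, Function.iterate_add_apply]
      change (step ω)^[t₀] (runFor (.seq P D) par x ω t) = _
      rw [h2, iterate_step_nil]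
    rw [h] at h1
    rw [← h1] at ht1 ht2
    exact ⟨ht1, ht2⟩
  · rintro ⟨t, ht⟩
    refine ⟨t + t₀, ?_⟩
    rw [h]
    exact ht

lemma Runs.haltsWithin_seq {T : ℝ}
    (h : Runs ω P (initState par x) { initState par x' with pos := R } B)
    (hD : HaltsWithin D par x' (shift R ω) T) : HaltsWithin (.seq P D) par x ω (T + (B + 1)) := by
  obtain ⟨t₀, ht₀, h⟩ := h.exists_runFor (D := D)
  obtain ⟨t, ht, hD⟩ := hD
  refine ⟨t + t₀, ?_, ?_⟩
  · push_cast
    have : (t₀ : ℝ) ≤ B + 1 := by exact_mod_cast ht₀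
    linarith
  · rw [h]
    exact hD

end Compose

/-! ### Measurability of the acceptance event -/

section Measurable

variable {Ω : Type*} [MeasurableSpace Ω]

/-- All components of a random state are measurable. -/
structure MeasurableState (s : Ω → State) : Prop where
  idx : ∀ i, Measurable fun z => (s z).idx i
  reg : ∀ i, Measurable fun z => (s z).reg i
  mem : ∀ i, Measurable fun z => (s z).mem i
  pos : Measurable fun z => (s z).pos

/-- This covers indirect addressing and reading the tape: the index is itself random, but ranges
over a countable set. -/
lemma measurable_eval_nat {X : Type*} [MeasurableSpace X] {f : Ω → ℕ → X} {k : Ω → ℕ}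
    (hf : ∀ i, Measurable fun z => f z i) (hk : Measurable k) : Measurable fun z => f z (k z) := by
  have : Measurable (Function.uncurry fun (i : ℕ) (z : Ω) => f z i) :=
    measurable_from_prod_countable_right hf
  exact this.comp (hk.prodMk measurable_id)

lemma MeasurableState.setIdx {s : Ω → State} (hs : MeasurableState s) {v : Ω → ℕ}
    (hv : Measurable v) (i : ℕ) : MeasurableState fun z => (s z).setIdx i (v z) where
  idx j := by
    simp only [State.setIdx, Function.update_apply]
    split_ifs
    exacts [hv, hs.idx j]
  reg := hs.reg
  mem := hs.mem
  pos := hs.pos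

lemma MeasurableState.setReg {s : Ω → State} (hs : MeasurableState s) {v : Ω → ℝ}
    (hv : Measurable v) (i : ℕ) : MeasurableState fun z => (s z).setReg i (v z) where
  idx := hs.idx
  reg j := by
    simp only [State.setReg, Function.update_apply]
    split_ifs
    exacts [hv, hs.reg j]
  mem := hs.mem
  pos := hs.pos

lemma MeasurableState.exec {s : Ω → State} (hs : MeasurableState s) {τ : Ω → Tape}
    (hτ : Measurable τ) (c : Instr) : MeasurableState fun z => c.exec (τ z) (s z) := by
  cases c with
  | idxConst i c => exact hs.setIdx measurable_const i
  | idxAdd i j k => exact hs.setIdx ((hs.idx j).add (hs.idx k)) i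
  | idxSub i j k => exact hs.setIdx ((hs.idx j).sub (hs.idx k)) i
  | regConst a c => exact hs.setReg measurable_const a
  | regOfIdx a i => exact hs.setReg (measurable_from_top.comp (hs.idx i)) a
  | regAdd a b c => exact hs.setReg ((hs.reg b).add (hs.reg c)) a
  | regSub a b c => exact hs.setReg ((hs.reg b).sub (hs.reg c)) a
  | regMul a b c => exact hs.setReg ((hs.reg b).mul (hs.reg c)) a
  | regDiv a b c => exact hs.setReg ((hs.reg b).div (hs.reg c)) a
  | load a i => exact hs.setReg (measurable_eval_nat hs.mem (hs.idx i)) a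
  | store i a =>
    refine ⟨hs.idx, hs.reg, fun j => ?_, hs.pos⟩
    simp only [Instr.exec, Function.update_apply]
    exact Measurable.ite (measurableSet_eq_fun measurable_const (hs.idx i)) (hs.reg a) (hs.mem j)
  | unif a =>
    have h := hs.setReg (measurable_eval_nat (f := fun z k => (τ z k).1)
      (fun i => ((measurable_pi_apply i).comp hτ).fst) hs.pos) a
    exact ⟨h.idx, h.reg, h.mem, hs.pos.add_const 1⟩
  | gauss a =>
    have h := hs.setReg (measurable_eval_nat (f := fun z k => (τ z k).2)
      (fun i => ((measurable_pi_apply i).comp hτ).snd) hs.pos) a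
    exact ⟨h.idx, h.reg, h.mem, hs.pos.add_const 1⟩

lemma MeasurableState.holds {s : Ω → State} (hs : MeasurableState s) (t : Cond) :
    MeasurableSet {z | t.Holds (s z)} := by
  cases t with
  | idxLt i j => exact measurableSet_lt (hs.idx i) (hs.idx j)
  | regLt a b => exact measurableSet_lt (hs.reg a) (hs.reg b)

/-- The list of pending programs is kept deterministic. Random control flow enters only at tests,
where the event splits along the measurable set on which the test holds. -/
lemma MeasurableState.measurableSet_accepts {τ : Ω → Tape} (hτ : Measurable τ) (t : ℕ) :
    ∀ (K : List Prog) {s : Ω → State}, MeasurableState s →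
      MeasurableSet {z | ((step (τ z))^[t] (K, s z)).1 = [] ∧
        ((step (τ z))^[t] (K, s z)).2.idx 0 = 1} := by
  induction t with
  | zero =>
    intro K s hs
    simp only [Function.iterate_zero, id]
    exact (MeasurableSet.const _).inter (measurableSet_eq_fun (hs.idx 0) measurable_const)
  | succ t ih =>
    intro K s hs
    simp only [Function.iterate_succ_apply]
    match K with
    | [] => exact ih [] hs
    | .instr c :: K => exact ih K (hs.exec hτ c)
    | .seq P Q :: K => exact ih (P :: Q :: K) hs
    | .ite c P Q :: K =>
      convert (hs.holds c).ite (ih (P :: K) hs) (ih (Q :: K) hs) using 1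
      ext z
      by_cases h : c.Holds (s z) <;> simp [step, h, Set.ite]
    | .loop c P :: K =>
      convert (hs.holds c).ite (ih (P :: .loop c P :: K) hs) (ih K hs) using 1
      ext z
      by_cases h : c.Holds (s z) <;> simp [step, h, Set.ite]

lemma measurable_initMem {n m : ℕ} (k : ℕ) :
    Measurable fun x : Samples n m => initMem x k := by
  unfold initMem
  split_ifs <;> fun_prop

lemma measurableSet_accepts (D : Prog) (par : Params) :
    MeasurableSet {z : Samples par.n par.m × Tape | Accepts D par z.1 z.2} := by
  have hs : MeasurableState fun z : Samples par.n par.m × Tape => initState par z.1 := by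
    refine ⟨fun i => ?_, fun i => ?_, fun i => ?_, measurable_const⟩
    · exact measurable_const
    · exact measurable_const
    · exact (measurable_initMem i).comp measurable_fst
  have h := fun t => hs.measurableSet_accepts measurable_snd t [D]
  convert MeasurableSet.iUnion h using 1
  ext z
  simp only [Set.mem_iUnion]
  rfl

end Measurable

/-! ### Independence of different parts of the tape -/

instance : IsProbabilityMeasure tapeMeasure := by
  unfold tapeMeasure; infer_instance

/-- The tape with `c` pieces of length `R` followed by another tape. -/
def splice (c R : ℕ) (W : Fin c → Tape) (ω : Tape) : Tape := fun i =>
  if h : i / R < c then W ⟨i / R, h⟩ (i % R) else ω (i - c * R)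

lemma splice_apply {c R : ℕ} (W : Fin c → Tape) (ω : Tape) (k : Fin c) {i : ℕ} (hi : i < R) :
    splice c R W ω (k * R + i) = W k i := by
  have hR : 0 < R := by omega
  have h1 : (k * R + i) / R = k := by
    rw [mul_comm, Nat.mul_add_div hR, Nat.div_eq_of_lt hi, add_zero]
  have h2 : (k * R + i) % R = i := by
    rw [mul_comm, Nat.mul_add_mod, Nat.mod_eq_of_lt hi]
  unfold splice
  rw [dif_pos (by rw [h1]; exact k.2)]
  simp only [h1, h2]

lemma shift_splice {c R : ℕ} (hR : 0 < R) (W : Fin c → Tape) (ω : Tape) :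
    shift (c * R) (splice c R W ω) = ω := by
  ext1 i
  have h1 : ¬ (c * R + i) / R < c := by
    rw [mul_comm, Nat.mul_add_div hR]
    exact not_lt.2 (Nat.le_add_right _ _)
  simp only [shift, splice, h1, dif_neg, not_false_eq_true]
  congr 1
  omega

lemma measurable_splice (c R : ℕ) :
    Measurable fun z : (Fin c → Tape) × Tape => splice c R z.1 z.2 := by
  refine measurable_pi_lambda _ fun i => ?_
  unfold splice
  split_ifs with h
  · exact (measurable_pi_apply _).comp ((measurable_pi_apply _).comp measurable_fst)
  · exact (measurable_pi_apply _).comp measurable_snd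

/-- The cells of the spliced tape are distinct cells among those of `c + 1` independent tapes: `f`
embeds ℕ into `(Fin c ⊕ Unit) × ℕ`. Selecting coordinates of a product measure along an injection
gives a product measure again. -/
lemma map_splice {c R : ℕ} (hR : 0 < R) :
    ((Measure.pi fun _ : Fin c => tapeMeasure).prod tapeMeasure).map
      (fun z => splice c R z.1 z.2) = tapeMeasure := by
  set ν := unifTorus.prod (contGaussian 1) with hν
  have h1 := measurePreserving_sumPiEquivProdPi_symm
    (fun _ : Fin c ⊕ Unit => tapeMeasure)
  have h2 : MeasurePreserving (fun z : (Fin c → Tape) × Tape => (z.1, fun _ : Unit => z.2))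
      ((Measure.pi fun _ : Fin c => tapeMeasure).prod tapeMeasure)
      ((Measure.pi fun _ : Fin c => tapeMeasure).prod
        (Measure.pi fun _ : Unit => tapeMeasure)) := by
    have h := (measurePreserving_funUnique tapeMeasure Unit).symm
    exact (MeasurePreserving.id (Measure.pi fun _ : Fin c => tapeMeasure)).prod h
  have h3 : (Measure.pi fun _ : Fin c ⊕ Unit => tapeMeasure).map
      (MeasurableEquiv.curry (Fin c ⊕ Unit) ℕ (ℝ × ℝ)).symm =
      Measure.infinitePi fun _ : (Fin c ⊕ Unit) × ℕ => ν := by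
    rw [← Measure.infinitePi_eq_pi]
    exact Measure.infinitePi_map_curry_symm (fun (_ : Fin c ⊕ Unit) (_ : ℕ) => ν)
  let f : ℕ → (Fin c ⊕ Unit) × ℕ := fun i =>
    if h : i / R < c then (.inl ⟨i / R, h⟩, i % R) else (.inr (), i - c * R)
  have hf : Function.Injective f := by
    intro i j hij
    have hi := Nat.div_add_mod i R
    have hj := Nat.div_add_mod j R
    simp only [f] at hij
    split_ifs at hij with hi1 hj1 hj1
    · simp only [Prod.mk.injEq, Sum.inl.injEq, Fin.mk.injEq] at hij
      rw [← hi, ← hj, hij.1, hij.2]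
    · simp at hij
    · simp at hij
    · simp only [Prod.mk.injEq, true_and] at hij
      have hi2 := (Nat.le_div_iff_mul_le hR).1 (not_lt.1 hi1)
      have hj2 := (Nat.le_div_iff_mul_le hR).1 (not_lt.1 hj1)
      omega
  have h4 := Measure.map_infinitePi_infinitePi_of_inj (P := fun _ => ν) hf
  rw [← h3, ← h1.map_eq, ← h2.map_eq, Measure.map_map (by fun_prop) (by fun_prop),
    Measure.map_map (by fun_prop) (by fun_prop), Measure.map_map (by fun_prop) (by fun_prop)] at h4
  refine Eq.trans ?_ h4
  congr 1
  ext1 z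
  ext1 i
  simp only [Function.comp, splice, f]
  split_ifs with h <;> rfl

/-- `H ω` depends only on the first `R` cells of the tape `ω`. -/
def LocalTo {Y : Type*} (R : ℕ) (H : Tape → Y) : Prop :=
  ∀ ω ω' : Tape, (∀ i < R, ω i = ω' i) → H ω = H ω'

@[fun_prop]
lemma measurable_shift (k : ℕ) : Measurable (shift k) :=
  measurable_pi_lambda _ fun _ => measurable_pi_apply _

/-- Since `G` sees only the first `R` cells, consecutive pieces of one tape may be replaced by
separate independent tapes, with a fresh tape left over. This is used twice: for the entries within
a sample and for the samples themselves. -/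
lemma map_chunks {X Y : Type*} [MeasurableSpace X] [MeasurableSpace Y] {c R : ℕ} (hR : 0 < R)
    {G : X × Tape → Y} (hG : Measurable G) (hloc : ∀ x, LocalTo R fun ω => G (x, ω))
    (μ : Measure (Fin c → X)) [IsProbabilityMeasure μ] :
    (μ.prod tapeMeasure).map
        (fun z => ((fun i : Fin c => G (z.1 i, shift (i * R) z.2)), shift (c * R) z.2)) =
      ((μ.prod (Measure.pi fun _ : Fin c => tapeMeasure)).map
        (fun z i => G (z.1 i, z.2 i))).prod tapeMeasure := by
  have h1 : μ.prod tapeMeasure = (μ.prod ((Measure.pi fun _ : Fin c => tapeMeasure).prod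
      tapeMeasure)).map (fun z => (z.1, splice c R z.2.1 z.2.2)) := by
    have := Measure.map_prod_map μ ((Measure.pi fun _ : Fin c => tapeMeasure).prod
      tapeMeasure) measurable_id (measurable_splice c R)
    rw [map_splice hR, Measure.map_id] at this
    exact this
  have h2 : Measurable fun z : (Fin c → X) × (Fin c → Tape) => fun i => G (z.1 i, z.2 i) := by
    fun_prop
  have h3 := Measure.map_prod_map (μ.prod (Measure.pi fun _ : Fin c => tapeMeasure)) tapeMeasure
    h2 measurable_id
  rw [Measure.map_id] at h3
  have hsp := measurable_splice c R
  rw [h3, h1, Measure.map_map (by fun_prop) (by fun_prop), ← Measure.prodAssoc_prod,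
    Measure.map_map (by fun_prop) (by fun_prop)]
  congr 1
  ext1 z
  refine Prod.ext ?_ (shift_splice hR _ _)
  ext1 i
  exact hloc _ _ _ fun k hk => splice_apply _ _ i hk

lemma map_arrow_pi {X Z Y : Type*} [MeasurableSpace X] [MeasurableSpace Z] [MeasurableSpace Y]
    {c : ℕ} {G : X × Z → Y} (hG : Measurable G) (P : Measure X) [IsProbabilityMeasure P]
    (Q : Measure Z) [IsProbabilityMeasure Q] :
    ((Measure.pi fun _ : Fin c => P).prod (Measure.pi fun _ : Fin c => Q)).map
      (fun z i => G (z.1 i, z.2 i)) = Measure.pi fun _ : Fin c => (P.prod Q).map G := by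
  have h1 := (measurePreserving_arrowProdEquivProdArrow X Z (Fin c) (fun _ => P) (fun _ => Q)).symm
  rw [← Measure.pi_map_pi (μ := fun _ : Fin c => P.prod Q) (fun _ => hG.aemeasurable),
    ← h1.map_eq, Measure.map_map (by fun_prop) (by fun_prop)]
  rfl

/-! ### The law of the rejection sampler -/

lemma map_head_tail : tapeMeasure.map (fun ω => (ω 0, shift 1 ω)) =
    (unifTorus.prod (contGaussian 1)).prod tapeMeasure := by
  have h0 : MeasurePreserving (fun W : Fin 1 → Tape => W 0 0)
      (Measure.pi fun _ : Fin 1 => tapeMeasure) (unifTorus.prod (contGaussian 1)) := by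
    have h1 : MeasurePreserving (Function.eval 0) tapeMeasure (unifTorus.prod (contGaussian 1)) :=
      measurePreserving_eval_infinitePi (fun _ : ℕ => unifTorus.prod (contGaussian 1)) 0
    exact h1.comp (measurePreserving_eval (fun _ : Fin 1 => tapeMeasure) 0)
  have h2 := (h0.prod (MeasurePreserving.id tapeMeasure)).map_eq
  rw [← h2]
  conv_lhs => rw [← map_splice (c := 1) (R := 1) one_pos]
  have hsp := measurable_splice 1 1
  rw [Measure.map_map (by fun_prop) (by fun_prop)]
  congr 1
  ext1 z
  refine Prod.ext ?_ ?_
  · exact splice_apply z.1 z.2 0 one_pos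
  · exact shift_splice one_pos z.1 z.2

lemma lintegral_tape {φ : (ℝ × ℝ) × Tape → ENNReal} (hφ : Measurable φ) :
    ∫⁻ ω, φ (ω 0, shift 1 ω) ∂tapeMeasure =
      ∫⁻ u, ∫⁻ g, ∫⁻ ω, φ ((u, g), ω) ∂tapeMeasure ∂contGaussian 1 ∂unifTorus := by
  have h : ∫⁻ ω, φ (ω 0, shift 1 ω) ∂tapeMeasure =
      ∫⁻ z, φ z ∂tapeMeasure.map (fun ω => (ω 0, shift 1 ω)) := by
    rw [lintegral_map hφ (by fun_prop)]
  rw [h, map_head_tail, lintegral_prod _ hφ.aemeasurable, lintegral_prod]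
  exact (hφ.lintegral_prod_right').aemeasurable

lemma lintegral_tape_gauss {φ : ℝ × Tape → ENNReal} (hφ : Measurable φ) :
    ∫⁻ ω, φ ((ω 0).2, shift 1 ω) ∂tapeMeasure =
      ∫⁻ g, ∫⁻ ω, φ (g, ω) ∂tapeMeasure ∂contGaussian 1 := by
  rw [lintegral_tape (φ := fun z => φ (z.1.2, z.2)) (by fun_prop)]
  simp

lemma lintegral_unifTorus_bit (a b : ENNReal) :
    ∫⁻ u, (if u < 1 / 2 then a else b) ∂unifTorus = 2⁻¹ * a + 2⁻¹ * b := by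
  have hm : MeasurableSet {u : ℝ | u < 1 / 2} := measurableSet_lt measurable_id measurable_const
  have h1 : unifTorus {u : ℝ | u < 1 / 2} = 2⁻¹ := by
    rw [unifTorus, Measure.restrict_apply hm]
    have : {u : ℝ | u < 1 / 2} ∩ Set.Ico 0 1 = Set.Ico 0 (1 / 2) := by
      ext x
      simp only [Set.mem_inter_iff, Set.mem_ofPred_eq, Set.mem_Ico]
      constructor
      · rintro ⟨h1, h2, h3⟩; exact ⟨h2, h1⟩
      · rintro ⟨h1, h2⟩; exact ⟨h2, h1, by linarith⟩
    rw [this, Real.volume_Ico, sub_zero, one_div, ENNReal.ofReal_inv_of_pos two_pos]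
    simp
  have h2 : unifTorus {u : ℝ | u < 1 / 2}ᶜ = 2⁻¹ := by
    rw [prob_compl_eq_one_sub hm, h1, ENNReal.one_sub_inv_two]
  rw [← lintegral_add_compl _ hm, setLIntegral_congr_fun hm (g := fun _ => a),
    setLIntegral_congr_fun hm.compl (g := fun _ => b), setLIntegral_const, setLIntegral_const,
    h1, h2, mul_comm a, mul_comm b]
  · intro u hu
    exact if_neg hu
  · intro u hu
    exact if_pos hu

@[fun_prop]
lemma measurable_addBits (k : ℕ) : Measurable fun z : Tape × ℝ => addBits k z.1 z.2 := by
  induction k with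
  | zero => exact measurable_snd
  | succ k ih =>
    have : Measurable fun z : Tape × ℝ => (shift 1 z.1,
        if (z.1 0).1 < 1 / 2 then z.2 + 2 ^ k else z.2) := by
      refine Measurable.prodMk (by fun_prop) (Measurable.ite ?_ (by fun_prop) (by fun_prop))
      exact measurableSet_lt (by fun_prop) measurable_const
    exact ih.comp this

/-- The most significant bit selects the lower or the upper half of the range, and the remaining
bits are uniform on that half. The function `φ` also receives the rest of the tape, so that later
random choices can be integrated afterwards. -/
lemma lintegral_addBits (k : ℕ) (x : ℝ) {φ : ℝ × Tape → ENNReal} (hφ : Measurable φ) :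
    ∫⁻ ω, φ (addBits k ω x, shift k ω) ∂tapeMeasure =
      (2 ^ k)⁻¹ * ∑ j ∈ Finset.range (2 ^ k), ∫⁻ ω, φ (x + j, ω) ∂tapeMeasure := by
  induction k generalizing x with
  | zero => simp [addBits]
  | succ k ih =>
    have h1 : ∀ ω, φ (addBits (k + 1) ω x, shift (k + 1) ω) =
        (fun z : (ℝ × ℝ) × Tape => φ (addBits k z.2 (if z.1.1 < 1 / 2 then x + 2 ^ k else x),
          shift k z.2)) (ω 0, shift 1 ω) := by
      intro ω
      simp only [addBits, shift_shift, add_comm k 1]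
    have hm : Measurable fun z : (ℝ × ℝ) × Tape =>
        φ (addBits k z.2 (if z.1.1 < 1 / 2 then x + 2 ^ k else x), shift k z.2) := by
      have : Measurable fun z : (ℝ × ℝ) × Tape =>
          (z.2, (if z.1.1 < 1 / 2 then x + 2 ^ k else x)) := by
        refine Measurable.prodMk (by fun_prop) (Measurable.ite ?_ (by fun_prop) (by fun_prop))
        exact measurableSet_lt (by fun_prop) measurable_const
      exact hφ.comp (((measurable_addBits k).comp this).prodMk (by fun_prop))
    simp_rw [h1]
    rw [lintegral_tape hm]
    trans ∫⁻ u, (if u < 1 / 2 then (2 ^ k)⁻¹ * ∑ j ∈ Finset.range (2 ^ k),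
          ∫⁻ ω, φ (x + 2 ^ k + j, ω) ∂tapeMeasure
        else (2 ^ k)⁻¹ * ∑ j ∈ Finset.range (2 ^ k), ∫⁻ ω, φ (x + j, ω) ∂tapeMeasure) ∂unifTorus
    · refine lintegral_congr fun u => ?_
      refine (lintegral_congr fun g => ih (if u < 1 / 2 then x + 2 ^ k else x)).trans ?_
      rw [lintegral_const, measure_univ, mul_one]
      split_ifs <;> rfl
    rw [lintegral_unifTorus_bit, pow_succ (2 : ℕ), mul_two, Finset.sum_range_add, pow_succ,
      ENNReal.mul_inv (by simp) (by simp)]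
    simp_rw [Nat.cast_add, Nat.cast_pow, Nat.cast_ofNat, ← add_assoc]
    ring

/-- The squared radius of a pair of standard Gaussians exceeds `(x/w)²` with probability exactly
`rho w x`; multiplying out `w²` avoids a division in the test. -/
lemma lintegral_accept {w : ℝ} (hw : 0 < w) (x : ℝ) (a b : ENNReal) :
    ∫⁻ g, ∫⁻ h, (if x * x < (g * g + h * h) * w * w then a else b) ∂contGaussian 1
      ∂contGaussian 1 = ENNReal.ofReal (rho w x) * a + ENNReal.ofReal (1 - rho w x) * b := by
  have hm : MeasurableSet {g : ℝ × ℝ | x * x < (g.1 * g.1 + g.2 * g.2) * w * w} :=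
    measurableSet_lt (by fun_prop) (by fun_prop)
  have hset : {g : ℝ × ℝ | x * x < (g.1 * g.1 + g.2 * g.2) * w * w} =
      {g : ℝ × ℝ | (x / w) ^ 2 < g.1 ^ 2 + g.2 ^ 2} := by
    ext g
    simp only [Set.mem_ofPred_eq]
    rw [div_pow, div_lt_iff₀ (by positivity)]
    constructor <;> intro h <;> nlinarith
  have h1 : ((contGaussian 1).prod (contGaussian 1))
      {g : ℝ × ℝ | x * x < (g.1 * g.1 + g.2 * g.2) * w * w} = ENNReal.ofReal (rho w x) := by
    rw [hset, contGaussian_prod_radius (by positivity)]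
    rfl
  have h2 : ((contGaussian 1).prod (contGaussian 1))
      {g : ℝ × ℝ | x * x < (g.1 * g.1 + g.2 * g.2) * w * w}ᶜ = ENNReal.ofReal (1 - rho w x) := by
    rw [prob_compl_eq_one_sub hm, h1, ENNReal.ofReal_sub _ (rho_pos w x).le, ENNReal.ofReal_one]
  rw [lintegral_lintegral (f := fun g h => if x * x < (g * g + h * h) * w * w then a else b)
    (Measurable.ite hm measurable_const measurable_const).aemeasurable]
  rw [← lintegral_add_compl _ hm, setLIntegral_congr_fun hm (g := fun _ => a),
    setLIntegral_congr_fun hm.compl (g := fun _ => b), setLIntegral_const, setLIntegral_const,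
    h1, h2, mul_comm a, mul_comm b]
  · intro u hu
    exact if_neg hu
  · intro u hu
    exact if_pos hu

@[fun_prop]
lemma measurable_trial (b : ℕ) (w : ℝ) :
    Measurable fun z : ℝ × Tape × ℝ => trial b w z.1 z.2.1 z.2.2 := by
  unfold trial
  have h : Measurable fun z : ℝ × Tape × ℝ => addBits (b + 1) z.2.1 (z.1 - 2 ^ b) :=
    (measurable_addBits (b + 1)).comp
      (by fun_prop : Measurable fun z : ℝ × Tape × ℝ => (z.2.1, z.1 - 2 ^ b))
  have h2 : Measurable fun z : ℝ × Tape × ℝ => ((z.2.1 (b + 1)).2 * (z.2.1 (b + 1)).2 +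
      (z.2.1 (b + 2)).2 * (z.2.1 (b + 2)).2) * w * w := by fun_prop
  exact Measurable.ite (measurableSet_lt (h.mul h) h2) h (by fun_prop)

@[fun_prop]
lemma measurable_sampler (b : ℕ) (w : ℝ) (M : ℕ) :
    Measurable fun z : ℝ × Tape × ℝ => sampler b w z.1 M z.2.1 z.2.2 := by
  induction M with
  | zero => exact measurable_snd.comp measurable_snd
  | succ M ih =>
    exact ih.comp (measurable_fst.prodMk (Measurable.prodMk (by fun_prop) (measurable_trial b w)))

lemma lintegral_trial (b : ℕ) {w : ℝ} (hw : 0 < w) (c y : ℝ) {φ : ℝ × Tape → ENNReal}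
    (hφ : Measurable φ) :
    ∫⁻ ω, φ (trial b w c ω y, shift (b + 3) ω) ∂tapeMeasure =
      (2 ^ (b + 1))⁻¹ * ∑ j ∈ Finset.range (2 ^ (b + 1)),
        (ENNReal.ofReal (rho w (c - 2 ^ b + j)) * ∫⁻ ω, φ (c - 2 ^ b + j, ω) ∂tapeMeasure +
          ENNReal.ofReal (1 - rho w (c - 2 ^ b + j)) * ∫⁻ ω, φ (y, ω) ∂tapeMeasure) := by
  have hite : Measurable fun z : ℝ × ℝ × ℝ =>
      (if z.1 * z.1 < (z.2.1 * z.2.1 + z.2.2 * z.2.2) * w * w then z.1 else y) :=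
    Measurable.ite (measurableSet_lt (by fun_prop) (by fun_prop)) (by fun_prop) measurable_const
  set ψ : ℝ × Tape → ENNReal := fun z =>
    φ ((if z.1 * z.1 < ((z.2 0).2 * (z.2 0).2 + (z.2 1).2 * (z.2 1).2) * w * w then z.1 else y),
      shift 2 z.2) with hψ
  have hψm : Measurable ψ := by
    have : Measurable fun z : ℝ × Tape => (z.1, (z.2 0).2, (z.2 1).2) := by fun_prop
    exact hφ.comp ((hite.comp this).prodMk (by fun_prop))
  have h1 : ∀ ω, φ (trial b w c ω y, shift (b + 3) ω) =
      ψ (addBits (b + 1) ω (c - 2 ^ b), shift (b + 1) ω) := by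
    intro ω
    simp only [hψ, trial, shift_shift]
    rfl
  simp_rw [h1]
  rw [lintegral_addBits _ _ hψm]
  congr 1
  refine Finset.sum_congr rfl fun j _ => ?_
  set x : ℝ := c - 2 ^ b + j
  have h2 : ∀ ω, ψ (x, ω) = (fun z : ℝ × Tape =>
      φ ((if x * x < (z.1 * z.1 + (z.2 0).2 * (z.2 0).2) * w * w then x else y), shift 1 z.2))
      ((ω 0).2, shift 1 ω) := by
    intro ω
    simp only [hψ, shift_shift]
    rfl
  have hm2 : Measurable fun z : ℝ × Tape =>
      φ ((if x * x < (z.1 * z.1 + (z.2 0).2 * (z.2 0).2) * w * w then x else y), shift 1 z.2) := by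
    have : Measurable fun z : ℝ × Tape => (x, z.1, (z.2 0).2) := by fun_prop
    exact hφ.comp ((hite.comp this).prodMk (by fun_prop))
  simp_rw [h2]
  rw [lintegral_tape_gauss hm2, ← lintegral_accept hw]
  refine lintegral_congr fun g => ?_
  have hm3 : Measurable fun z : ℝ × Tape =>
      φ ((if x * x < (g * g + z.1 * z.1) * w * w then x else y), z.2) := by
    have : Measurable fun z : ℝ × Tape => (x, g, z.1) := by fun_prop
    exact hφ.comp ((hite.comp this).prodMk (by fun_prop))
  rw [lintegral_tape_gauss hm3]
  refine lintegral_congr fun h => ?_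
  dsimp only
  split_ifs <;> rfl

/-- The sum of geometric weights arising from repeated trials. -/
lemma lintegral_sampler (b : ℕ) {w : ℝ} (hw : 0 < w) (c : ℝ) {φ : ℝ → ENNReal}
    (hφ : Measurable φ) (M : ℕ) (y : ℝ) :
    ∫⁻ ω, φ (sampler b w c M ω y) ∂tapeMeasure =
      (∑ i ∈ Finset.range M, ((2 ^ (b + 1))⁻¹ * ∑ j ∈ Finset.range (2 ^ (b + 1)),
          ENNReal.ofReal (1 - rho w (c - 2 ^ b + j))) ^ i) *
        ((2 ^ (b + 1))⁻¹ * ∑ j ∈ Finset.range (2 ^ (b + 1)),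
          ENNReal.ofReal (rho w (c - 2 ^ b + j)) * φ (c - 2 ^ b + j)) +
      ((2 ^ (b + 1))⁻¹ * ∑ j ∈ Finset.range (2 ^ (b + 1)),
          ENNReal.ofReal (1 - rho w (c - 2 ^ b + j))) ^ M * φ y := by
  set p' : ENNReal := (2 ^ (b + 1))⁻¹ * ∑ j ∈ Finset.range (2 ^ (b + 1)),
          ENNReal.ofReal (1 - rho w (c - 2 ^ b + j)) with hp'
  set A := (2 ^ (b + 1))⁻¹ * ∑ j ∈ Finset.range (2 ^ (b + 1)),
          ENNReal.ofReal (rho w (c - 2 ^ b + j)) * φ (c - 2 ^ b + j) with hA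
  set p : ENNReal := (2 ^ (b + 1))⁻¹ * ∑ j ∈ Finset.range (2 ^ (b + 1)),
          ENNReal.ofReal (rho w (c - 2 ^ b + j)) with hp
  have hpp : p + p' = 1 := by
    rw [hp, hp', ← mul_add, ← Finset.sum_add_distrib]
    have : ∀ j ∈ Finset.range (2 ^ (b + 1)), ENNReal.ofReal (rho w (c - 2 ^ b + (j : ℝ))) +
        ENNReal.ofReal (1 - rho w (c - 2 ^ b + j)) = 1 := by
      intro j _
      rw [← ENNReal.ofReal_add (rho_pos _ _).le (by linarith [rho_le_one w (c - 2 ^ b + j)]),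
        add_sub_cancel, ENNReal.ofReal_one]
    rw [Finset.sum_congr rfl this, Finset.sum_const, Finset.card_range, nsmul_eq_mul, mul_one]
    push_cast
    exact ENNReal.inv_mul_cancel (by simp) (by simp)
  induction M generalizing y with
  | zero => simp [sampler]
  | succ M ih =>
    have h1 : ∀ ω, φ (sampler b w c (M + 1) ω y) =
        (fun z : ℝ × Tape => φ (sampler b w c M z.2 z.1)) (trial b w c ω y, shift (b + 3) ω) :=
      fun ω => rfl
    have hm : Measurable fun z : ℝ × Tape => φ (sampler b w c M z.2 z.1) :=
      hφ.comp ((measurable_sampler b w M).comp (by fun_prop : Measurable fun z : ℝ × Tape =>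
        (c, z.2, z.1)))
    simp_rw [h1]
    rw [lintegral_trial b hw c y hm]
    simp only [ih]
    set S := ∑ i ∈ Finset.range M, p' ^ i with hS
    -- The first trial has been peeled off. Its value survives only if all `M` later trials reject,
    -- which accounts for the new term `p' ^ M * A`; the other terms recombine through `p + p' = 1`.
    have h2 : (2 ^ (b + 1))⁻¹ * ∑ j ∈ Finset.range (2 ^ (b + 1)),
        (ENNReal.ofReal (rho w (c - 2 ^ b + j)) * (S * A + p' ^ M * φ (c - 2 ^ b + j)) +
          ENNReal.ofReal (1 - rho w (c - 2 ^ b + j)) * (S * A + p' ^ M * φ y)) =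
        p * (S * A) + p' ^ M * A + p' * (S * A + p' ^ M * φ y) := by
      have e : ∀ j : ℕ, ENNReal.ofReal (rho w (c - 2 ^ b + j)) *
            (S * A + p' ^ M * φ (c - 2 ^ b + j)) +
          ENNReal.ofReal (1 - rho w (c - 2 ^ b + j)) * (S * A + p' ^ M * φ y) =
          ENNReal.ofReal (rho w (c - 2 ^ b + j)) * (S * A) +
            p' ^ M * (ENNReal.ofReal (rho w (c - 2 ^ b + j)) * φ (c - 2 ^ b + j)) +
          ENNReal.ofReal (1 - rho w (c - 2 ^ b + j)) * (S * A + p' ^ M * φ y) := fun j => by ring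
      simp_rw [e, Finset.sum_add_distrib, ← Finset.sum_mul, ← Finset.mul_sum]
      generalize S * A + p' ^ M * φ y = X
      generalize S * A = Y
      rw [hp, hA, mul_add, mul_add]
      congr 1
      · ring
      · rw [hp']; ring
    rw [h2, Finset.sum_range_succ, ← hS]
    calc _ = (p + p') * (S * A) + p' ^ M * A + p' ^ (M + 1) * φ y := by ring
      _ = _ := by rw [hpp]; ring

/-- Proposals in `[0, w]` are accepted with probability at least `exp(-π)`, hence at least `1/25`.
-/
lemma exp_pi_le : Real.exp Real.pi ≤ 25 := by
  have h1 : Real.exp Real.pi ≤ Real.exp (1 + 1 + 1 + 0.15) :=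
    Real.exp_le_exp.2 (by linarith [Real.pi_lt_d2])
  have h2 : Real.exp 0.15 ≤ 1.18 := by
    have := Real.one_sub_le_exp_neg 0.15
    rw [Real.exp_neg] at this
    have h0 := Real.exp_pos (0.15 : ℝ)
    rw [le_inv_comm₀ (by norm_num) h0] at this
    exact this.trans (by norm_num)
  have h3 := Real.exp_one_lt_d9
  rw [Real.exp_add, Real.exp_add, Real.exp_add] at h1
  have h4 : Real.exp 1 * Real.exp 1 * Real.exp 1 ≤ 2.72 * 2.72 * 2.72 := by
    gcongr <;> linarith
  have h5 : Real.exp 1 * Real.exp 1 * Real.exp 1 * Real.exp 0.15 ≤ 2.72 * 2.72 * 2.72 * 1.18 := by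
    gcongr
  norm_num at h5 ⊢
  linarith

/-- A lower bound for the probability that a trial succeeds. -/
lemma le_sum_rho {b K : ℕ} {w c : ℝ} (hw : 1 ≤ w) (hc : c ∈ Set.Ico (0 : ℝ) 1)
    (hb : w ≤ 2 ^ b) (hb' : 2 ^ b ≤ 4 * K * w) :
    1 ≤ 400 * K * ((2 ^ (b + 1))⁻¹ * ∑ j ∈ Finset.range (2 ^ (b + 1)), rho w (c - 2 ^ b + j)) := by
  have hf : ⌊w⌋₊ ≤ 2 ^ b := by
    have := (Nat.floor_le (by linarith : (0 : ℝ) ≤ w)).trans hb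
    exact_mod_cast this
  -- Only the proposals `c, c + 1, …` within `[0, w]` are counted. There are `⌊w⌋ ≥ w/2` of them,
  -- each accepted with probability at least `1/25`, out of `2 ^ (b + 1) ≤ 8Kw` proposals. The
  -- success probability is thus at least `1/(400K)`.
  have h1 : ∑ i ∈ Finset.range ⌊w⌋₊, Real.exp (-Real.pi) ≤
      ∑ j ∈ Finset.range (2 ^ (b + 1)), rho w (c - 2 ^ b + j) := by
    calc ∑ i ∈ Finset.range ⌊w⌋₊, Real.exp (-Real.pi)
        ≤ ∑ i ∈ Finset.range ⌊w⌋₊, rho w (c - 2 ^ b + ((2 ^ b + i : ℕ) : ℝ)) := by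
          refine Finset.sum_le_sum fun i hi => Real.exp_le_exp.2 ?_
          have hi' : i + 1 ≤ ⌊w⌋₊ := Finset.mem_range.1 hi
          have hi2 : (i : ℝ) + 1 ≤ w := by
            have := (Nat.le_floor_iff (by linarith : (0 : ℝ) ≤ w)).1 hi'
            exact_mod_cast this
          have e : c - 2 ^ b + ((2 ^ b + i : ℕ) : ℝ) = c + i := by push_cast; ring
          rw [e]
          have h0 : 0 ≤ (c + i) / w := div_nonneg (by linarith [hc.1, (Nat.cast_nonneg i : (0 : ℝ) ≤ i)]) (by linarith)
          have h2 : (c + i) / w ≤ 1 := by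
            rw [div_le_one (by linarith)]
            linarith [hc.2]
          have h3 : ((c + i) / w) ^ 2 ≤ 1 := pow_le_one₀ h0 h2
          nlinarith [Real.pi_pos]
      _ = ∑ j ∈ Finset.Ico (2 ^ b) (2 ^ b + ⌊w⌋₊), rho w (c - 2 ^ b + j) := by
          rw [Finset.sum_Ico_eq_sum_range, Nat.add_sub_cancel_left]
      _ ≤ _ := by
          refine Finset.sum_le_sum_of_subset_of_nonneg ?_ fun _ _ _ => (rho_pos _ _).le
          intro j hj
          rw [Finset.mem_Ico] at hj
          rw [Finset.mem_range, pow_succ]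
          omega
  rw [Finset.sum_const, Finset.card_range, nsmul_eq_mul] at h1
  have h2 : w / 2 ≤ ⌊w⌋₊ := by
    have h3 := Nat.lt_floor_add_one w
    have h4 : (1 : ℝ) ≤ ⌊w⌋₊ := by exact_mod_cast Nat.one_le_floor_iff w |>.2 hw
    linarith
  have h3 : 1 / 25 ≤ Real.exp (-Real.pi) := by
    rw [Real.exp_neg, one_div]
    gcongr
    exact exp_pi_le
  have hpos : (0 : ℝ) < 2 ^ b := by positivity
  have h4 : w / 2 * (1 / 25) ≤ ∑ j ∈ Finset.range (2 ^ (b + 1)), rho w (c - 2 ^ b + j) := by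
    refine le_trans ?_ h1
    gcongr
  rw [pow_succ]
  calc (1 : ℝ) ≤ 400 * K * ((2 ^ b * 2)⁻¹ * (w / 2 * (1 / 25))) := by
        rw [← div_eq_inv_mul, ← mul_div_assoc, le_div_iff₀ (by positivity)]
        linarith
    _ ≤ _ := by
        gcongr

/-- In the application `p` is the success probability of a trial and `N` the number of proposals, so
`p * N` is the Gaussian mass of the window; it is at most the full lattice sum, which is at most `w
* κ`. -/
lemma geom_weight_le {e κ ρ w p N d : ℝ} (he : e ≤ 1) (hd : d ≤ e) (hp : 0 < p) (hN : 0 < N)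
    (hw : 0 < w) (hκ : 0 < κ) (hρ : 0 ≤ ρ) (h : p * N ≤ w * κ) :
    (1 - e) / κ * (ρ / w) ≤ (1 - d) / p * N⁻¹ * ρ := by
  calc (1 - e) / κ * (ρ / w) = (1 - e) / (w * κ) * ρ := by
        rw [div_mul_div_comm, mul_comm w, div_mul_eq_mul_div]
    _ ≤ (1 - d) / (p * N) * ρ := by
        refine mul_le_mul_of_nonneg_right ?_ hρ
        exact div_le_div₀ (by linarith) (by linarith) (by positivity) h
    _ = _ := by rw [← div_div, div_eq_mul_inv _ N]

/-- The rejection sampler yields almost all of the discrete Gaussian distribution. -/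
lemma le_lintegral_sampler {b K M : ℕ} {w c : ℝ} (hw : 1 ≤ w) (hc : c ∈ Set.Ico (0 : ℝ) 1)
    (hb : w ≤ 2 ^ b) (hb' : 2 ^ b ≤ 4 * K * w) (hM : 400 * K * K ≤ M) {φ : ℝ → ENNReal}
    (hφ : Measurable φ) (y : ℝ) :
    ENNReal.ofReal ((1 - Real.exp (-K)) / (1 + 4 * Real.exp (-Real.pi * w ^ 2))) *
        ∑ j ∈ Finset.range (2 ^ (b + 1)), dens w (c - 2 ^ b + j) * φ (c - 2 ^ b + j) ≤
      ∫⁻ ω, φ (sampler b w c M ω y) ∂tapeMeasure := by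
  have hw0 : 0 < w := by linarith
  rw [lintegral_sampler b hw0 c hφ M y]
  -- The contribution of runs in which every trial fails is dropped, as only a lower bound is
  -- needed.
  refine le_trans ?_ le_self_add
  have hp0 := le_sum_rho hw hc hb hb'
  set p : ℝ := (2 ^ (b + 1))⁻¹ * ∑ j ∈ Finset.range (2 ^ (b + 1)), rho w (c - 2 ^ b + j) with hp
  have hp1 : p ≤ 1 := by
    rw [hp, inv_mul_le_iff₀ (by positivity), mul_one]
    refine (Finset.sum_le_sum fun j _ => rho_le_one w _).trans ?_
    simp
  have hppos : 0 < p := by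
    rw [hp]
    refine mul_pos (by positivity) (Finset.sum_pos (fun j _ => rho_pos _ _) ?_)
    simp
  have h2 : ((2 : ENNReal) ^ (b + 1))⁻¹ = ENNReal.ofReal ((2 ^ (b + 1))⁻¹) := by
    rw [ENNReal.ofReal_inv_of_pos (by positivity), ENNReal.ofReal_pow (by norm_num)]
    simp
  have hp' : ((2 : ENNReal) ^ (b + 1))⁻¹ * ∑ j ∈ Finset.range (2 ^ (b + 1)),
      ENNReal.ofReal (1 - rho w (c - 2 ^ b + j)) = ENNReal.ofReal (1 - p) := by
    rw [← ENNReal.ofReal_sum_of_nonneg (fun j _ => by linarith [rho_le_one w (c - 2 ^ b + j)]), h2,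
      ← ENNReal.ofReal_mul (by positivity), Finset.sum_sub_distrib, mul_sub, ← hp]
    congr 2
    simp
  rw [hp']
  have hgeom : ∑ i ∈ Finset.range M, ENNReal.ofReal (1 - p) ^ i =
      ENNReal.ofReal ((1 - (1 - p) ^ M) / p) := by
    simp_rw [← ENNReal.ofReal_pow (by linarith : 0 ≤ 1 - p)]
    rw [← ENNReal.ofReal_sum_of_nonneg (fun i _ => pow_nonneg (by linarith) i),
      geom_sum_eq (by linarith)]
    congr 1
    rw [← neg_div_neg_eq]
    congr 1 <;> ring
  -- A success probability of at least `1/(400K)` and at least `400K²` trials give `p * M ≥ K`.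
  have hdecay : (1 - p) ^ M ≤ Real.exp (-K) := by
    calc (1 - p) ^ M ≤ Real.exp (-p) ^ M := by
          exact pow_le_pow_left₀ (by linarith) (Real.one_sub_le_exp_neg p) M
      _ = Real.exp (M * -p) := by rw [Real.exp_nat_mul]
      _ ≤ _ := by
        apply Real.exp_le_exp.2
        have hM' : (400 * K * K : ℝ) ≤ M := by exact_mod_cast hM
        have : (K : ℝ) * 1 ≤ K * (400 * K * p) := by gcongr
        nlinarith
  have hup : ∑ j ∈ Finset.range (2 ^ (b + 1)), rho w (c - 2 ^ b + j) ≤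
      w * (1 + 4 * Real.exp (-Real.pi * w ^ 2)) := by
    refine le_trans ?_ (tsum_rho_le c hw le_rfl)
    have hinj : Set.InjOn (fun j : ℕ => (j : ℤ) - 2 ^ b) (Finset.range (2 ^ (b + 1))) := by
      intro i _ j _ hij
      simpa using hij
    have := (summable_rho c hw0).sum_le_tsum
      ((Finset.range (2 ^ (b + 1))).image (fun j : ℕ => (j : ℤ) - 2 ^ b))
      (fun _ _ => (rho_pos _ _).le)
    rw [Finset.sum_image hinj] at this
    refine le_trans (le_of_eq (Finset.sum_congr rfl fun j _ => ?_)) this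
    push_cast
    congr 1
    ring
  rw [hgeom, h2, ← mul_assoc, ← ENNReal.ofReal_mul (by
    apply div_nonneg _ hppos.le
    have : (1 - p) ^ M ≤ 1 := pow_le_one₀ (by linarith) (by linarith)
    linarith), Finset.mul_sum, Finset.mul_sum]
  refine Finset.sum_le_sum fun j _ => ?_
  rw [← mul_assoc, ← mul_assoc, dens]
  gcongr ?_ * _
  set ρj := rho w (c - 2 ^ b + j)
  have hρ : 0 < ρj := rho_pos _ _
  have hE := Real.exp_pos (-Real.pi * w ^ 2)
  have hK1 : Real.exp (-(K : ℝ)) ≤ 1 := Real.exp_le_one_iff.2 (by simp)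
  rw [← ENNReal.ofReal_mul (div_nonneg (by linarith) (by linarith)),
    ← ENNReal.ofReal_mul (mul_nonneg (div_nonneg (by linarith) hppos.le) (by positivity))]
  apply ENNReal.ofReal_le_ofReal
  have h5 : p * 2 ^ (b + 1) ≤ w * (1 + 4 * Real.exp (-Real.pi * w ^ 2)) := by
    rw [hp, mul_comm _ ((2 : ℝ) ^ (b + 1)), mul_inv_cancel_left₀ (by positivity)]
    exact hup
  have hE1 : 0 < 1 + 4 * Real.exp (-Real.pi * w ^ 2) := by linarith
  exact geom_weight_le hK1 hdecay hppos (by positivity) hw0 hE1 hρ.le h5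

/-! ### Lattice sums -/

/-- The window `[-N, N)` has integer length `2N`, so it contains exactly `2N` points of the coset `z
+ ℤ`, namely the proposals of the sampler. This makes visible that they depend on `z` modulo 1 only.
-/
lemma sum_fract_eq_tsum (N : ℕ) (z : ℝ) (F : ℝ → ENNReal) :
    ∑ j ∈ Finset.range (2 * N), F (Int.fract z - N + j) =
      ∑' k : ℤ, (Set.Ico (-N : ℝ) N).indicator F (z + k) := by
  have h1 : ∑' k : ℤ, (Set.Ico (-N : ℝ) N).indicator F (z + k) =
      ∑' k : ℤ, (Set.Ico (-N : ℝ) N).indicator F (Int.fract z + k) := by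
    rw [← (Equiv.addRight ⌊z⌋).tsum_eq
      (fun k : ℤ => (Set.Ico (-N : ℝ) N).indicator F (Int.fract z + k))]
    refine tsum_congr fun k => ?_
    congr 1
    simp only [Equiv.coe_addRight, Int.cast_add]
    linarith [Int.floor_add_fract z]
  have h0 := Int.fract_nonneg z
  have h2 := Int.fract_lt_one z
  rw [h1, tsum_eq_sum (s := (Finset.range (2 * N)).image fun j : ℕ => (j : ℤ) - N),
    Finset.sum_image (by intro i _ j _ hij; simpa using hij)]
  · refine Finset.sum_congr rfl fun j hj => ?_
    have hj' : (j : ℝ) + 1 ≤ 2 * N := by exact_mod_cast Finset.mem_range.1 hj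
    have hj0 : (0 : ℝ) ≤ j := Nat.cast_nonneg j
    rw [Set.indicator_of_mem]
    · congr 1
      push_cast
      ring
    · push_cast
      constructor <;> linarith
  · intro k hk
    apply Set.indicator_of_notMem
    rintro ⟨h3, h4⟩
    apply hk
    have h5 : (-N : ℤ) < k + 1 := by
      have : (-N : ℝ) < k + 1 := by linarith
      exact_mod_cast this
    have h6 : k < N := by
      have : (k : ℝ) < N := by linarith
      exact_mod_cast this
    rw [Finset.mem_image]
    exact ⟨(k + N).toNat, Finset.mem_range.2 (by omega), by omega⟩

lemma sum_range_tsum_int {q : ℕ} (hq : 0 < q) (F : ℤ → ENNReal) :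
    ∑ a ∈ Finset.range q, ∑' k : ℤ, F (a + q * k) = ∑' z : ℤ, F z := by
  have : NeZero q := ⟨hq.ne'⟩
  rw [← (Int.divModEquiv q).symm.tsum_eq F, ENNReal.tsum_prod', ENNReal.tsum_comm, tsum_fintype,
    ← Fin.sum_univ_eq_sum_range (fun a : ℕ => ∑' k : ℤ, F (a + q * k))]
  refine Finset.sum_congr rfl fun a _ => tsum_congr fun k => ?_
  congr 1
  simp only [Int.divModEquiv_symm_apply]
  ring

lemma lintegral_fundamental {F : ℝ → ENNReal} (hF : Measurable F) :
    ∫⁻ x, F x = ∫⁻ x in Set.Ico (0 : ℝ) 1, ∑' k : ℤ, F (x + k) := by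
  rw [lintegral_tsum fun k => (by fun_prop), ← setLIntegral_univ, ← iUnion_Ico_intCast ℝ,
    lintegral_iUnion (fun _ => measurableSet_Ico) (Set.pairwise_disjoint_Ico_intCast ℝ)]
  refine tsum_congr fun k => ?_
  rw [← lintegral_indicator measurableSet_Ico, ← lintegral_indicator measurableSet_Ico,
    ← lintegral_add_right_eq_self _ (k : ℝ)]
  refine lintegral_congr fun x => ?_
  simp only [Set.indicator, Set.mem_Ico]
  congr 1
  simp only [eq_iff_iff]
  constructor <;> rintro ⟨h1, h2⟩ <;> constructor <;> linarith

/-! ### Uniform distributions on `ℤ_q` -/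

lemma lintegral_unifZq (q : ℕ) (F : ℝ → ENNReal) :
    ∫⁻ a, F a ∂unifZq q = ∑ a ∈ Finset.range q, (q : ENNReal)⁻¹ * F a := by
  simp [unifZq, lintegral_finsetSum_measure]

lemma isProbabilityMeasure_unifZq {q : ℕ} (hq : 0 < q) : IsProbabilityMeasure (unifZq q) := by
  refine ⟨?_⟩
  rw [← lintegral_one, lintegral_unifZq]
  simp only [mul_one, Finset.sum_const, Finset.card_range, nsmul_eq_mul]
  exact ENNReal.mul_inv_cancel (by simp [hq.ne']) (by simp)

instance : ∀ q, SFinite (unifZq q)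
  | 0 => by simp [unifZq]; infer_instance
  | q + 1 => by have := isProbabilityMeasure_unifZq q.succ_pos; infer_instance

/-! ### Gaussian noise modulo one -/

/-- The expected value of `g` at `e + h mod 1` with `e ∼ D_α`. -/
def noisy (α h : ℝ) (g : ℝ → ENNReal) : ENNReal :=
  ∫⁻ e, g (Int.fract (e + h)) ∂contGaussian α

lemma noisy_eq {α : ℝ} (hα : 0 < α) (h : ℝ) {g : ℝ → ENNReal} (hg : Measurable g) :
    noisy α h g = ∫⁻ b, dens α (b - h) * g (Int.fract b) := by
  rw [noisy, lintegral_contGaussian hα (by fun_prop),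
    ← lintegral_sub_right_eq_self (fun e => dens α e * g (Int.fract (e + h))) h]
  simp

/-- Here integrality of the secret becomes useful: changing the lift of `a_j/q` by an integer
changes `(a_j/q) s_j` by an integer. -/
lemma noisy_add_int (α h : ℝ) (k : ℤ) (g : ℝ → ENNReal) : noisy α (h + k) g = noisy α h g := by
  unfold noisy
  simp_rw [← add_assoc, Int.fract_add_intCast]

lemma measurable_noisy {X : Type*} [MeasurableSpace X] (α : ℝ) {h : X → ℝ} (hh : Measurable h)
    {g : X → ℝ → ENNReal} (hg : Measurable fun z : X × ℝ => g z.1 z.2) :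
    Measurable fun x => noisy α (h x) (g x) := by
  unfold noisy
  apply Measurable.lintegral_prod_right' (f := fun z : X × ℝ => g z.1 (Int.fract (z.2 + h z.1)))
  exact hg.comp (by fun_prop : Measurable fun z : X × ℝ => (z.1, Int.fract (z.2 + h z.1)))

/-- Noise on top of a uniform element of `(1/q)ℤ/ℤ` is almost uniform. -/
lemma le_lintegral_unifZq_noisy {α w : ℝ} {q : ℕ} (hq : 0 < q) (hα : 0 < α) (hw : 1 ≤ w)
    (h : w ≤ q * α) {g : ℝ → ENNReal} (hg : Measurable g) :
    ENNReal.ofReal (1 - 4 * Real.exp (-Real.pi * w ^ 2)) * ∫⁻ b, g b ∂unifTorus ≤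
      ∫⁻ a, noisy α (a / q) g ∂unifZq q := by
  rw [lintegral_unifZq]
  have h1 : ∀ a : ℕ, (q : ENNReal)⁻¹ * noisy α (a / q) g =
      ∫⁻ x in Set.Ico (0 : ℝ) 1, (∑' k : ℤ, (q : ENNReal)⁻¹ * dens α (x - (a + q * k : ℤ) / q)) *
        g x := by
    intro a
    rw [noisy_eq hα _ hg, lintegral_fundamental (by fun_prop),
      ← lintegral_const_mul _ (by fun_prop)]
    refine setLIntegral_congr_fun measurableSet_Ico fun x hx => ?_
    rw [← ENNReal.tsum_mul_left, ← ENNReal.tsum_mul_right,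
      ← (Equiv.neg ℤ).tsum_eq]
    refine tsum_congr fun k => ?_
    simp only [Equiv.neg_apply]
    rw [Int.fract_add_intCast, Int.fract_eq_self.2 hx, mul_assoc]
    congr 3
    have : (q : ℝ) ≠ 0 := by exact_mod_cast hq.ne'
    push_cast
    field_simp
    ring
  simp_rw [h1]
  rw [← lintegral_finsetSum _ fun a _ => by fun_prop, unifTorus,
    ← lintegral_const_mul _ hg]
  refine lintegral_mono fun x => ?_
  rw [← Finset.sum_mul,
    sum_range_tsum_int hq (fun z => (q : ENNReal)⁻¹ * dens α (x - z / q))]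
  gcongr
  exact le_tsum_dens hq hα hw x h

/-- Noise on top of a discrete Gaussian is almost a continuous Gaussian. -/
lemma le_lintegral_discGaussian_noisy {α σ w : ℝ} {q : ℕ} (hq : 0 < q) (hα : 0 < α)
    (hw : 1 ≤ w) (hσ : w ≤ σ) (hw' : w ≤ q * (σ / q * α / √(α ^ 2 + (σ / q) ^ 2))) (h : ℝ)
    {g : ℝ → ENNReal} (hg : Measurable g) :
    ENNReal.ofReal ((1 - 4 * Real.exp (-Real.pi * w ^ 2)) /
        (1 + 4 * Real.exp (-Real.pi * w ^ 2))) * noisy (√(α ^ 2 + (σ / q) ^ 2)) h g ≤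
      ∫⁻ e, noisy α (e / q + h) g ∂discGaussian σ := by
  have hσ0 : 0 < σ := by linarith
  have hq' : (0 : ℝ) < q := by exact_mod_cast hq
  set κ := 1 + 4 * Real.exp (-Real.pi * w ^ 2) with hκ
  have hκ0 : 0 < κ := by positivity
  have hη0 : 0 < √(α ^ 2 + (σ / q) ^ 2) := Real.sqrt_pos.2 (by positivity)
  -- By Poisson summation the normalising constant of the discrete Gaussian is at most `σ * κ`, so
  -- each mass is at least `κ⁻¹` times the corresponding Riemann weight of `D_{σ/q}` on `(1/q)ℤ`.
  have h1 : ∀ k : ℤ, ENNReal.ofReal κ⁻¹ * ((q : ENNReal)⁻¹ * dens (σ / q) (0 - k / q)) ≤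
      ENNReal.ofReal (rho σ k / ∑' j : ℤ, rho σ j) := by
    intro k
    have e3 : (q : ENNReal)⁻¹ = ENNReal.ofReal ((q : ℝ)⁻¹) := by
      rw [ENNReal.ofReal_inv_of_pos hq', ENNReal.ofReal_natCast]
    have e4 : rho (σ / q) (0 - k / q) = rho σ k := by
      rw [zero_sub, rho_neg, rho, rho, div_div_div_cancel_right₀ hq'.ne']
    have hs := tsum_rho_le 0 hw hσ
    simp only [add_zero] at hs
    have hs0 : 0 < ∑' j : ℤ, rho σ j := by
      have h0 := summable_rho 0 hσ0
      simp only [add_zero] at h0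
      exact h0.tsum_pos (fun _ => (rho_pos _ _).le) 0 (rho_pos _ _)
    rw [e3, dens, e4, ← ENNReal.ofReal_mul (by positivity), ← ENNReal.ofReal_mul (by positivity)]
    apply ENNReal.ofReal_le_ofReal
    calc κ⁻¹ * ((q : ℝ)⁻¹ * (rho σ k / (σ / q))) = rho σ k / (σ * κ) := by field_simp
      _ ≤ _ := by
        gcongr
        exact (rho_pos _ _).le
  rw [discGaussian, lintegral_sum_measure]
  simp only [lintegral_smul_measure, lintegral_dirac, smul_eq_mul]
  calc _ ≤ ∫⁻ b, ∑' k : ℤ, ENNReal.ofReal κ⁻¹ * ((q : ENNReal)⁻¹ * dens (σ / q) (0 - k / q) *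
        dens α (b - h - k / q * 1)) * g (Int.fract b) := by
        rw [noisy_eq hη0 _ hg, ← lintegral_const_mul _ (by fun_prop)]
        refine lintegral_mono fun b => ?_
        -- Smoothing the discrete error is the special case of slope `t = 1` and centre `y = 0`.
        have h2 := le_tsum_dens_mul_dens hq (ρ := σ / q) (by positivity) hα hw 1 0 (b - h)
          (by simpa using hw')
        rw [div_eq_mul_inv, mul_comm _ κ⁻¹, ENNReal.ofReal_mul (by positivity), ENNReal.tsum_mul_right,
          ENNReal.tsum_mul_left, ← mul_assoc, mul_assoc (ENNReal.ofReal κ⁻¹)]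
        gcongr
        simpa using h2
    _ = ∑' k : ℤ, (ENNReal.ofReal κ⁻¹ * ((q : ENNReal)⁻¹ * dens (σ / q) (0 - k / q))) *
        noisy α (k / q + h) g := by
        rw [lintegral_tsum fun k => by fun_prop]
        refine tsum_congr fun k => ?_
        rw [noisy_eq hα _ hg, ← lintegral_const_mul _ (by fun_prop)]
        refine lintegral_congr fun b => ?_
        rw [show b - h - k / q * 1 = b - (k / q + h) by ring]
        ring
    _ ≤ _ := by
        refine ENNReal.tsum_le_tsum fun k => ?_
        gcongr
        exact h1 k

/-! ### The law of one coordinate -/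

/-- The reduction of one entry, without truncation and without the final scaling. -/
def cell (q : ℕ) (ρ w : ℝ) (b M : ℕ) (a : ℝ) (ω : Tape) : ℝ :=
  sampler b w (Int.fract (a / q + ρ * (ω 0).2)) M (shift 1 ω) 0

@[fun_prop]
lemma measurable_cell (q : ℕ) (ρ w : ℝ) (b M : ℕ) :
    Measurable fun z : ℝ × Tape => cell q ρ w b M z.1 z.2 :=
  (measurable_sampler b w M).comp
    (by fun_prop : Measurable fun z : ℝ × Tape =>
      (Int.fract (z.1 / q + ρ * (z.2 0).2), shift 1 z.2, (0 : ℝ)))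

/-- The joint law of the reduction of a uniform entry `a`, and `a / q`. -/
def coordLaw (q : ℕ) (ρ w : ℝ) (b M : ℕ) : Measure (ℝ × ℝ) :=
  ((unifZq q).prod tapeMeasure).map fun z => (cell q ρ w b M z.1 z.2, z.1 / q)

/-- The Gaussian `D_w` restricted to `[-2^b, 2^b)`. -/
def truncGaussian (w : ℝ) (b : ℕ) : Measure ℝ :=
  (contGaussian w).restrict (Set.Ico (-2 ^ b) (2 ^ b))

instance (q : ℕ) (ρ w : ℝ) (b M : ℕ) : SFinite (coordLaw q ρ w b M) := by
  unfold coordLaw; infer_instance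

lemma isProbabilityMeasure_coordLaw {q : ℕ} (hq : 0 < q) (ρ w : ℝ) (b M : ℕ) :
    IsProbabilityMeasure (coordLaw q ρ w b M) := by
  have := isProbabilityMeasure_unifZq hq
  exact Measure.isProbabilityMeasure_map (by fun_prop)

instance (w : ℝ) (b : ℕ) : IsFiniteMeasure (truncGaussian w b) := by
  unfold truncGaussian; infer_instance

/-- For a fixed noise `g` the sampler gives each point `y = a/q + ρg + k` of the coset nearly the
weight `dens w y`. Substituting `y` for `g` turns the sum over points of the coset into a sum over
lifts of `a/q`; reflecting `k` is harmless as it ranges over ℤ through the substitution itself. -/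
lemma le_lintegral_cell {q b K M : ℕ} {ρ w : ℝ} (hρ : 0 < ρ) (hw : 1 ≤ w)
    (hb : w ≤ 2 ^ b) (hb' : 2 ^ b ≤ 4 * K * w) (hM : 400 * K * K ≤ M) (a : ℝ)
    {Φ : ℝ → ENNReal} (hΦ : Measurable Φ) :
    ENNReal.ofReal ((1 - Real.exp (-K)) / (1 + 4 * Real.exp (-Real.pi * w ^ 2))) *
        ∑' k : ℤ, ∫⁻ y in Set.Ico (-2 ^ b) (2 ^ b), dens ρ (y - (a / q + k)) * (dens w y * Φ y) ≤
      ∫⁻ ω, Φ (cell q ρ w b M a ω) ∂tapeMeasure := by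
  have hm : Measurable fun z : ℝ × Tape =>
      Φ (sampler b w (Int.fract (a / q + ρ * z.1)) M z.2 0) :=
    hΦ.comp ((measurable_sampler b w M).comp (by fun_prop : Measurable fun z : ℝ × Tape =>
      (Int.fract (a / q + ρ * z.1), z.2, (0 : ℝ))))
  have h1 := lintegral_tape_gauss hm
  simp only [cell]
  rw [h1]
  set θ := ENNReal.ofReal ((1 - Real.exp (-K)) / (1 + 4 * Real.exp (-Real.pi * w ^ 2)))
  set G : ℝ → ENNReal := (Set.Ico (-2 ^ b) (2 ^ b)).indicator fun y => dens w y * Φ y with hG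
  have hGm : Measurable G := Measurable.indicator (by fun_prop) measurableSet_Ico
  calc _ = θ * ∑' k : ℤ, ∫⁻ x, G (a / q + x + k) ∂contGaussian ρ := by
        congr 1
        refine tsum_congr fun k => ?_
        rw [lintegral_contGaussian hρ (by fun_prop), ← lintegral_indicator measurableSet_Ico,
          ← lintegral_sub_right_eq_self (fun x => dens ρ x * G (a / q + x + k)) (a / q + k)]
        refine lintegral_congr fun y => ?_
        rw [show a / q + (y - (a / q + k)) + k = y by ring, hG]
        by_cases hy : y ∈ Set.Ico (-2 ^ b : ℝ) (2 ^ b)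
        · rw [Set.indicator_of_mem hy, Set.indicator_of_mem hy]
        · rw [Set.indicator_of_notMem hy, Set.indicator_of_notMem hy, mul_zero]
    _ = ∫⁻ g, θ * ∑' k : ℤ, G (a / q + ρ * g + k) ∂contGaussian 1 := by
        rw [lintegral_const_mul _ (by fun_prop), ← lintegral_tsum fun k => by fun_prop]
        nth_rw 1 [← mul_one ρ]
        rw [← contGaussian_map_mul, lintegral_map (by fun_prop) (by fun_prop)]
    _ ≤ _ := by
        refine lintegral_mono fun g => ?_
        refine le_trans (le_of_eq ?_) (le_lintegral_sampler hw
          ⟨Int.fract_nonneg (a / q + ρ * g), Int.fract_lt_one _⟩ hb hb' hM hΦ 0)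
        congr 1
        have h2 := sum_fract_eq_tsum (2 ^ b) (a / q + ρ * g) fun y => dens w y * Φ y
        push_cast at h2
        rw [pow_succ' (2 : ℕ), h2]

/-- The joint law of the reduction of an entry `a` and of `(a / q) t + e` is almost the law of
`y` and `y t + e'` with a wider noise `e'`. -/
lemma le_lintegral_coordLaw {q b K M : ℕ} {ρ w α : ℝ} (hq : 0 < q) (hρ : 0 < ρ) (hα : 0 < α)
    (hw : 1 ≤ w) (hb : w ≤ 2 ^ b) (hb' : 2 ^ b ≤ 4 * K * w) (hM : 400 * K * K ≤ M) (t : ℤ)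
    (h : ℝ) (ht : w ≤ q * (ρ * α / √(α ^ 2 + t ^ 2 * ρ ^ 2)))
    {g : ℝ → ℝ → ENNReal} (hg : Measurable fun z : ℝ × ℝ => g z.1 z.2) :
    ENNReal.ofReal ((1 - Real.exp (-K)) / (1 + 4 * Real.exp (-Real.pi * w ^ 2)) *
        (1 - 4 * Real.exp (-Real.pi * w ^ 2))) *
        ∫⁻ y, noisy (√(α ^ 2 + t ^ 2 * ρ ^ 2)) (y * t + h) (g y) ∂truncGaussian w b ≤
      ∫⁻ z, noisy α (z.2 * t + h) (g z.1) ∂coordLaw q ρ w b M := by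
  have hq' : (q : ℝ) ≠ 0 := by exact_mod_cast hq.ne'
  have hη0 : 0 < √(α ^ 2 + t ^ 2 * ρ ^ 2) := Real.sqrt_pos.2 (by positivity)
  have hK1 : Real.exp (-(K : ℝ)) ≤ 1 := Real.exp_le_one_iff.2 (by simp)
  rw [ENNReal.ofReal_mul (div_nonneg (by linarith) (by positivity))]
  set θ := ENNReal.ofReal ((1 - Real.exp (-K)) / (1 + 4 * Real.exp (-Real.pi * w ^ 2))) with hθ
  have hgy : ∀ y, Measurable (g y) := fun y => hg.comp (by fun_prop : Measurable fun b : ℝ => (y, b))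
  have hnm : ∀ c : ℝ, Measurable fun y => noisy α c (g y) := fun c =>
    measurable_noisy α measurable_const hg
  have hgf : Measurable fun z : ℝ × ℝ => g z.1 (Int.fract z.2) :=
    hg.comp (by fun_prop : Measurable fun z : ℝ × ℝ => (z.1, Int.fract z.2))
  have hR : ∫⁻ z, noisy α (z.2 * t + h) (g z.1) ∂coordLaw q ρ w b M =
      ∑ a ∈ Finset.range q, (q : ENNReal)⁻¹ *
        ∫⁻ ω, noisy α ((a : ℝ) / q * t + h) (g (cell q ρ w b M a ω)) ∂tapeMeasure := by
    rw [coordLaw, lintegral_map, lintegral_prod, lintegral_unifZq]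
    · exact ((measurable_noisy α (h := fun z : ℝ × ℝ => z.2 * t + h) (g := fun z => g z.1)
        (by fun_prop) (hg.comp (by fun_prop : Measurable fun z : (ℝ × ℝ) × ℝ =>
          (z.1.1, z.2)))).comp (by fun_prop : Measurable fun z : ℝ × Tape =>
            (cell q ρ w b M z.1 z.2, z.1 / q))).aemeasurable
    · exact measurable_noisy α (h := fun z : ℝ × ℝ => z.2 * t + h) (g := fun z => g z.1)
        (by fun_prop) (hg.comp (by fun_prop : Measurable fun z : (ℝ × ℝ) × ℝ => (z.1.1, z.2)))
    · fun_prop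
  rw [hR]
  have hterm : ∀ (z : ℤ) (y : ℝ), Measurable fun b' =>
      (q : ENNReal)⁻¹ * dens ρ (y - z / q) * dens α (b' - h - z / q * t) * g y (Int.fract b') :=
    fun z y => by
      have := hgy y
      fun_prop
  calc _ ≤ θ * ∫⁻ y in Set.Ico (-2 ^ b) (2 ^ b), dens w y * ∫⁻ b', ∑' z : ℤ,
          (q : ENNReal)⁻¹ * dens ρ (y - z / q) * dens α (b' - h - z / q * t) *
            g y (Int.fract b') := by
        rw [mul_assoc]
        gcongr
        rw [truncGaussian, contGaussian_eq (by linarith), restrict_withDensity measurableSet_Ico,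
          lintegral_withDensity_eq_lintegral_mul _ (measurable_dens w)
            (measurable_noisy _ (by fun_prop) hg),
          ← lintegral_const_mul _ ((measurable_dens w).mul (measurable_noisy _ (by fun_prop) hg))]
        refine lintegral_mono fun y => ?_
        simp only [Pi.mul_apply]
        rw [mul_left_comm]
        gcongr
        have := hgy y
        rw [noisy_eq hη0 _ (hgy y), ← lintegral_const_mul _ (by fun_prop)]
        refine lintegral_mono fun b' => ?_
        rw [ENNReal.tsum_mul_right, ← mul_assoc]
        gcongr
        have h2 := le_tsum_dens_mul_dens hq hρ hα hw t y (b' - h) ht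
        rwa [show b' - h - y * t = b' - (y * t + h) by ring] at h2
    _ = θ * ∑' z : ℤ, (q : ENNReal)⁻¹ * ∫⁻ y in Set.Ico (-2 ^ b) (2 ^ b),
          dens ρ (y - z / q) * (dens w y * noisy α (z / q * t + h) (g y)) := by
        congr 1
        have e : ∀ y, dens w y * ∫⁻ b', ∑' z : ℤ, (q : ENNReal)⁻¹ * dens ρ (y - z / q) *
            dens α (b' - h - z / q * t) * g y (Int.fract b') =
            ∑' z : ℤ, (q : ENNReal)⁻¹ *
              (dens ρ (y - z / q) * (dens w y * noisy α (z / q * t + h) (g y))) := by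
          intro y
          have := hgy y
          rw [lintegral_tsum fun z => (hterm z y).aemeasurable, ← ENNReal.tsum_mul_left]
          refine tsum_congr fun z => ?_
          rw [noisy_eq hα _ (hgy y)]
          simp_rw [mul_assoc]
          rw [lintegral_const_mul _ (by fun_prop), lintegral_const_mul _ (by fun_prop)]
          simp_rw [sub_sub, add_comm h]
          ring
        simp_rw [e]
        have hn := fun z : ℤ => hnm (z / q * t + h)
        rw [lintegral_tsum fun z => by have := hn z; fun_prop]
        refine tsum_congr fun z => ?_
        have := hn z
        rw [lintegral_const_mul _ (by fun_prop)]
    _ = ∑ a ∈ Finset.range q, (q : ENNReal)⁻¹ * (θ * ∑' k : ℤ,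
          ∫⁻ y in Set.Ico (-2 ^ b) (2 ^ b), dens ρ (y - ((a : ℝ) / q + k)) *
            (dens w y * noisy α ((a : ℝ) / q * t + h) (g y))) := by
        rw [← sum_range_tsum_int hq, Finset.mul_sum]
        refine Finset.sum_congr rfl fun a _ => ?_
        rw [ENNReal.tsum_mul_left, mul_left_comm]
        congr 3
        funext k
        refine lintegral_congr fun y => ?_
        have e1 : (((a : ℤ) + q * k : ℤ) : ℝ) / q = a / q + k := by
          push_cast
          field_simp
        -- Writing `z = a + qk` separates the residue `a` from an integer shift; the latter moves
        -- the argument of `noisy` by the integer `k * t`.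
        have e2 : ((a : ℝ) / q + k) * t + h = a / q * t + h + (k * t : ℤ) := by
          push_cast; ring
        rw [e1, e2, noisy_add_int]
    _ ≤ _ := by
        gcongr with a ha
        exact le_lintegral_cell hρ hw hb hb' hM a (hnm _)

/-! ### All entries of one sample -/

lemma lintegral_pi_succ {X : Type*} [MeasurableSpace X] {n : ℕ} (μ : Measure X) [SigmaFinite μ]
    {F : (Fin (n + 1) → X) → ENNReal} (hF : Measurable F) :
    ∫⁻ x, F x ∂Measure.pi (fun _ => μ) =
      ∫⁻ x, ∫⁻ y, F (Fin.cons x y) ∂Measure.pi (fun _ : Fin n => μ) ∂μ := by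
  have h := (measurePreserving_piFinSuccAbove (fun _ : Fin (n + 1) => μ) 0).symm
  rw [← h.map_eq, lintegral_map hF (MeasurableEquiv.measurable _), lintegral_prod]
  · refine lintegral_congr fun x => lintegral_congr fun y => ?_
    simp [MeasurableEquiv.piFinSuccAbove, Fin.insertNthEquiv]
  · exact (hF.comp (MeasurableEquiv.measurable _)).aemeasurable

lemma measurable_finCons {X : Type*} [MeasurableSpace X] {n : ℕ} :
    Measurable fun z : X × (Fin n → X) => (Fin.cons z.1 z.2 : Fin (n + 1) → X) := by
  refine measurable_pi_lambda _ fun j => ?_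
  refine Fin.cases ?_ (fun j => ?_) j
  · simpa using measurable_fst
  · simp only [Fin.cons_succ]
    fun_prop

/-- The law of all entries of one sample. -/
lemma le_lintegral_pi_coordLaw {q b K M : ℕ} {ρ w : ℝ} (hq : 0 < q) (hρ : 0 < ρ)
    (hw : 1 ≤ w) (hb : w ≤ 2 ^ b) (hb' : 2 ^ b ≤ 4 * K * w) (hM : 400 * K * K ≤ M)
    (hqρ : 2 * w ≤ q * ρ) {n : ℕ} (s : Fin n → ℤ) {α : ℝ} (hα : 0 < α)
    (hs : ∀ j, (s j : ℝ) ^ 2 * ρ ^ 2 ≤ α ^ 2) (h : ℝ)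
    {g : (Fin n → ℝ) → ℝ → ENNReal} (hg : Measurable fun z : (Fin n → ℝ) × ℝ => g z.1 z.2) :
    ENNReal.ofReal ((1 - Real.exp (-K)) / (1 + 4 * Real.exp (-Real.pi * w ^ 2)) *
        (1 - 4 * Real.exp (-Real.pi * w ^ 2))) ^ n *
        ∫⁻ y, noisy (√(α ^ 2 + ρ ^ 2 * ∑ j, (s j : ℝ) ^ 2)) (∑ j, y j * s j + h) (g y)
          ∂Measure.pi (fun _ : Fin n => truncGaussian w b) ≤
      ∫⁻ z, noisy α (∑ j, (z j).2 * s j + h) (g fun j => (z j).1)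
        ∂Measure.pi (fun _ : Fin n => coordLaw q ρ w b M) := by
  have := isProbabilityMeasure_coordLaw hq ρ w b M
  set θ := ENNReal.ofReal ((1 - Real.exp (-K)) / (1 + 4 * Real.exp (-Real.pi * w ^ 2)) *
        (1 - 4 * Real.exp (-Real.pi * w ^ 2))) with hθ
  induction n generalizing h with
  | zero =>
    have e : ∀ (X : Type) [MeasurableSpace X] (μ : Measure X) (F : (Fin 0 → X) → ENNReal),
        ∫⁻ x, F x ∂Measure.pi (fun _ : Fin 0 => μ) = F Fin.elim0 := by
      intro X _ μ F
      rw [lintegral_unique, Measure.pi_empty_univ, mul_one]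
      congr 1
    rw [e, e]
    simp only [pow_zero, one_mul, Finset.univ_eq_empty, Finset.sum_empty, mul_zero, add_zero,
      Real.sqrt_sq hα.le]
    exact le_of_eq (congrArg _ (congrArg g (Subsingleton.elim _ _)))
  | succ n ih =>
    -- `η` is the width of the noise once coordinates `1, …, n` have been exchanged. Coordinate 0 is
    -- treated on top of this noise, and the induction hypothesis then resolves `η` into `α` and the
    -- other coordinates.
    set η := √(α ^ 2 + ρ ^ 2 * ∑ j : Fin n, (s j.succ : ℝ) ^ 2) with hη
    have hS : 0 ≤ ρ ^ 2 * ∑ j : Fin n, (s j.succ : ℝ) ^ 2 := by positivity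
    have hη2 : η ^ 2 = α ^ 2 + ρ ^ 2 * ∑ j : Fin n, (s j.succ : ℝ) ^ 2 :=
      Real.sq_sqrt (by positivity)
    have hη0 : 0 < η := Real.sqrt_pos.2 (by positivity)
    have hη' : √(α ^ 2 + ρ ^ 2 * ∑ j, (s j : ℝ) ^ 2) = √(η ^ 2 + (s 0 : ℝ) ^ 2 * ρ ^ 2) := by
      rw [hη2, Fin.sum_univ_succ]
      congr 1
      ring
    -- Since `|s 0| ρ ≤ α ≤ η`, the new width is at most `2 * η`, and the smoothing condition
    -- follows from `2 * w ≤ q * ρ`.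
    have hcond : w ≤ q * (ρ * η / √(η ^ 2 + (s 0 : ℝ) ^ 2 * ρ ^ 2)) := by
      have h1 : √(η ^ 2 + (s 0 : ℝ) ^ 2 * ρ ^ 2) ≤ 2 * η := by
        apply Real.sqrt_le_iff.2 ⟨by positivity, ?_⟩
        nlinarith [hs 0]
      calc w ≤ q * (ρ * η / (2 * η)) := by
            rw [mul_div_mul_right _ _ hη0.ne']
            linarith
        _ ≤ _ := by
          gcongr
    have hgc : Measurable fun z : (ℝ × (Fin n → ℝ)) × ℝ => g (Fin.cons z.1.1 z.1.2) z.2 :=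
      hg.comp (Measurable.prodMk (measurable_finCons.comp measurable_fst) measurable_snd)
    have hgs : ∀ x : ℝ, Measurable fun z : (Fin n → ℝ) × ℝ => g (Fin.cons x z.1) z.2 := fun x =>
      hgc.comp (by fun_prop : Measurable fun z : (Fin n → ℝ) × ℝ => ((x, z.1), z.2))
    have hg0 : ∀ y : Fin n → ℝ, Measurable fun z : ℝ × ℝ => g (Fin.cons z.1 y) z.2 := fun y =>
      hgc.comp (by fun_prop : Measurable fun z : ℝ × ℝ => ((z.1, y), z.2))
    calc _ = θ ^ n * ∫⁻ y, θ * ∫⁻ x, noisy (√(η ^ 2 + (s 0 : ℝ) ^ 2 * ρ ^ 2))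
            (x * s 0 + (∑ j, y j * s j.succ + h)) (g (Fin.cons x y)) ∂truncGaussian w b
            ∂Measure.pi (fun _ : Fin n => truncGaussian w b) := by
          have hm : Measurable fun z : (Fin n → ℝ) × ℝ =>
              noisy (√(η ^ 2 + (s 0 : ℝ) ^ 2 * ρ ^ 2))
                (z.2 * s 0 + (∑ j, z.1 j * s j.succ + h)) (g (Fin.cons z.2 z.1)) := by
            refine measurable_noisy _ (by fun_prop) ?_
            exact hgc.comp (by fun_prop : Measurable fun z : ((Fin n → ℝ) × ℝ) × ℝ =>
              ((z.1.2, z.1.1), z.2))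
          rw [lintegral_const_mul _ hm.lintegral_prod_right', ← mul_assoc, ← pow_succ,
            lintegral_lintegral_swap hm.aemeasurable, lintegral_pi_succ, hη']
          · simp only [Fin.sum_univ_succ, Fin.cons_zero, Fin.cons_succ, add_assoc]
          · exact measurable_noisy _ (by fun_prop) hg
      _ ≤ θ ^ n * ∫⁻ y, ∫⁻ z, noisy η (z.2 * s 0 + (∑ j, y j * s j.succ + h))
            (g (Fin.cons z.1 y)) ∂coordLaw q ρ w b M
            ∂Measure.pi (fun _ : Fin n => truncGaussian w b) := by
          gcongr with y
          exact le_lintegral_coordLaw hq hρ hη0 hw hb hb' hM (s 0) _ hcond (hg0 y)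
      _ = ∫⁻ z, θ ^ n * ∫⁻ y, noisy η (∑ j, y j * s j.succ + (z.2 * s 0 + h))
            (g (Fin.cons z.1 y)) ∂Measure.pi (fun _ : Fin n => truncGaussian w b)
            ∂coordLaw q ρ w b M := by
          have hm : Measurable fun z : (ℝ × ℝ) × (Fin n → ℝ) =>
              noisy η (∑ j, z.2 j * s j.succ + (z.1.2 * s 0 + h)) (g (Fin.cons z.1.1 z.2)) := by
            refine measurable_noisy _ (by fun_prop) ?_
            exact hgc.comp (by fun_prop : Measurable fun z : ((ℝ × ℝ) × (Fin n → ℝ)) × ℝ =>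
              ((z.1.1.1, z.1.2), z.2))
          rw [lintegral_const_mul _ hm.lintegral_prod_right',
            lintegral_lintegral_swap (f := fun (z : ℝ × ℝ) (y : Fin n → ℝ) =>
              noisy η (∑ j, y j * s j.succ + (z.2 * s 0 + h)) (g (Fin.cons z.1 y)))
              hm.aemeasurable]
          simp_rw [add_left_comm]
      _ ≤ ∫⁻ z, ∫⁻ zs, noisy α (∑ j, (zs j).2 * s j.succ + (z.2 * s 0 + h))
            (g (Fin.cons z.1 fun j => (zs j).1)) ∂Measure.pi (fun _ : Fin n => coordLaw q ρ w b M)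
            ∂coordLaw q ρ w b M :=
          lintegral_mono fun z => ih (fun j => s j.succ) (fun j => hs j.succ) _ (hgs z.1)
      _ = _ := by
          rw [lintegral_pi_succ]
          · refine lintegral_congr fun z => lintegral_congr fun zs => ?_
            rw [Fin.sum_univ_succ]
            simp only [Fin.cons_zero, Fin.cons_succ]
            congr 1
            · ring
            · congr 1
              funext j
              refine Fin.cases rfl (fun j => rfl) j
          · refine measurable_noisy _ (by fun_prop) ?_
            exact hg.comp (by fun_prop : Measurable fun z : (Fin (n + 1) → ℝ × ℝ) × ℝ =>
              ((fun j => (z.1 j).1), z.2))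

/-! ### Statistical distance by common parts -/

section Overlap

variable {X Y : Type*} [MeasurableSpace X] [MeasurableSpace Y]

/-- The measures `μ` and `ν` have a common part of mass at least `1 - δ`. -/
def Overlap (δ : ℝ) (μ ν : Measure X) : Prop :=
  ∃ κ, κ ≤ μ ∧ κ ≤ ν ∧ ENNReal.ofReal (1 - δ) ≤ κ Set.univ

/-- Both probabilities of `A` lie between `κ A` and `κ A + δ`, because the common part `κ` misses at
most mass `δ` of either measure. -/
lemma Overlap.abs_sub_le {δ : ℝ} {μ ν : Measure X} [IsProbabilityMeasure μ]
    [IsProbabilityMeasure ν] (h : Overlap δ μ ν) {A : Set X} (hA : MeasurableSet A) :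
    |μ.real A - ν.real A| ≤ δ := by
  obtain ⟨κ, h1, h2, h3⟩ := h
  have : IsFiniteMeasure κ := isFiniteMeasure_of_le μ h1
  have h4 : 1 - δ ≤ κ.real Set.univ :=
    (ENNReal.ofReal_le_iff_le_toReal (measure_ne_top _ _)).1 h3
  have key : ∀ ν' : Measure X, κ ≤ ν' → ∀ [IsProbabilityMeasure ν'],
      κ.real A ≤ ν'.real A ∧ ν'.real A ≤ κ.real A + δ := by
    intro ν' h _
    have h5 := probReal_add_probReal_compl (μ := ν') hA
    have h6 := measureReal_add_measureReal_compl (μ := κ) hA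
    have h7 : ∀ B, κ.real B ≤ ν'.real B := fun B =>
      ENNReal.toReal_mono (measure_ne_top _ _) (h B)
    have := h7 Aᶜ
    exact ⟨h7 A, by linarith⟩
  have hμ := key μ h1
  have hν := key ν h2
  rw [abs_le]
  constructor <;> linarith

lemma Overlap.prod_right {δ : ℝ} {μ ν : Measure X} [SFinite μ] [SFinite ν] (h : Overlap δ μ ν)
    (τ : Measure Y) [IsProbabilityMeasure τ] : Overlap δ (μ.prod τ) (ν.prod τ) := by
  obtain ⟨κ, h1, h2, h3⟩ := h
  refine ⟨κ.prod τ, Measure.prod_mono h1 le_rfl, Measure.prod_mono h2 le_rfl, ?_⟩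
  rw [← Set.univ_prod_univ, Measure.prod_prod, measure_univ (μ := τ), mul_one]
  exact h3

lemma pi_mono_measure {κ μ : Measure X} [SigmaFinite κ] [SigmaFinite μ] (h : κ ≤ μ) (n : ℕ) :
    Measure.pi (fun _ : Fin n => κ) ≤ Measure.pi fun _ : Fin n => μ := by
  induction n with
  | zero =>
    rw [Measure.pi_of_empty, Measure.pi_of_empty]
  | succ n ih =>
    have hκ := (measurePreserving_piFinSuccAbove (fun _ : Fin (n + 1) => κ) 0).symm
    have hμ := (measurePreserving_piFinSuccAbove (fun _ : Fin (n + 1) => μ) 0).symm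
    rw [← hκ.map_eq, ← hμ.map_eq]
    exact Measure.map_mono (Measure.prod_mono h ih) (MeasurableEquiv.measurable _)

/-- The power of the common part is a common part of the powers, and its mass is estimated by
Bernoulli's inequality. -/
lemma Overlap.pi {δ : ℝ} {μ ν : Measure X} [IsFiniteMeasure μ] [IsFiniteMeasure ν]
    (h : Overlap δ μ ν) (m : ℕ) :
    Overlap (m * δ) (Measure.pi fun _ : Fin m => μ) (Measure.pi fun _ : Fin m => ν) := by
  obtain ⟨κ, h1, h2, h3⟩ := h
  have : IsFiniteMeasure κ := isFiniteMeasure_of_le μ h1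
  refine ⟨Measure.pi fun _ => κ, pi_mono_measure h1 m, pi_mono_measure h2 m, ?_⟩
  rw [Measure.pi_univ, Finset.prod_const, Finset.card_univ, Fintype.card_fin]
  rcases le_or_gt δ 1 with hδ | hδ
  · calc ENNReal.ofReal (1 - m * δ) ≤ ENNReal.ofReal ((1 - δ) ^ m) := by
          apply ENNReal.ofReal_le_ofReal
          have := one_add_mul_le_pow (a := -δ) (by linarith) m
          rw [sub_eq_add_neg 1 δ]
          linarith
      _ = ENNReal.ofReal (1 - δ) ^ m := ENNReal.ofReal_pow (by linarith) m
      _ ≤ _ := by gcongr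
  -- For `δ > 1` the required mass `1 - m * δ` is negative, unless `m = 0`.
  · rcases m with _ | m
    · simp
    · rw [ENNReal.ofReal_of_nonpos]
      · exact bot_le
      · push_cast
        nlinarith [(Nat.cast_nonneg m : (0 : ℝ) ≤ m)]

lemma Overlap.mixture {Z : Type*} {δ : ℝ} (S : PMF Z) {μ ν : Z → Measure X}
    (h : ∀ s ∈ S.support, Overlap δ (μ s) (ν s)) : Overlap δ (mixture S μ) (mixture S ν) := by
  choose! κ h1 h2 h3 using h
  have key : ∀ μ' : Z → Measure X, (∀ s ∈ S.support, κ s ≤ μ' s) →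
      CLWE.mixture S κ ≤ CLWE.mixture S μ' := by
    intro μ' h
    rw [Measure.le_iff]
    intro A hA
    rw [CLWE.mixture, CLWE.mixture, Measure.sum_apply _ hA, Measure.sum_apply _ hA]
    refine ENNReal.tsum_le_tsum fun s => ?_
    simp only [Measure.smul_apply, smul_eq_mul]
    by_cases hs : s ∈ S.support
    · gcongr
      exact h s hs
    · rw [PMF.mem_support_iff, not_not] at hs
      simp [hs]
  refine ⟨CLWE.mixture S κ, key μ h1, key ν h2, ?_⟩
  rw [CLWE.mixture, Measure.sum_apply _ MeasurableSet.univ]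
  simp only [Measure.smul_apply, smul_eq_mul]
  calc ENNReal.ofReal (1 - δ) = ∑' s, S s * ENNReal.ofReal (1 - δ) := by
        rw [ENNReal.tsum_mul_right, S.tsum_coe, one_mul]
    _ ≤ _ := by
      refine ENNReal.tsum_le_tsum fun s => ?_
      by_cases hs : s ∈ S.support
      · gcongr
        exact h3 s hs
      · rw [PMF.mem_support_iff, not_not] at hs
        simp [hs]

lemma isProbabilityMeasure_mixture {Z : Type*} (S : PMF Z) (μ : Z → Measure X)
    [∀ s, IsProbabilityMeasure (μ s)] : IsProbabilityMeasure (mixture S μ) := by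
  refine ⟨?_⟩
  rw [mixture, Measure.sum_apply _ MeasurableSet.univ]
  simp [S.tsum_coe]

lemma mixture_prod {Z : Type*} (S : PMF Z) (μ : Z → Measure X) (τ : Measure Y) [SFinite τ] :
    (mixture S μ).prod τ = mixture S fun s => (μ s).prod τ := by
  simp only [mixture, Measure.prod_sum_left, Measure.prod_smul_left]

lemma mixture_map {Z : Type*} (S : PMF Z) (μ : Z → Measure X) {f : X → Y} (hf : Measurable f) :
    (mixture S μ).map f = mixture S fun s => (μ s).map f := by
  simp only [mixture, Measure.map_sum hf.aemeasurable, Measure.map_smul]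

lemma mixture_map_secret {Z Z' : Type*} (S : PMF Z) (g : Z → Z') (μ : Z' → Measure X) :
    mixture (S.map g) μ = mixture S fun s => μ (g s) := by
  classical
  ext A hA
  rw [mixture, mixture, Measure.sum_apply _ hA, Measure.sum_apply _ hA]
  simp only [Measure.smul_apply, smul_eq_mul, PMF.map_apply]
  simp_rw [← ENNReal.tsum_mul_right]
  rw [ENNReal.tsum_comm]
  refine tsum_congr fun s => ?_
  rw [tsum_eq_single (g s)]
  · simp
  · intro t ht
    simp [ht]

end Overlap

/-! ### Tails of Gaussian distributions -/

/-- If two independent copies both exceed `t` in absolute value, their squared radius exceeds `2t²`,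
which has probability exactly `exp(-2πt²)`. Independence makes this a bound for the square of the
tail. -/
lemma contGaussian_tail_le {t : ℝ} (ht : 0 ≤ t) :
    contGaussian 1 {g | t < |g|} ≤ ENNReal.ofReal (Real.exp (-Real.pi * t ^ 2)) := by
  have h1 : contGaussian 1 {g | t < |g|} * contGaussian 1 {g | t < |g|} ≤
      ENNReal.ofReal (Real.exp (-Real.pi * t ^ 2)) * ENNReal.ofReal (Real.exp (-Real.pi * t ^ 2)) := by
    rw [← Measure.prod_prod, ← ENNReal.ofReal_mul (Real.exp_pos _).le, ← Real.exp_add,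
      ← mul_add, ← contGaussian_prod_radius (by positivity)]
    refine measure_mono fun g hg => ?_
    obtain ⟨h1, h2⟩ := hg
    rw [Set.mem_ofPred_eq] at h1 h2 ⊢
    have h3 := sq_abs g.1
    have h4 := sq_abs g.2
    nlinarith
  by_contra! h
  exact absurd h1 (not_le.2 (ENNReal.mul_lt_mul h h))

lemma contGaussian_one_tail_le (K : ℕ) :
    contGaussian 1 {g | (K : ℝ) < |g|} ≤ ENNReal.ofReal (Real.exp (-K)) := by
  refine (contGaussian_tail_le (Nat.cast_nonneg K)).trans (ENNReal.ofReal_le_ofReal ?_)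
  apply Real.exp_le_exp.2
  have h1 : (K : ℝ) ≤ K ^ 2 := by
    exact_mod_cast Nat.le_self_pow two_ne_zero K
  nlinarith [Real.pi_gt_three]

lemma le_truncGaussian_univ {K b : ℕ} {w : ℝ} (hw : 0 < w) (hb : K * w + 1 ≤ 2 ^ b) :
    ENNReal.ofReal (1 - Real.exp (-K)) ≤ truncGaussian w b Set.univ := by
  have h1 : contGaussian w = (contGaussian 1).map (w * ·) := by
    rw [contGaussian_map_mul, mul_one]
  rw [truncGaussian, Measure.restrict_apply_univ, h1, Measure.map_apply (by fun_prop)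
    measurableSet_Ico, ENNReal.ofReal_sub _ (Real.exp_pos _).le, ENNReal.ofReal_one]
  have hm : MeasurableSet {g : ℝ | (K : ℝ) < |g|} := measurableSet_lt (by fun_prop) (by fun_prop)
  calc _ ≤ 1 - contGaussian 1 {g | (K : ℝ) < |g|} := by
        gcongr
        exact contGaussian_one_tail_le K
    _ = contGaussian 1 {g | (K : ℝ) < |g|}ᶜ := (prob_compl_eq_one_sub hm).symm
    _ ≤ _ := by
      refine measure_mono fun g hg => ?_
      rw [Set.mem_compl_iff, Set.mem_ofPred_eq, not_lt, abs_le] at hg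
      rw [Set.mem_preimage, Set.mem_Ico]
      constructor <;> nlinarith [hg.1, hg.2]

/-! ### The law of one sample -/

lemma le_of_forall_lintegral_le {X : Type*} [MeasurableSpace X] {c : ENNReal} {κ μ : Measure X}
    (h : ∀ F : X → ENNReal, Measurable F → c * ∫⁻ x, F x ∂κ ≤ ∫⁻ x, F x ∂μ) : c • κ ≤ μ := by
  rw [Measure.le_iff]
  intro A hA
  have := h (A.indicator 1) (measurable_one.indicator hA)
  rwa [lintegral_indicator_one hA, lintegral_indicator_one hA] at this

/-- The reduction of one sample, without truncation. -/
def idealSample (par : Params) (z : ((Fin par.n → ℝ) × ℝ) × Tape) : (Fin par.n → ℝ) × ℝ :=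
  (fun j => cell par.q par.ρ par.w par.bitsN par.trials (z.1.1 j) (shift (j * par.chunk) z.2) /
    par.w, Int.fract (z.1.2 / par.q + par.α * (shift (par.n * par.chunk) z.2 0).2))

lemma measurable_cell_comp {X : Type*} [MeasurableSpace X] (q : ℕ) (ρ w : ℝ) (b M : ℕ)
    {f : X → ℝ} {g : X → Tape} (hf : Measurable f) (hg : Measurable g) :
    Measurable fun x => cell q ρ w b M (f x) (g x) :=
  (measurable_cell q ρ w b M).comp (hf.prodMk hg)

@[fun_prop]
lemma measurable_idealSample (par : Params) : Measurable (idealSample par) := by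
  unfold idealSample
  refine Measurable.prodMk (measurable_pi_lambda _ fun j => ?_) (by fun_prop)
  exact (measurable_cell_comp _ _ _ _ _ (by fun_prop) (by fun_prop)).div_const _

lemma addBits_congr (k : ℕ) {ω ω' : Tape} (h : ∀ i < k, ω i = ω' i) (x : ℝ) :
    addBits k ω x = addBits k ω' x := by
  induction k generalizing ω ω' x with
  | zero => rfl
  | succ k ih =>
    simp only [addBits, h 0 (Nat.succ_pos k)]
    exact ih (fun i hi => h _ (by omega)) _

lemma trial_congr {b : ℕ} (w c : ℝ) {ω ω' : Tape} (h : ∀ i < b + 3, ω i = ω' i) (y : ℝ) :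
    trial b w c ω y = trial b w c ω' y := by
  simp only [trial]
  rw [addBits_congr (b + 1) (fun i hi => h i (by omega)), h (b + 1) (by omega),
    h (b + 2) (by omega)]

lemma sampler_congr {b : ℕ} (w c : ℝ) (M : ℕ) {ω ω' : Tape}
    (h : ∀ i < M * (b + 3), ω i = ω' i) (y : ℝ) :
    sampler b w c M ω y = sampler b w c M ω' y := by
  induction M generalizing ω ω' y with
  | zero => rfl
  | succ M ih =>
    simp only [sampler]
    rw [trial_congr w c (fun i hi => h i (by rw [Nat.succ_mul]; omega)) y]
    exact ih (fun i hi => h _ (by rw [Nat.succ_mul]; omega)) _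

lemma localTo_cell (q : ℕ) (ρ w : ℝ) (b M : ℕ) (a : ℝ) :
    LocalTo (1 + M * (b + 3)) (cell q ρ w b M a) := by
  intro ω ω' h
  simp only [cell]
  rw [h 0 (by omega)]
  exact sampler_congr _ _ _ (fun i hi => h _ (by omega)) _

lemma localTo_idealSample (par : Params) (x : (Fin par.n → ℝ) × ℝ) :
    LocalTo ((par.n + 1) * par.chunk) fun ω => idealSample par (x, ω) := by
  intro ω ω' h
  have hc : 0 < par.chunk := by unfold Params.chunk; omega
  have key : ∀ j ≤ par.n, ∀ i < par.chunk, shift (j * par.chunk) ω i =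
      shift (j * par.chunk) ω' i := by
    intro j hj i hi
    have h1 : (j + 1) * par.chunk ≤ (par.n + 1) * par.chunk := by gcongr
    rw [Nat.succ_mul] at h1
    exact h _ (by omega)
  simp only [idealSample]
  rw [key par.n le_rfl 0 hc]
  congr 1
  funext j
  rw [localTo_cell _ _ _ _ _ _ _ _ (key j j.2.le)]

/-- The laws of `(𝐚, b)` and of the tape determine the law of the reduced sample. -/
lemma lintegral_idealSample (par : Params) (hq : 0 < par.q) (E : Measure ℝ) [SFinite E]
    (s : Fin par.n → ℤ) {φ : (Fin par.n → ℝ) × ℝ → ℝ} (hφm : Measurable φ)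
    (hφ : ∀ a e, ∃ k : ℤ, φ (a, e) / par.q = ∑ j, a j / par.q * s j + e / par.q + k)
    {F : (Fin par.n → ℝ) × ℝ → ENNReal} (hF : Measurable F) :
    ∫⁻ y, F y ∂((((Measure.pi fun _ : Fin par.n => unifZq par.q).prod E).map
        fun ae => (ae.1, φ ae)).prod tapeMeasure).map (idealSample par) =
      ∫⁻ e, ∫⁻ z, noisy par.α (∑ j, (z j).2 * s j + e / par.q)
        (fun b => F (fun j => (z j).1 / par.w, b))
        ∂(Measure.pi fun _ : Fin par.n => coordLaw par.q par.ρ par.w par.bitsN par.trials) ∂E := by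
  have := isProbabilityMeasure_unifZq hq
  have hm : Measurable fun z : ((Fin par.n → ℝ) × ℝ) × Tape =>
      F (idealSample par ((z.1.1, φ z.1), z.2)) := by fun_prop
  rw [lintegral_map hF (by fun_prop), lintegral_prod _ (by fun_prop),
    lintegral_map (f := fun x => ∫⁻ ω, F (idealSample par (x, ω)) ∂tapeMeasure)
      (Measurable.lintegral_prod_right' (f := fun z => F (idealSample par z)) (by fun_prop))
      (by fun_prop),
    lintegral_prod_symm _ (Measurable.lintegral_prod_right' hm).aemeasurable]
  refine lintegral_congr fun e => ?_
  set G : ℝ × Tape → ℝ × ℝ :=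
    fun z => (cell par.q par.ρ par.w par.bitsN par.trials z.1 z.2, z.1 / par.q) with hG
  have hGm : Measurable G := by
    rw [hG]
    exact (measurable_cell _ _ _ _ _).prodMk (by fun_prop)
  have hGl : ∀ x, LocalTo par.chunk fun ω => G (x, ω) := by
    intro x ω ω' h
    simp only [hG]
    rw [localTo_cell _ _ _ _ _ _ _ _ h]
  set Ψ : (Fin par.n → ℝ × ℝ) × Tape → ENNReal := fun z =>
    F (fun j => (z.1 j).1 / par.w,
      Int.fract (par.α * (z.2 0).2 + (∑ j, (z.1 j).2 * s j + e / par.q))) with hΨ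
  have hΨm : Measurable Ψ := by
    refine hF.comp (Measurable.prodMk ?_ ?_)
    · fun_prop
    · fun_prop
  -- The chunks used by the `n` entries become independent tapes. The rest of the tape, whose first
  -- Gaussian is the noise added to `b/q`, stays independent of them.
  have hc := map_chunks (c := par.n) (R := par.chunk) (by unfold Params.chunk; omega) hGm hGl
    (Measure.pi fun _ => unifZq par.q)
  rw [map_arrow_pi hGm] at hc
  calc _ = ∫⁻ z, Ψ ((fun j : Fin par.n => G (z.1 j, shift (j * par.chunk) z.2)),
          shift (par.n * par.chunk) z.2)
          ∂(Measure.pi fun _ : Fin par.n => unifZq par.q).prod tapeMeasure := by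
        rw [lintegral_prod]
        · refine lintegral_congr fun a => lintegral_congr fun ω => ?_
          simp only [hΨ, hG, idealSample]
          -- Reduction modulo `q` changes `b/q` by an integer, which the fractional part forgets.
          obtain ⟨k, hk⟩ := hφ a e
          rw [hk, add_right_comm, Int.fract_add_intCast, add_comm (par.α * _)]
        · refine Measurable.aemeasurable (hΨm.comp (Measurable.prodMk ?_ (by fun_prop)))
          exact measurable_pi_lambda _ fun j => hGm.comp (by fun_prop)
    _ = ∫⁻ z, Ψ z ∂(Measure.pi fun _ : Fin par.n =>
          coordLaw par.q par.ρ par.w par.bitsN par.trials).prod tapeMeasure := by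
        have e1 : (Measure.pi fun _ : Fin par.n =>
          coordLaw par.q par.ρ par.w par.bitsN par.trials) =
            Measure.pi fun _ : Fin par.n => ((unifZq par.q).prod tapeMeasure).map G := rfl
        rw [e1, ← hc, lintegral_map hΨm]
        refine Measurable.prodMk ?_ (by fun_prop)
        exact measurable_pi_lambda _ fun j => hGm.comp (by fun_prop)
    _ = _ := by
        rw [lintegral_prod _ hΨm.aemeasurable]
        refine lintegral_congr fun z => ?_
        have hFz : Measurable fun b => F (fun j => (z j).1 / par.w, b) := hF.comp (by fun_prop)
        have h1 := lintegral_tape_gauss (φ := fun x => F (fun j => (z j).1 / par.w,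
          Int.fract (par.α * x.1 + (∑ j, (z j).2 * s j + e / par.q))))
          (hF.comp (by fun_prop))
        simp only [hΨ]
        simp only [lintegral_const, measure_univ, mul_one] at h1
        rw [h1, noisy]
        nth_rw 2 [← mul_one par.α]
        rw [← contGaussian_map_mul, lintegral_map (by fun_prop) (by fun_prop)]

/-! ### Closeness of the reduced samples -/

/-- The conditions on the parameters under which the reduction is correct. -/
structure Params.Admissible (par : Params) : Prop where
  n_pos : 0 < par.n
  m_pos : 0 < par.m
  q_pos : 0 < par.q
  one_le_r : 1 ≤ par.r
  one_le_w : 1 ≤ par.w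
  le_σ : 3 * par.r * par.w ≤ par.σ

/-- An upper bound for the relative errors of the sums of Gaussians over lattices. -/
def Params.E (par : Params) : ℝ := Real.exp (-Real.pi * par.w ^ 2)

/-- The statistical distance between a reduced sample and the sample it simulates. -/
def Params.sampleError (par : Params) : ℝ :=
  par.n * (2 * Real.exp (-par.K) + 8 * par.E) + 8 * par.E

lemma Params.one_le_K (par : Params) : 1 ≤ par.K := by
  unfold Params.K; omega

namespace Params.Admissible

variable {par : Params} (h : par.Admissible)

include h

lemma E_le : 8 * par.E ≤ 1 := by
  have h1 := h.one_le_w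
  have h2 : Real.exp (-Real.pi * par.w ^ 2) ≤ Real.exp (-3) := by
    apply Real.exp_le_exp.2
    nlinarith [Real.pi_gt_three]
  have h3 : Real.exp (-3) ≤ 1 / 8 := by
    rw [Real.exp_neg, inv_eq_one_div]
    have h4 : (2 : ℝ) ≤ Real.exp 1 := by linarith [Real.add_one_le_exp (1 : ℝ)]
    have h5 : (8 : ℝ) ≤ Real.exp 3 := by
      have : Real.exp 3 = Real.exp 1 ^ 3 := by rw [← Real.exp_nat_mul]; norm_num
      rw [this]
      calc (8 : ℝ) = 2 ^ 3 := by norm_num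
        _ ≤ _ := by gcongr
    gcongr
  rw [Params.E]
  linarith

end Params.Admissible

lemma exp_neg_natCast_le_half {K : ℕ} (hK : 1 ≤ K) : Real.exp (-K) ≤ 1 / 2 := by
  rw [Real.exp_neg, inv_eq_one_div]
  have h1 : (1 : ℝ) ≤ K := by exact_mod_cast hK
  have := Real.add_one_le_exp (K : ℝ)
  gcongr
  linarith

/-- Collecting the factors that are lost in one sample. -/
lemma one_sub_le_factors {x y : ℝ} (hx : 0 ≤ x) (hx1 : x ≤ 1 / 2) (hy : 0 ≤ y) (hy1 : 8 * y ≤ 1)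
    (n : ℕ) : 1 - (n * (2 * x + 8 * y) + 8 * y) ≤
      ((1 - x) / (1 + 4 * y) * (1 - 4 * y)) ^ n * ((1 - 4 * y) / (1 + 4 * y)) * (1 - x) ^ n := by
  have h1 : 1 - 8 * y ≤ (1 - 4 * y) / (1 + 4 * y) := by
    rw [le_div_iff₀ (by linarith)]
    nlinarith
  have h2 : 1 - (2 * x + 8 * y) ≤ (1 - x) / (1 + 4 * y) * (1 - 4 * y) * (1 - x) := by
    calc 1 - (2 * x + 8 * y) ≤ (1 - 8 * y) * ((1 - x) * (1 - x)) := by nlinarith [mul_nonneg hx hy, mul_self_nonneg x]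
      _ ≤ (1 - 4 * y) / (1 + 4 * y) * ((1 - x) * (1 - x)) := by
        gcongr
        nlinarith
      _ = _ := by ring
  -- Bernoulli's inequality for the loss per coordinate; if that loss exceeds 1, the left side is
  -- nonpositive except for `n = 0`.
  have h3 : 1 - n * (2 * x + 8 * y) ≤
      ((1 - x) / (1 + 4 * y) * (1 - 4 * y) * (1 - x)) ^ n := by
    rcases le_or_gt (2 * x + 8 * y) 1 with h4 | h4
    · calc 1 - n * (2 * x + 8 * y) ≤ (1 - (2 * x + 8 * y)) ^ n := by
            have := one_add_mul_le_pow (a := -(2 * x + 8 * y)) (by linarith) n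
            rw [sub_eq_add_neg 1 (2 * x + 8 * y)]
            linarith
        _ ≤ _ := by
          gcongr
    · rcases n with _ | n
      · simp
      · have h5 : 1 - ((n + 1 : ℕ) : ℝ) * (2 * x + 8 * y) ≤ 0 := by
          push_cast
          nlinarith [(Nat.cast_nonneg n : (0 : ℝ) ≤ n)]
        refine h5.trans (pow_nonneg ?_ _)
        have : 0 ≤ (1 - x) / (1 + 4 * y) := div_nonneg (by linarith) (by linarith)
        exact mul_nonneg (mul_nonneg this (by linarith)) (by linarith)
  rw [mul_right_comm, ← mul_pow]
  have h6 : 0 ≤ ((1 - x) / (1 + 4 * y) * (1 - 4 * y) * (1 - x)) ^ n := by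
    have : 0 ≤ (1 - x) / (1 + 4 * y) := div_nonneg (by linarith) (by linarith)
    exact pow_nonneg (mul_nonneg (mul_nonneg this (by linarith)) (by linarith)) _
  set Z := ((1 - x) / (1 + 4 * y) * (1 - 4 * y) * (1 - x)) ^ n
  have h7 : 0 ≤ (n : ℝ) * (2 * x + 8 * y) * y := by positivity
  calc _ ≤ (1 - n * (2 * x + 8 * y)) * (1 - 8 * y) := by nlinarith
    _ ≤ Z * (1 - 8 * y) := by
      gcongr
    _ ≤ _ := by gcongr

/-- The truncated version of `D_1`. -/
def truncStandard (par : Params) : Measure ℝ := (truncGaussian par.w par.bitsN).map (· / par.w)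

instance (par : Params) : IsFiniteMeasure (truncStandard par) := by
  unfold truncStandard; infer_instance

lemma truncStandard_le (par : Params) (hw : 0 < par.w) : truncStandard par ≤ contGaussian 1 := by
  have h1 : contGaussian 1 = (contGaussian par.w).map (· / par.w) := by
    have := contGaussian_map_mul par.w par.w⁻¹
    rw [inv_mul_cancel₀ hw.ne'] at this
    rw [← this]
    congr 1
    ext x
    rw [div_eq_inv_mul]
  rw [truncStandard, h1]
  exact Measure.map_mono Measure.restrict_le_self (by fun_prop)

lemma le_two_pow_bitsN (par : Params) : par.K * par.w + 1 ≤ 2 ^ par.bitsN := by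
  have h1 := Nat.le_pow_clog one_lt_two ⌈par.K * par.w + 1⌉₊
  have h2 := Nat.le_ceil (par.K * par.w + 1)
  refine h2.trans ?_
  unfold Params.bitsN
  exact_mod_cast h1

/-- An oversized window would make acceptance rare. Minimality of the exponent gives `2 ^ (bitsN -
1) < ⌈Kw + 1⌉ < Kw + 2`, whence `2 ^ bitsN ≤ 2(Kw + 1) ≤ 4Kw`. -/
lemma two_pow_bitsN_le (par : Params) (hw : 1 ≤ par.w) :
    (2 : ℝ) ^ par.bitsN ≤ 4 * par.K * par.w := by
  have hK : (1 : ℝ) ≤ par.K := by exact_mod_cast par.one_le_K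
  have hKw : 1 ≤ par.K * par.w := by nlinarith
  have h1 : 1 < ⌈par.K * par.w + 1⌉₊ := Nat.lt_ceil.2 (by push_cast; linarith)
  have h2 := Nat.pow_pred_clog_lt_self one_lt_two h1
  have h3 : 0 < par.bitsN := Nat.clog_pos one_lt_two h1
  have h4 := Nat.ceil_lt_add_one (by linarith : 0 ≤ par.K * par.w + 1)
  have h5 : 2 ^ par.bitsN = 2 * 2 ^ (par.bitsN - 1) := by
    rw [← pow_succ']; congr 1; omega
  have h6 : (2 : ℝ) ^ (par.bitsN - 1) + 1 ≤ ⌈par.K * par.w + 1⌉₊ := by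
    have h7 : 2 ^ (par.bitsN - 1) + 1 ≤ ⌈par.K * par.w + 1⌉₊ := h2
    exact_mod_cast h7
  have h8 : (2 : ℝ) ^ par.bitsN = 2 * 2 ^ (par.bitsN - 1) := by exact_mod_cast h5
  rw [h8]
  linarith

namespace Params.Admissible

variable {par : Params} (h : par.Admissible)

include h

/-- In units of `1/q` the noise on an entry has width `σ/r`; this is what the factor `r` in the
lower bound on `σ` is for. -/
lemma two_w_le : 2 * par.w ≤ par.q * par.ρ := by
  have hq : (0 : ℝ) < par.q := by exact_mod_cast h.q_pos
  have hr := h.one_le_r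
  have hw := h.one_le_w
  have hσ := h.le_σ
  rw [Params.ρ, Params.α, ← mul_div_assoc, mul_div_cancel₀ _ hq.ne', le_div_iff₀ (by linarith)]
  nlinarith

lemma σ_pos : 0 < par.σ := by
  have := h.le_σ
  have := h.one_le_r
  have := h.one_le_w
  have : 0 < 3 * par.r * par.w := by positivity
  linarith

lemma α_pos : 0 < par.α := by
  have hq : (0 : ℝ) < par.q := by exact_mod_cast h.q_pos
  exact div_pos h.σ_pos hq

lemma ρ_pos : 0 < par.ρ := div_pos h.α_pos (by linarith [h.one_le_r])

lemma three_w_le_σ : 3 * par.w ≤ par.σ := by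
  have := h.le_σ
  have := h.one_le_r
  have := h.one_le_w
  nlinarith

/-- Lower bound for the law of a reduced sample without the noise of the input. -/
lemma le_lintegral_entries (s : Fin par.n → ℤ) (hs : ∑ j, (s j : ℝ) ^ 2 ≤ par.r ^ 2) (c : ℝ)
    {F : (Fin par.n → ℝ) × ℝ → ENNReal} (hF : Measurable F) :
    ENNReal.ofReal ((1 - Real.exp (-par.K)) / (1 + 4 * par.E) * (1 - 4 * par.E)) ^ par.n *
        ∫⁻ y, noisy (√(par.α ^ 2 + par.ρ ^ 2 * ∑ j, (s j : ℝ) ^ 2))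
          (par.w * ∑ j, y j * s j + c) (fun b => F (y, b))
          ∂Measure.pi (fun _ : Fin par.n => truncStandard par) ≤
      ∫⁻ z, noisy par.α (∑ j, (z j).2 * s j + c) (fun b => F (fun j => (z j).1 / par.w, b))
        ∂(Measure.pi fun _ : Fin par.n => coordLaw par.q par.ρ par.w par.bitsN par.trials) := by
  have hw := h.one_le_w
  have hw0 : 0 < par.w := by linarith
  have hK : (1 : ℝ) ≤ par.K := by exact_mod_cast par.one_le_K
  have hb := le_two_pow_bitsN par
  have hFd : Measurable fun z : (Fin par.n → ℝ) × ℝ => F (fun j => z.1 j / par.w, z.2) :=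
    hF.comp (by fun_prop)
  -- A single coordinate of the secret is bounded by its norm `r`, and `α = r * ρ`.
  have h1 : ∀ j, (s j : ℝ) ^ 2 * par.ρ ^ 2 ≤ par.α ^ 2 := by
    intro j
    have h2 : (s j : ℝ) ^ 2 ≤ par.r ^ 2 :=
      (Finset.single_le_sum (fun j _ => sq_nonneg (s j : ℝ)) (Finset.mem_univ j)).trans hs
    have h3 : par.α ^ 2 = par.r ^ 2 * par.ρ ^ 2 := by
      rw [← mul_pow, Params.ρ, mul_div_cancel₀ _ (by linarith [h.one_le_r])]
    rw [h3]
    gcongr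
  refine le_trans (le_of_eq ?_) (le_lintegral_pi_coordLaw h.q_pos h.ρ_pos hw (by nlinarith)
    (two_pow_bitsN_le par hw) le_rfl h.two_w_le s h.α_pos h1 c
    (g := fun z b => F (fun j => z j / par.w, b)) hFd)
  congr 1
  rw [truncStandard, ← Measure.pi_map_pi (μ := fun _ : Fin par.n => truncGaussian par.w par.bitsN)
    (f := fun _ x => x / par.w) (fun _ => by fun_prop), lintegral_map _ (by fun_prop)]
  · refine lintegral_congr fun y => ?_
    congr 2
    rw [Finset.mul_sum]
    refine Finset.sum_congr rfl fun j _ => ?_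
    rw [← mul_assoc, mul_div_cancel₀ _ hw0.ne']
  · exact measurable_noisy _ (by fun_prop) hF

lemma truncStandard_univ : ENNReal.ofReal (1 - Real.exp (-par.K)) ≤
    truncStandard par Set.univ := by
  rw [truncStandard, Measure.map_apply (by fun_prop) MeasurableSet.univ, Set.preimage_univ]
  exact le_truncGaussian_univ (by linarith [h.one_le_w]) (le_two_pow_bitsN par)

end Params.Admissible

lemma norm_toLp_sq {n : ℕ} (s : Fin n → ℤ) :
    ‖WithLp.toLp 2 (fun j => (s j : ℝ))‖ ^ 2 = ∑ j, (s j : ℝ) ^ 2 := by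
  rw [EuclideanSpace.norm_sq_eq]
  simp

lemma isProbabilityMeasure_discGaussian {σ : ℝ} (hσ : 0 < σ) :
    IsProbabilityMeasure (discGaussian σ) := by
  have h0 := summable_rho 0 hσ
  simp only [add_zero] at h0
  have hs0 : 0 < ∑' j : ℤ, rho σ j := h0.tsum_pos (fun _ => (rho_pos _ _).le) 0 (rho_pos _ _)
  refine ⟨?_⟩
  rw [discGaussian, Measure.sum_apply _ MeasurableSet.univ]
  simp only [Measure.smul_apply, measure_univ, smul_eq_mul, mul_one]
  rw [← ENNReal.ofReal_tsum_of_nonneg (fun k => div_nonneg (rho_pos _ _).le hs0.le)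
    (h0.div_const _), tsum_div_const, div_self hs0.ne', ENNReal.ofReal_one]

@[fun_prop]
lemma measurable_modQ (q : ℕ) : Measurable (modQ q) := by
  unfold modQ; fun_prop

lemma modQ_div {q : ℕ} (hq : 0 < q) (x : ℝ) : modQ q x / q = Int.fract (x / q) := by
  have : (q : ℝ) ≠ 0 := by exact_mod_cast hq.ne'
  rw [modQ, mul_div_cancel_left₀ _ this]

/-- The law of one LWE sample with secret `s`. -/
def lweSample (par : Params) (s : Fin par.n → ℤ) : Measure ((Fin par.n → ℝ) × ℝ) :=
  ((Measure.pi fun _ : Fin par.n => unifZq par.q).prod (discGaussian par.σ)).map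
    fun ae => (ae.1, modQ par.q (∑ j, ae.1 j * (s j : ℝ) + ae.2))

/-- The law of one CLWE sample with secret `s / r`. -/
def clweSample (par : Params) (s : Fin par.n → ℤ) : Measure ((Fin par.n → ℝ) × ℝ) :=
  ((Measure.pi fun _ : Fin par.n => contGaussian 1).prod (contGaussian par.β)).map
    fun ae => (ae.1, Int.fract (par.γ * ∑ j, ae.1 j * ((s j : ℝ) / par.r) + ae.2))

namespace Params.Admissible

variable {par : Params} (h : par.Admissible)

include h

lemma γ_eq : par.γ = par.w * par.r := by
  have := h.one_le_r
  rw [Params.w, div_mul_cancel₀ _ (by linarith)]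

/-- The common part is an explicit multiple of a truncated target `κ`. Its mass is a product of
three losses: the smoothing and sampling of the `n` entries, the smoothing of `b` (the factor `c`),
and the truncation of the `n` Gaussians. -/
lemma overlap_of_le {κ P Q : Measure ((Fin par.n → ℝ) × ℝ)} {c : ℝ}
    (hc : (1 - 4 * par.E) / (1 + 4 * par.E) ≤ c) (hc1 : c ≤ 1)
    (hκ : κ Set.univ = truncStandard par Set.univ ^ par.n) (hQ : κ ≤ Q)
    (hP : (ENNReal.ofReal ((1 - Real.exp (-par.K)) / (1 + 4 * par.E) * (1 - 4 * par.E)) ^ par.n *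
      ENNReal.ofReal c) • κ ≤ P) : Overlap par.sampleError P Q := by
  have hE0 : 0 ≤ par.E := (Real.exp_pos _).le
  have hE1 := h.E_le
  have hx := exp_neg_natCast_le_half par.one_le_K
  have hx0 := Real.exp_pos (-(par.K : ℝ))
  have ha0 : 0 ≤ (1 - Real.exp (-par.K)) / (1 + 4 * par.E) * (1 - 4 * par.E) :=
    mul_nonneg (div_nonneg (by linarith) (by linarith)) (by linarith)
  have ha1 : (1 - Real.exp (-par.K)) / (1 + 4 * par.E) * (1 - 4 * par.E) ≤ 1 := by
    refine mul_le_one₀ ?_ (by linarith) (by linarith)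
    rw [div_le_one (by linarith)]
    linarith
  have hc0 : 0 ≤ c := le_trans (div_nonneg (by linarith) (by linarith)) hc
  refine ⟨_, hP, le_trans ?_ hQ, ?_⟩
  · calc _ ≤ (1 : ENNReal) • κ := by
          gcongr
          refine mul_le_one' (pow_le_one' ?_ _) ?_
          · exact ENNReal.ofReal_le_one.2 ha1
          · exact ENNReal.ofReal_le_one.2 hc1
      _ = κ := one_smul _ _
  · rw [Measure.smul_apply, smul_eq_mul, hκ]
    calc _ ≤ ENNReal.ofReal (((1 - Real.exp (-par.K)) / (1 + 4 * par.E) * (1 - 4 * par.E)) ^ par.n *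
          ((1 - 4 * par.E) / (1 + 4 * par.E)) * (1 - Real.exp (-par.K)) ^ par.n) :=
        ENNReal.ofReal_le_ofReal (one_sub_le_factors hx0.le hx hE0 hE1 par.n)
      _ ≤ ENNReal.ofReal (((1 - Real.exp (-par.K)) / (1 + 4 * par.E) * (1 - 4 * par.E)) ^ par.n *
          c * (1 - Real.exp (-par.K)) ^ par.n) := by
        apply ENNReal.ofReal_le_ofReal
        have : 0 ≤ (1 - Real.exp (-(par.K : ℝ))) ^ par.n := pow_nonneg (by linarith) _
        gcongr
      _ ≤ _ := by
        rw [ENNReal.ofReal_mul (by positivity), ENNReal.ofReal_mul (by positivity),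
          ENNReal.ofReal_pow ha0, ENNReal.ofReal_pow (by linarith)]
        gcongr
        exact h.truncStandard_univ

lemma pi_truncStandard_le : Measure.pi (fun _ : Fin par.n => truncStandard par) ≤
    Measure.pi fun _ : Fin par.n => contGaussian 1 :=
  pi_mono_measure (truncStandard_le par (by linarith [h.one_le_w])) _

/-- The reduction turns LWE samples into CLWE samples. -/
lemma overlap_lweSample (hβ : par.β = √3 * (par.σ / par.q)) (s : Fin par.n → ℤ)
    (hs : ‖WithLp.toLp 2 (fun j => (s j : ℝ))‖ = par.r) :
    Overlap par.sampleError (((lweSample par s).prod tapeMeasure).map (idealSample par))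
      (clweSample par s) := by
  have hs2 : ∑ j, (s j : ℝ) ^ 2 = par.r ^ 2 := by rw [← norm_toLp_sq, hs]
  have hq : (0 : ℝ) < par.q := by exact_mod_cast h.q_pos
  have hw := h.one_le_w
  have hr := h.one_le_r
  have hα := h.α_pos
  have hσ := h.σ_pos
  have hE0 : 0 ≤ par.E := (Real.exp_pos _).le
  have hE1 := h.E_le
  have := isProbabilityMeasure_discGaussian hσ
  have hρr : par.ρ ^ 2 * par.r ^ 2 = par.α ^ 2 := by
    rw [← mul_pow, Params.ρ, div_mul_cancel₀ _ (by linarith)]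
  set η := √(par.α ^ 2 + par.ρ ^ 2 * ∑ j, (s j : ℝ) ^ 2) with hη
  -- The entries contribute `ρ²‖s‖² = α²`, by the exact norm of the secret, and the fresh noise
  -- another `α²`. With the LWE error `(σ/q)² = α²` the total is `3α²`, which explains `√3`.
  have hη2 : η ^ 2 = 2 * par.α ^ 2 := by
    rw [hη, Real.sq_sqrt (by positivity), hs2, hρr]; ring
  have hη0 : 0 < η := Real.sqrt_pos.2 (by positivity)
  have hβ' : √(η ^ 2 + (par.σ / par.q) ^ 2) = par.β := by
    rw [hη2, hβ, ← Params.α, show 2 * par.α ^ 2 + par.α ^ 2 = 3 * par.α ^ 2 by ring,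
      Real.sqrt_mul (by norm_num), Real.sqrt_sq hα.le]
  have hβ0 : 0 < par.β := by rw [← hβ']; positivity
  have hcond : par.w ≤ par.q * (par.σ / par.q * η / √(η ^ 2 + (par.σ / par.q) ^ 2)) := by
    have h1 : √(η ^ 2 + (par.σ / par.q) ^ 2) ≤ 2 * η := by
      apply Real.sqrt_le_iff.2 ⟨by positivity, ?_⟩
      rw [← Params.α, mul_pow, hη2]
      nlinarith
    calc par.w ≤ par.q * (par.σ / par.q * η / (2 * η)) := by
          rw [mul_div_mul_right _ _ hη0.ne', ← mul_div_assoc, mul_div_cancel₀ _ hq.ne']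
          linarith [h.three_w_le_σ]
      _ ≤ _ := by
        have : 0 < √(η ^ 2 + (par.σ / par.q) ^ 2) := by rw [hβ']; exact hβ0
        gcongr
  have hmap : Measurable fun ae : (Fin par.n → ℝ) × ℝ =>
      (ae.1, Int.fract (par.γ * ∑ j, ae.1 j * ((s j : ℝ) / par.r) + ae.2)) := by fun_prop
  refine h.overlap_of_le (κ := ((Measure.pi fun _ : Fin par.n => truncStandard par).prod
    (contGaussian par.β)).map fun ae =>
      (ae.1, Int.fract (par.γ * ∑ j, ae.1 j * ((s j : ℝ) / par.r) + ae.2))) le_rfl ?_ ?_ ?_ ?_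
  · rw [div_le_one (by linarith)]
    linarith
  · rw [Measure.map_apply hmap MeasurableSet.univ, Set.preimage_univ, ← Set.univ_prod_univ,
      Measure.prod_prod, measure_univ (μ := contGaussian par.β), mul_one, Measure.pi_univ, Finset.prod_const,
      Finset.card_univ, Fintype.card_fin]
  · exact Measure.map_mono (Measure.prod_mono h.pi_truncStandard_le le_rfl) hmap
  · refine le_of_forall_lintegral_le fun F hF => ?_
    have hφ : ∀ (a : Fin par.n → ℝ) (e : ℝ), ∃ k : ℤ,
        modQ par.q (∑ j, a j * (s j : ℝ) + e) / par.q = ∑ j : Fin par.n, a j / par.q * s j + e / par.q + k := by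
      intro a e
      refine ⟨-⌊(∑ j : Fin par.n, a j * (s j : ℝ) + e) / par.q⌋, ?_⟩
      rw [modQ_div h.q_pos, ← Int.self_sub_floor]
      push_cast
      rw [add_div, Finset.sum_div, sub_eq_add_neg]
      simp_rw [div_mul_eq_mul_div]
    rw [lweSample, lintegral_idealSample par h.q_pos _ s
      (φ := fun ae => modQ par.q (∑ j, ae.1 j * (s j : ℝ) + ae.2)) (by fun_prop) hφ hF]
    set θ := ENNReal.ofReal ((1 - Real.exp (-par.K)) / (1 + 4 * par.E) * (1 - 4 * par.E)) ^ par.n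
    have hm : Measurable fun z : ℝ × (Fin par.n → ℝ) =>
        noisy η (par.w * ∑ j, z.2 j * s j + z.1 / par.q) (fun b => F (z.2, b)) :=
      measurable_noisy _ (by fun_prop) (hF.comp (by fun_prop))
    -- Starting from the target, the noise of width `β` is first resolved into the discrete error
    -- and noise of width `η`. The error `e` is then fixed by exchanging the integrals and serves as
    -- the offset `e / q` when the entries are exchanged.
    calc _ = θ * ∫⁻ y, ENNReal.ofReal ((1 - 4 * par.E) / (1 + 4 * par.E)) *
            noisy par.β (par.w * ∑ j, y j * s j) (fun b => F (y, b))
            ∂Measure.pi fun _ : Fin par.n => truncStandard par := by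
          rw [lintegral_map hF hmap, lintegral_prod _ (by fun_prop), lintegral_const_mul, mul_assoc]
          · congr 3
            funext y
            refine lintegral_congr fun b => ?_
            rw [add_comm b]
            congr 4
            rw [h.γ_eq, Finset.mul_sum, Finset.mul_sum]
            refine Finset.sum_congr rfl fun j _ => ?_
            field_simp
          · exact measurable_noisy _ (by fun_prop) (hF.comp (by fun_prop))
      _ ≤ θ * ∫⁻ y, ∫⁻ e, noisy η (par.w * ∑ j, y j * s j + e / par.q) (fun b => F (y, b))
            ∂discGaussian par.σ ∂Measure.pi fun _ : Fin par.n => truncStandard par := by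
          gcongr with y
          have h1 := le_lintegral_discGaussian_noisy h.q_pos hη0 hw
            (by linarith [h.three_w_le_σ]) hcond (par.w * ∑ j, y j * s j)
            (g := fun b => F (y, b)) (hF.comp (by fun_prop))
          rw [hβ'] at h1
          simp_rw [add_comm (_ / _)] at h1
          exact h1
      _ = ∫⁻ e, θ * ∫⁻ y, noisy η (par.w * ∑ j, y j * s j + e / par.q) (fun b => F (y, b))
            ∂(Measure.pi fun _ : Fin par.n => truncStandard par) ∂discGaussian par.σ := by
          rw [lintegral_const_mul _ hm.lintegral_prod_right',
            lintegral_lintegral_swap (f := fun e (y : Fin par.n → ℝ) =>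
              noisy η (par.w * ∑ j, y j * s j + e / par.q) (fun b => F (y, b))) hm.aemeasurable]
      _ ≤ _ := lintegral_mono fun e => h.le_lintegral_entries s hs2.le _ hF

/-- The reduction turns uniform samples into uniform samples. -/
lemma overlap_nullSample :
    Overlap par.sampleError ((((Measure.pi fun _ : Fin par.n => unifZq par.q).prod
        (unifZq par.q)).prod tapeMeasure).map (idealSample par))
      ((Measure.pi fun _ : Fin par.n => contGaussian 1).prod unifTorus) := by
  have hq : (0 : ℝ) < par.q := by exact_mod_cast h.q_pos
  have hw := h.one_le_w
  have hα := h.α_pos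
  have hE0 : 0 ≤ par.E := (Real.exp_pos _).le
  have hE1 := h.E_le
  refine h.overlap_of_le (κ := (Measure.pi fun _ : Fin par.n => truncStandard par).prod
    unifTorus) (c := 1 - 4 * par.E) (div_le_self (by linarith) (by linarith)) (by linarith)
    ?_ ?_ ?_
  · rw [← Set.univ_prod_univ,
      Measure.prod_prod, measure_univ (μ := unifTorus), mul_one, Measure.pi_univ, Finset.prod_const,
      Finset.card_univ, Fintype.card_fin]
  · exact Measure.prod_mono h.pi_truncStandard_le le_rfl
  · refine le_of_forall_lintegral_le fun F hF => ?_
    -- A uniform `b` is the case of secret 0 in which `b` itself plays the role of the error.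
    have h1 := lintegral_idealSample par h.q_pos (unifZq par.q) 0 (φ := fun ae => ae.2)
      (by fun_prop) (fun a e => ⟨0, by simp⟩) hF
    rw [Measure.map_id'] at h1
    rw [h1]
    set θ := ENNReal.ofReal ((1 - Real.exp (-par.K)) / (1 + 4 * par.E) * (1 - 4 * par.E)) ^ par.n
    have hm : Measurable fun z : ℝ × (Fin par.n → ℝ) =>
        noisy par.α (z.1 / par.q) (fun b => F (z.2, b)) :=
      measurable_noisy _ (by fun_prop) (hF.comp (by fun_prop))
    calc _ = θ * ∫⁻ y, ENNReal.ofReal (1 - 4 * par.E) * ∫⁻ b, F (y, b) ∂unifTorus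
            ∂Measure.pi fun _ : Fin par.n => truncStandard par := by
          rw [lintegral_prod _ (by fun_prop), lintegral_const_mul, mul_assoc]
          exact hF.lintegral_prod_right'
      _ ≤ θ * ∫⁻ y, ∫⁻ e, noisy par.α (e / par.q) (fun b => F (y, b))
            ∂unifZq par.q ∂Measure.pi fun _ : Fin par.n => truncStandard par := by
          gcongr with y
          refine le_lintegral_unifZq_noisy h.q_pos hα hw ?_ (hF.comp (by fun_prop))
          rw [Params.α, mul_div_cancel₀ _ hq.ne']
          linarith [h.three_w_le_σ]
      _ = ∫⁻ e, θ * ∫⁻ y, noisy par.α (e / par.q) (fun b => F (y, b))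
            ∂(Measure.pi fun _ : Fin par.n => truncStandard par) ∂unifZq par.q := by
          rw [lintegral_const_mul _ hm.lintegral_prod_right',
            lintegral_lintegral_swap (f := fun e (y : Fin par.n → ℝ) =>
              noisy par.α (e / par.q) (fun b => F (y, b))) hm.aemeasurable]
      _ ≤ _ := lintegral_mono fun e => by
          have h2 := h.le_lintegral_entries 0 (by simp; positivity) (e / par.q) hF
          simpa [Real.sqrt_sq hα.le] using h2

end Params.Admissible

/-! ### The advantage of the reduction -/

/-- The reduction of all samples, without truncation. -/
def idealReduce (par : Params) (x : Samples par.n par.m) (ω : Tape) : Samples par.n par.m :=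
  fun i => idealSample par (x i, shift (i * ((par.n + 1) * par.chunk)) ω)

lemma Params.chunk_pos (par : Params) : 0 < par.chunk := by
  unfold Params.chunk; omega

/-- The number of cells of the tape that the reduction consumes. -/
def Params.used (par : Params) : ℕ := par.m * ((par.n + 1) * par.chunk)

@[fun_prop]
lemma measurable_idealReduce (par : Params) :
    Measurable fun z : Samples par.n par.m × Tape => (idealReduce par z.1 z.2, shift par.used z.2) := by
  unfold idealReduce
  refine Measurable.prodMk (measurable_pi_lambda _ fun i => ?_) (by fun_prop)
  exact (measurable_idealSample par).comp (by fun_prop)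

lemma map_idealReduce (par : Params) (P : Measure ((Fin par.n → ℝ) × ℝ)) [IsProbabilityMeasure P] :
    ((Measure.pi fun _ : Fin par.m => P).prod tapeMeasure).map
      (fun z => (idealReduce par z.1 z.2, shift par.used z.2)) =
    (Measure.pi fun _ : Fin par.m => (P.prod tapeMeasure).map (idealSample par)).prod
      tapeMeasure := by
  rw [← map_arrow_pi (measurable_idealSample par)]
  exact map_chunks (Nat.mul_pos (Nat.succ_pos _) par.chunk_pos) (measurable_idealSample par)
    (localTo_idealSample par) _

/-- The samples that are valid after scaling by `1 / q`. -/
def scaledSample (par : Params) : Set ((Fin par.n → ℝ) × ℝ) :=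
  {y | (∀ j, y.1 j / (par.q : ℝ) ∈ Set.Ico (0 : ℝ) 1) ∧ y.2 / (par.q : ℝ) ∈ Set.Ico (0 : ℝ) 1}

lemma measurableSet_scaledSample (par : Params) : MeasurableSet (scaledSample par) := by
  have : scaledSample par = (⋂ j, (fun y => y.1 j / (par.q : ℝ)) ⁻¹' Set.Ico (0 : ℝ) 1) ∩
      (fun y => y.2 / (par.q : ℝ)) ⁻¹' Set.Ico (0 : ℝ) 1 := by
    ext
    simp [scaledSample]
  rw [this]
  exact (MeasurableSet.iInter fun j => measurableSet_Ico.preimage (by fun_prop)).inter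
    (measurableSet_Ico.preimage (by fun_prop))

/-- The inputs that are valid after scaling by `1 / q`. -/
def scaledInputs (par : Params) : Set (Samples par.n par.m) :=
  {x | ∀ i, x i ∈ scaledSample par}

lemma truncFract_of_abs_le {B x : ℝ} (h : |x| < B) : truncFract B x = Int.fract x := by
  rw [abs_lt] at h
  rw [truncFract, if_pos ⟨h.1.le, h.2⟩]

lemma le_two_pow_bitsB (par : Params) : par.K * par.α + 2 ≤ 2 ^ par.bitsB := by
  have h1 := Nat.le_pow_clog one_lt_two ⌈par.K * par.α + 1 + 1⌉₊
  have h2 := Nat.le_ceil (par.K * par.α + 1 + 1)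
  calc par.K * par.α + 2 = par.K * par.α + 1 + 1 := by ring
    _ ≤ _ := h2
    _ ≤ _ := by
      unfold Params.bitsB
      exact_mod_cast h1

/-- If the noises are at most `K` in absolute value, then every argument of `truncFract` is less
than `1 + Kα < 2 ^ bitsB` in absolute value, using `ρ ≤ α`. The truncation therefore has no effect.
-/
lemma reduce_eq_idealReduce {par : Params} (h : par.Admissible) {x : Samples par.n par.m}
    (hx : x ∈ scaledInputs par) {ω : Tape}
    (hω : ∀ i < par.m, ∀ j < par.n + 1,
      |(ω (j * par.chunk + i * ((par.n + 1) * par.chunk))).2| ≤ par.K) :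
    reduce par x ω = idealReduce par x ω := by
  have hα := h.α_pos
  have hρ := h.ρ_pos
  have hB := le_two_pow_bitsB par
  have hρα : par.ρ ≤ par.α := div_le_self hα.le h.one_le_r
  have key : ∀ (y c g : ℝ), y ∈ Set.Ico (0 : ℝ) 1 → 0 < c → c ≤ par.α → |g| ≤ par.K →
      truncFract (2 ^ par.bitsB) (y + c * g) = Int.fract (y + c * g) := by
    intro y c g hy hc hcα hg
    apply truncFract_of_abs_le
    have h1 : |c * g| ≤ par.α * par.K := by
      rw [abs_mul, abs_of_pos hc]
      gcongr
    have h2 := abs_add_le y (c * g)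
    rw [abs_of_nonneg hy.1] at h2
    linarith [hy.2]
  funext i
  simp only [reduce, idealReduce, idealSample, aCell, bCell, cell]
  have hs : ∀ j, shift (j * par.chunk) (shift (i * ((par.n + 1) * par.chunk)) ω) 0 =
      ω (j * par.chunk + i * ((par.n + 1) * par.chunk)) := by
    intro j
    simp only [shift]
    congr 1
    omega
  congr 1
  · funext j
    rw [key _ _ _ ((hx i).1 j) hρ hρα]
    rw [hs]
    exact hω i i.2 j (by omega)
  · rw [key _ _ _ (hx i).2 hα le_rfl]
    rw [hs]
    exact hω i i.2 par.n (by omega)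

lemma tape_tail_le (K k : ℕ) :
    tapeMeasure {ω | (K : ℝ) < |(ω k).2|} ≤ ENNReal.ofReal (Real.exp (-K)) := by
  have h1 : MeasurePreserving (fun ω : Tape => (ω k).2) tapeMeasure (contGaussian 1) := by
    have h2 : MeasurePreserving (Function.eval k) tapeMeasure (unifTorus.prod (contGaussian 1)) :=
      measurePreserving_eval_infinitePi (fun _ : ℕ => unifTorus.prod (contGaussian 1)) k
    exact measurePreserving_snd.comp h2
  have h3 := h1.measure_preimage (s := {g : ℝ | (K : ℝ) < |g|})
    (measurableSet_lt (by fun_prop) (by fun_prop)).nullMeasurableSet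
  exact h3.trans_le (contGaussian_one_tail_le K)

lemma abs_measureReal_sub_le {X : Type*} [MeasurableSpace X] {μ : Measure X} [IsFiniteMeasure μ]
    {A B C : Set X} (h : ∀ x, x ∉ C → (x ∈ A ↔ x ∈ B)) : |μ.real A - μ.real B| ≤ μ.real C := by
  have key : ∀ A B : Set X, (∀ x, x ∉ C → (x ∈ A ↔ x ∈ B)) → μ.real A ≤ μ.real B + μ.real C := by
    intro A B h
    refine (measureReal_mono (s₂ := B ∪ C) fun x hx => ?_).trans (measureReal_union_le _ _)
    by_cases hC : x ∈ C
    · exact Or.inr hC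
    · exact Or.inl ((h x hC).1 hx)
  have h1 := key A B h
  have h2 := key B A fun x hx => (h x hx).symm
  rw [abs_le]
  constructor <;> linarith

/-- The error that is caused by truncation. -/
lemma abs_acceptProb_sub_ideal_le {par : Params} (h : par.Admissible) (D : Prog)
    (μ : Measure (Samples par.n par.m)) [IsProbabilityMeasure μ]
    (hμ : ∀ᵐ x ∂μ, x ∈ scaledInputs par) :
    |acceptProb (.seq reduction D) par μ - ((μ.prod tapeMeasure).map
        (fun z => (idealReduce par z.1 z.2, shift par.used z.2))).real
          {z | Accepts D par z.1 z.2}| ≤ par.m * (par.n + 1) * Real.exp (-par.K) := by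
  set bad : Set Tape := ⋃ i ∈ Finset.range par.m, ⋃ j ∈ Finset.range (par.n + 1),
    {ω | (par.K : ℝ) < |(ω (j * par.chunk + i * ((par.n + 1) * par.chunk))).2|} with hbad
  have hbadm : tapeMeasure.real bad ≤ par.m * (par.n + 1) * Real.exp (-par.K) := by
    have h1 : ∀ k, tapeMeasure.real {ω | (par.K : ℝ) < |(ω k).2|} ≤ Real.exp (-par.K) := fun k =>
      ENNReal.toReal_le_of_le_ofReal (Real.exp_pos _).le (tape_tail_le par.K k)
    refine (measureReal_biUnion_finset_le _ _).trans ?_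
    calc _ ≤ ∑ i ∈ Finset.range par.m, ∑ j ∈ Finset.range (par.n + 1), Real.exp (-par.K) := by
          refine Finset.sum_le_sum fun i _ => (measureReal_biUnion_finset_le _ _).trans ?_
          exact Finset.sum_le_sum fun j _ => h1 _
      _ = _ := by
          simp only [Finset.sum_const, Finset.card_range, nsmul_eq_mul]
          push_cast
          ring
  rw [map_measureReal_apply (measurable_idealReduce par) (measurableSet_accepts D par), acceptProb]
  refine (abs_measureReal_sub_le (C := {z | z.1 ∈ scaledInputs par ∧ z.2 ∉ bad}ᶜ) ?_).trans ?_
  · rintro ⟨x, ω⟩ hz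
    rw [Set.mem_compl_iff, not_not] at hz
    obtain ⟨hx, hω⟩ := hz
    have hω' : ∀ i < par.m, ∀ j < par.n + 1,
        |(ω (j * par.chunk + i * ((par.n + 1) * par.chunk))).2| ≤ par.K := by
      intro i hi j hj
      by_contra! hlt
      apply hω
      simp only [hbad, Set.mem_iUnion, Finset.mem_range]
      exact ⟨i, hi, j, hj, hlt⟩
    have h1 := (runs_reduction ω par x).accepts_seq (D := D)
    rw [reduce_eq_idealReduce h hx hω'] at h1
    exact h1
  · have h2 : (μ.prod tapeMeasure) {z | z.1 ∈ scaledInputs par ∧ z.2 ∉ bad}ᶜ ≤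
        (μ.prod tapeMeasure) ((scaledInputs par)ᶜ ×ˢ Set.univ) +
        (μ.prod tapeMeasure) (Set.univ ×ˢ bad) := by
      refine (measure_mono ?_).trans (measure_union_le _ _)
      rintro ⟨x, ω⟩ hz
      rw [Set.mem_compl_iff, Set.mem_ofPred_eq, not_and_or, not_not] at hz
      exact hz.imp (fun h => ⟨h, trivial⟩) fun h => ⟨trivial, h⟩
    have h3 : μ (scaledInputs par)ᶜ = 0 := hμ
    rw [Measure.prod_prod, Measure.prod_prod, h3, zero_mul, zero_add, measure_univ, one_mul] at h2
    exact (ENNReal.toReal_mono (measure_ne_top _ _) h2).trans hbadm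

lemma ae_unifZq {q : ℕ} (hq : 0 < q) : ∀ᵐ a : ℝ ∂unifZq q, a / q ∈ Set.Ico (0 : ℝ) 1 := by
  have hq' : (0 : ℝ) < q := by exact_mod_cast hq
  have hm : MeasurableSet {a : ℝ | a / q ∈ Set.Ico (0 : ℝ) 1}ᶜ :=
    ((measurable_id.div_const (q : ℝ)) measurableSet_Ico).compl
  rw [ae_iff]
  change unifZq q {a : ℝ | a / q ∈ Set.Ico (0 : ℝ) 1}ᶜ = 0
  rw [← lintegral_indicator_one hm, lintegral_unifZq]
  refine Finset.sum_eq_zero fun a ha => ?_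
  rw [Set.indicator_of_notMem, mul_zero]
  rw [Set.mem_compl_iff, not_not]
  have : (a : ℝ) < q := by exact_mod_cast Finset.mem_range.1 ha
  exact ⟨by positivity, (div_lt_one hq').2 this⟩

lemma ae_pi_forall {X : Type*} [MeasurableSpace X] {n : ℕ} {μ : Measure X}
    [IsProbabilityMeasure μ] {p : X → Prop} (h : ∀ᵐ x ∂μ, p x) :
    ∀ᵐ x ∂Measure.pi fun _ : Fin n => μ, ∀ i, p (x i) :=
  ae_all_iff.2 fun i =>
    (Measure.quasiMeasurePreserving_eval (fun _ : Fin n => μ) i).ae h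

lemma isProbabilityMeasure_lweSample {par : Params} (hq : 0 < par.q) (hσ : 0 < par.σ)
    (s : Fin par.n → ℤ) : IsProbabilityMeasure (lweSample par s) := by
  have := isProbabilityMeasure_unifZq hq
  have := isProbabilityMeasure_discGaussian hσ
  exact Measure.isProbabilityMeasure_map (by fun_prop)

instance (par : Params) (s : Fin par.n → ℤ) : IsProbabilityMeasure (clweSample par s) :=
  Measure.isProbabilityMeasure_map (by fun_prop)

lemma lwe_eq (par : Params) (S : PMF (Fin par.n → ℤ)) :
    lwe par.m par.q (Measure.pi fun _ => unifZq par.q) S (discGaussian par.σ) =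
      mixture S fun s => Measure.pi fun _ => lweSample par s := rfl

lemma clwe_eq (par : Params) (S : PMF (Fin par.n → ℤ)) :
    clwe par.m (Measure.pi fun _ => contGaussian 1) (scaleSecret par.r S) par.γ par.β =
      mixture S fun s => Measure.pi fun _ => clweSample par s :=
  mixture_map_secret S _ _

/-- The reduction changes acceptance probabilities by at most this error. -/
def Params.totalError (par : Params) : ℝ :=
  par.m * par.sampleError + par.m * (par.n + 1) * Real.exp (-par.K)

namespace Params.Admissible

variable {par : Params} (h : par.Admissible) (D : Prog)

include h

lemma abs_acceptProb_sub_le {μ ν : Measure (Samples par.n par.m)} [IsProbabilityMeasure μ]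
    [IsProbabilityMeasure ν] (hμ : ∀ᵐ x ∂μ, x ∈ scaledInputs par)
    (ho : Overlap (par.m * par.sampleError) ((μ.prod tapeMeasure).map
      fun z => (idealReduce par z.1 z.2, shift par.used z.2)) (ν.prod tapeMeasure)) :
    |acceptProb (.seq reduction D) par μ - acceptProb D par ν| ≤ par.totalError := by
  have h1 := abs_acceptProb_sub_ideal_le h D μ hμ
  have : IsProbabilityMeasure ((μ.prod tapeMeasure).map
      fun z => (idealReduce par z.1 z.2, shift par.used z.2)) :=
    Measure.isProbabilityMeasure_map (by fun_prop)
  have h2 := ho.abs_sub_le (measurableSet_accepts D par)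
  refine (abs_sub_le _ _ _).trans ((add_le_add h1 h2).trans (le_of_eq ?_))
  rw [Params.totalError, add_comm]

set_option synthInstance.maxSize 1000 in
lemma abs_acceptProb_lwe_sub_le (hβ : par.β = √3 * (par.σ / par.q)) (S : PMF (Fin par.n → ℤ))
    (hS : ∀ s ∈ S.support, ‖WithLp.toLp 2 (fun j => (s j : ℝ))‖ = par.r) :
    |acceptProb (.seq reduction D) par
        (lwe par.m par.q (Measure.pi fun _ => unifZq par.q) S (discGaussian par.σ)) -
      acceptProb D par
        (clwe par.m (Measure.pi fun _ => contGaussian 1) (scaleSecret par.r S) par.γ par.β)| ≤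
      par.totalError := by
  have hi := isProbabilityMeasure_lweSample h.q_pos h.σ_pos
  have hu := isProbabilityMeasure_unifZq h.q_pos
  have := isProbabilityMeasure_discGaussian h.σ_pos
  have hq' : (0 : ℝ) < par.q := by exact_mod_cast h.q_pos
  rw [lwe_eq, clwe_eq]
  have h1 := isProbabilityMeasure_mixture S fun s => Measure.pi fun _ : Fin par.m => lweSample par s
  have h2 := isProbabilityMeasure_mixture S fun s => Measure.pi fun _ : Fin par.m => clweSample par s
  refine h.abs_acceptProb_sub_le D ?_ ?_
  · rw [mixture, Measure.ae_sum_iff]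
    intro s
    refine Measure.ae_smul_measure ?_ _
    refine ae_pi_forall (p := fun y => y ∈ scaledSample par) ?_
    refine (ae_map_iff (by fun_prop) (measurableSet_scaledSample par)).2 ?_
    have h3 := ae_pi_forall (n := par.n) (ae_unifZq h.q_pos)
    filter_upwards [Measure.quasiMeasurePreserving_fst.ae h3] with ae hae
    refine ⟨hae, ?_⟩
    rw [modQ_div h.q_pos]
    exact ⟨Int.fract_nonneg _, Int.fract_lt_one _⟩
  · rw [mixture_prod, mixture_prod, mixture_map _ _ (by fun_prop)]
    refine Overlap.mixture S fun s hs => ?_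
    rw [map_idealReduce]
    have : IsProbabilityMeasure (((lweSample par s).prod tapeMeasure).map (idealSample par)) :=
      Measure.isProbabilityMeasure_map (by fun_prop)
    have h3 := (h.overlap_lweSample hβ s (hS s hs)).pi par.m
    exact h3.prod_right tapeMeasure

lemma abs_acceptProb_null_sub_le :
    |acceptProb (.seq reduction D) par
        (nullSamples par.m (Measure.pi fun _ => unifZq par.q) (unifZq par.q)) -
      acceptProb D par (nullSamples par.m (Measure.pi fun _ => contGaussian 1) unifTorus)| ≤
      par.totalError := by
  have hu := isProbabilityMeasure_unifZq h.q_pos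
  have hp : IsProbabilityMeasure
      (nullSamples (n := par.n) par.m (Measure.pi fun _ => unifZq par.q) (unifZq par.q)) := by
    unfold nullSamples; infer_instance
  have hp' : IsProbabilityMeasure
      (nullSamples (n := par.n) par.m (Measure.pi fun _ => contGaussian 1) unifTorus) := by
    unfold nullSamples; infer_instance
  refine h.abs_acceptProb_sub_le D ?_ ?_
  · refine ae_pi_forall (p := fun y => y ∈ scaledSample par) ?_
    have h3 := ae_pi_forall (n := par.n) (ae_unifZq h.q_pos)
    filter_upwards [Measure.quasiMeasurePreserving_fst.ae h3,
      Measure.quasiMeasurePreserving_snd.ae (ae_unifZq h.q_pos)] with y hy1 hy2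
    exact ⟨hy1, hy2⟩
  · rw [nullSamples, map_idealReduce]
    have : IsProbabilityMeasure ((((Measure.pi fun _ : Fin par.n => unifZq par.q).prod
        (unifZq par.q)).prod tapeMeasure).map (idealSample par)) :=
      Measure.isProbabilityMeasure_map (by fun_prop)
    exact (h.overlap_nullSample.pi par.m).prod_right tapeMeasure

end Params.Admissible

/-! ### Asymptotic bounds -/

lemma log_le_logLam (par : Params) : Real.log par.lam ≤ par.logLam := by
  have h0 : (0 : ℝ) ≤ par.logLam := Nat.cast_nonneg _
  rcases Nat.eq_zero_or_pos par.lam with hl | hl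
  · simp [hl]
  have h1 : (par.lam : ℝ) ≤ 2 ^ par.logLam := by
    have := Nat.le_pow_clog one_lt_two par.lam
    rw [Params.logLam, Nat.ceil_natCast]
    exact_mod_cast this
  have h2 := Real.log_le_log (by exact_mod_cast hl) h1
  rw [Real.log_pow] at h2
  have h3 := Real.log_two_lt_d9
  nlinarith

/-- The choice of `w` cancels the factor `mn` in `mn exp(-w²)`, and `K ≥ mn + (log λ)²` does so in
`mn exp(-K)`. The term `exp(-K)` occurs `2mn + m(n + 1) ≤ 4mn` times and `E` occurs `8mn + 8m ≤
16mn` times. -/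
lemma Params.Admissible.totalError_le {par : Params} (h : par.Admissible) {F : ℝ}
    (hw : par.w ^ 2 = Real.log par.m + Real.log par.n + F) :
    par.totalError ≤ 4 * Real.exp (-Real.log par.lam ^ 2) + 16 * Real.exp (-F) := by
  have hm : (1 : ℝ) ≤ par.m := by exact_mod_cast h.m_pos
  have hn : (1 : ℝ) ≤ par.n := by exact_mod_cast h.n_pos
  have hE : par.m * par.n * par.E ≤ Real.exp (-F) := by
    have h1 : par.E ≤ Real.exp (-par.w ^ 2) := by
      apply Real.exp_le_exp.2
      nlinarith [Real.pi_gt_three, sq_nonneg par.w]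
    calc par.m * par.n * par.E ≤ par.m * par.n * Real.exp (-par.w ^ 2) := by gcongr
      _ = Real.exp (-F) := by
        have e : (par.m : ℝ) * par.n = Real.exp (Real.log par.m + Real.log par.n) := by
          rw [Real.exp_add, Real.exp_log (by linarith), Real.exp_log (by linarith)]
        rw [e, ← Real.exp_add, hw]
        congr 1
        ring
  have hK : par.m * par.n * Real.exp (-par.K) ≤ Real.exp (-Real.log par.lam ^ 2) := by
    have h1 : Real.log par.lam ^ 2 ≤ par.logLam * par.logLam := by
      rw [← sq]
      have h0 : 0 ≤ Real.log par.lam := Real.log_natCast_nonneg _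
      have := log_le_logLam par
      gcongr
    have h2 : (par.m : ℝ) * par.n ≤ Real.exp (par.m * par.n) := by
      linarith [Real.add_one_le_exp ((par.m : ℝ) * par.n)]
    calc par.m * par.n * Real.exp (-par.K) ≤ Real.exp (par.m * par.n) * Real.exp (-par.K) := by
          gcongr
      _ ≤ _ := by
        rw [← Real.exp_add]
        apply Real.exp_le_exp.2
        rw [Params.K]
        push_cast
        linarith
  have hE0 : 0 ≤ par.E := (Real.exp_pos _).le
  have hx0 := (Real.exp_pos (-(par.K : ℝ))).le
  rw [Params.totalError, Params.sampleError]
  have h3 : par.m * Real.exp (-par.K) ≤ par.m * par.n * Real.exp (-par.K) := by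
    gcongr
    nlinarith
  have h4 : par.m * par.E ≤ par.m * par.n * par.E := by
    gcongr
    nlinarith
  nlinarith

/-- The loss of advantage in the reduction. -/
def loss (f : ℕ → ℝ) (l : ℕ) : ℝ :=
  if 1 ≤ f l then 8 * Real.exp (-Real.log l ^ 2) + 32 * Real.exp (-f l) else 1

lemma loss_nonneg (f : ℕ → ℝ) (l : ℕ) : 0 ≤ loss f l := by
  unfold loss
  split_ifs <;> positivity

/-- Eventually both `f(λ)` and `(log λ)²` exceed `(k + 1) log λ`, so `λᵏ` times either exponential
is at most `1/λ`; the constant is `40 = 8 + 32`. -/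
lemma negligible_loss {f : ℕ → ℝ} (hf : IsOmegaLog f) : Negligible (loss f) := by
  intro k
  have hlog : Tendsto (fun l : ℕ => Real.log l) atTop atTop :=
    Real.tendsto_log_atTop.comp tendsto_natCast_atTop_atTop
  have hlim : Tendsto (fun l : ℕ => 40 / (l : ℝ)) atTop (nhds 0) :=
    tendsto_const_div_atTop_nhds_zero_nat 40
  refine squeeze_zero' (Eventually.of_forall fun l => mul_nonneg (by positivity) (loss_nonneg f l))
    ?_ hlim
  filter_upwards [hlog.eventually_ge_atTop (k + 1), hf.eventually_ge_atTop (k + 1),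
    eventually_gt_atTop 0] with l h1 h2 h3
  have hl : (0 : ℝ) < l := by exact_mod_cast h3
  have hk : (0 : ℝ) ≤ k := Nat.cast_nonneg k
  have hL : 0 < Real.log l := by linarith
  rw [le_div_iff₀ hL] at h2
  have h4 : ∀ y : ℝ, (k + 1) * Real.log l ≤ y → (l : ℝ) ^ k * Real.exp (-y) ≤ 1 / l := by
    intro y hy
    have e1 : (l : ℝ) ^ k = Real.exp (k * Real.log l) := by
      rw [Real.exp_nat_mul, Real.exp_log hl]
    have e2 : 1 / (l : ℝ) = Real.exp (-Real.log l) := by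
      rw [Real.exp_neg, Real.exp_log hl, one_div]
    rw [e1, e2, ← Real.exp_add]
    apply Real.exp_le_exp.2
    linarith
  have h5 := h4 (f l) h2
  have h6 := h4 (Real.log l ^ 2) (by nlinarith)
  rw [loss, if_pos (by nlinarith)]
  calc _ = 8 * ((l : ℝ) ^ k * Real.exp (-Real.log l ^ 2)) +
        32 * ((l : ℝ) ^ k * Real.exp (-f l)) := by ring
    _ ≤ 8 * (1 / l) + 32 * (1 / l) := by gcongr
    _ = 40 / l := by ring

/-! ### The running time -/

lemma clog_ceil_le {x : ℝ} (hx : 1 ≤ x) : (Nat.clog 2 ⌈x⌉₊ : ℝ) ≤ 1 + 2 * Real.log x := by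
  have hl := Real.log_nonneg hx
  rcases Nat.lt_or_ge 1 ⌈x⌉₊ with h | h
  · have h1 := Nat.lt_ceil.1 (Nat.pow_pred_clog_lt_self one_lt_two h)
    have h2 := Real.log_le_log (by positivity) h1.le
    push_cast at h2
    rw [Real.log_pow] at h2
    have h3 := Real.log_two_gt_d9
    have h4 : 0 < Nat.clog 2 ⌈x⌉₊ := Nat.clog_pos one_lt_two h
    have h5 : ((Nat.clog 2 ⌈x⌉₊).pred : ℝ) = Nat.clog 2 ⌈x⌉₊ - 1 := by
      rw [Nat.pred_eq_sub_one, Nat.cast_sub h4, Nat.cast_one]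
    have h6 : (0 : ℝ) ≤ (Nat.clog 2 ⌈x⌉₊).pred := Nat.cast_nonneg _
    nlinarith
  · rw [Nat.clog_of_right_le_one h, Nat.cast_zero]
    linarith

/-- For `σ < 1` the logarithm of `σ` is negative; its square makes the time bound meaningful for all
`σ > 0`. -/
lemma log_one_add_le {x : ℝ} (hx : 0 < x) : Real.log (1 + x) ≤ 2 * (1 + Real.log x ^ 2) := by
  rcases le_total x 1 with h | h
  · have h1 := Real.log_le_sub_one_of_pos (by linarith : 0 < 1 + x)
    nlinarith [sq_nonneg (Real.log x)]
  · have h1 : Real.log (1 + x) ≤ Real.log (2 * x) := Real.log_le_log (by linarith) (by linarith)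
    rw [Real.log_mul (by norm_num) hx.ne'] at h1
    nlinarith [Real.log_two_lt_d9, sq_nonneg (Real.log x - 1)]

/-- A quantity whose fourth power controls the running time of the reduction. -/
def Params.scale (par : Params) : ℝ :=
  (1 + par.n) * (1 + par.m) * (1 + Real.log par.lam ^ 2) * (1 + Real.log par.σ ^ 2)

/-- The polynomial that bounds the running time of the reduction. -/
def timePoly : MvPolynomial (Fin 5) ℕ :=
  MvPolynomial.C 6400000 * ((1 + MvPolynomial.X 0) * (1 + MvPolynomial.X 1) *
    (1 + MvPolynomial.X 4 ^ 2) * (1 + MvPolynomial.X 3 ^ 2)) ^ 4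

lemma polyTime_timePoly (par : Params) : polyTime timePoly par = 6400000 * par.scale ^ 4 := by
  simp [polyTime, timePoly, Params.scale]

/-- Here `32400 = 400 · 9²` comes from `K ≤ 9Z`, and `196 = 7 · 23 + 35`. Then `32400 · 196 + 5 · 25
+ 51 = 6350576`, and the remaining terms fit below `6400000`. -/
lemma time_arith {Z c t N B l : ℝ} (hZ : 1 ≤ Z) (hc : c ≤ Z) (hc0 : 0 ≤ c)
    (ht : t ≤ 32400 * Z ^ 2) (ht0 : 0 ≤ t) (hN : N ≤ 23 * Z) (hN0 : 0 ≤ N) (hB : B ≤ 25 * Z)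
    (hl : l ≤ 2 * Z) :
    c * (t * (7 * N + 35) + 5 * B + 51) + 4 * (l + N + B) + 200 + 1 ≤ 6400000 * Z ^ 4 := by
  have h1 : t * (7 * N + 35) ≤ 32400 * Z ^ 2 * (196 * Z) := by
    gcongr
    linarith
  have h2 : Z ≤ Z ^ 3 := le_self_pow₀ hZ (by norm_num)
  have h3 : t * (7 * N + 35) + 5 * B + 51 ≤ 6350576 * Z ^ 3 := by linarith
  have h4 : c * (t * (7 * N + 35) + 5 * B + 51) ≤ c * (6350576 * Z ^ 3) := by gcongr
  have h5 : c * (6350576 * Z ^ 3) ≤ Z * (6350576 * Z ^ 3) := by gcongr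
  have h6 : Z ≤ Z ^ 4 := le_self_pow₀ hZ (by norm_num)
  linarith

lemma reductionTime_le {par : Params} (hσ : 0 < par.σ) (hq : 0 < par.q)
    (hw : 0 ≤ par.w) (hwσ : par.w ≤ par.σ) :
    (reductionTime par : ℝ) + 1 ≤ polyTime timePoly par := by
  rw [polyTime_timePoly]
  set Z := par.scale with hZ
  have hn : (0 : ℝ) ≤ par.n := Nat.cast_nonneg _
  have hm : (0 : ℝ) ≤ par.m := Nat.cast_nonneg _
  have hl : 0 ≤ Real.log par.lam := Real.log_natCast_nonneg _
  set A := (1 + (par.n : ℝ)) * (1 + par.m) with hA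
  set B := 1 + Real.log par.lam ^ 2 with hB
  set Γ := 1 + Real.log par.σ ^ 2 with hΓ
  have hA1 : 1 ≤ A := by nlinarith [mul_nonneg hn hm]
  have hB1 : 1 ≤ B := by nlinarith [sq_nonneg (Real.log par.lam)]
  have hΓ1 : 1 ≤ Γ := by nlinarith [sq_nonneg (Real.log par.σ)]
  have hZe : Z = A * B * Γ := rfl
  have hAB : 1 ≤ A * B := one_le_mul_of_one_le_of_one_le hA1 hB1
  have hABZ : A * B ≤ Z := le_mul_of_one_le_right (by linarith) hΓ1
  have hAZ : A ≤ Z := (le_mul_of_one_le_right (by linarith) hB1).trans hABZ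
  have hBZ : B ≤ Z := (le_mul_of_one_le_left (by linarith) hA1).trans hABZ
  have hΓZ : Γ ≤ Z := le_mul_of_one_le_left (by linarith) hAB
  have hZ1 : 1 ≤ Z := hA1.trans hAZ
  have hℓ : (par.logLam : ℝ) ≤ 1 + 2 * Real.log par.lam := by
    rcases Nat.eq_zero_or_pos par.lam with h0 | h0
    · simp [Params.logLam, h0]
    · exact clog_ceil_le (by exact_mod_cast h0)
  have hℓ0 : (0 : ℝ) ≤ par.logLam := Nat.cast_nonneg _
  have hℓZ : (par.logLam : ℝ) ≤ 2 * Z := by nlinarith [sq_nonneg (Real.log par.lam - 1)]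
  have hK : (par.K : ℝ) ≤ 9 * Z := by
    have h1 : (par.logLam : ℝ) * par.logLam ≤ 8 * B := by
      nlinarith [sq_nonneg (2 * Real.log par.lam - 1)]
    rw [Params.K]
    push_cast
    nlinarith
  have hK1 : (1 : ℝ) ≤ par.K := by exact_mod_cast par.one_le_K
  have hlogK : Real.log par.K ≤ 9 * Z := by
    linarith [Real.log_le_sub_one_of_pos (by linarith : (0 : ℝ) < par.K)]
  have hlogσ : Real.log (1 + par.σ) ≤ 2 * Z := (log_one_add_le hσ).trans (by linarith)
  have hN : (par.bitsN : ℝ) ≤ 23 * Z := by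
    have h0 : 0 ≤ par.K * par.w := by positivity
    have h1 := clog_ceil_le (x := par.K * par.w + 1) (by linarith)
    -- The bound `w ≤ σ` controls the size of the sampling window by `log σ`.
    have h2 : Real.log (par.K * par.w + 1) ≤ Real.log (par.K * (1 + par.σ)) := by
      apply Real.log_le_log (by linarith)
      nlinarith
    rw [Real.log_mul (by linarith) (by linarith)] at h2
    rw [Params.bitsN]
    linarith
  -- Since `q ≥ 1`, the range for fractional parts is also controlled by `log σ`, and `log q` does
  -- not enter the polynomial.
  have hα : par.α ≤ par.σ := div_le_self hσ.le (by exact_mod_cast hq)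
  have hα0 : 0 ≤ par.α := div_nonneg hσ.le (Nat.cast_nonneg _)
  have hBb : (par.bitsB : ℝ) ≤ 25 * Z := by
    have h0 : 0 ≤ par.K * par.α := by positivity
    have h1 := clog_ceil_le (x := par.K * par.α + 1 + 1) (by linarith)
    have h2 : Real.log (par.K * par.α + 1 + 1) ≤ Real.log (2 * (par.K * (1 + par.σ))) := by
      apply Real.log_le_log (by linarith)
      nlinarith
    rw [Real.log_mul (by norm_num) (by positivity), Real.log_mul (by linarith) (by linarith)] at h2
    rw [Params.bitsB]
    linarith [Real.log_two_lt_d9]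
  have hcells : ((par.n : ℝ) + 1) * par.m ≤ Z := by nlinarith
  have htr : (par.trials : ℝ) ≤ 32400 * Z ^ 2 := by
    rw [Params.trials]
    push_cast
    calc (400 * par.K * par.K : ℝ) ≤ 400 * (9 * Z) * (9 * Z) := by gcongr
      _ = 32400 * Z ^ 2 := by ring
  have h := time_arith hZ1 hcells (by positivity) htr (Nat.cast_nonneg _) hN (Nat.cast_nonneg _)
    hBb hℓZ
  rw [reductionTime]
  push_cast
  exact h

lemma HaltsWithin.mono {P : Prog} {par : Params} {x : Samples par.n par.m} {ω : Tape} {B B' : ℝ}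
    (h : HaltsWithin P par x ω B) (hB : B ≤ B') : HaltsWithin P par x ω B' := by
  obtain ⟨t, ht, h⟩ := h
  exact ⟨t, ht.trans hB, h⟩

/-- Thanks to truncation the reduced samples have the right format on every tape, however atypical.
The worst-case time bound of the distinguisher hence always applies. -/
lemma reduce_mem_clweInputs (par : Params) (x : Samples par.n par.m) (ω : Tape) :
    reduce par x ω ∈ clweInputs par.n par.m := fun _ => truncFract_mem _ _

lemma haltsWithin_reduction_seq {par : Params} {D : Prog} {T : ℝ}
    (hD : ∀ x ∈ clweInputs par.n par.m, ∀ ω ∈ validTapes, HaltsWithin D par x ω T)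
    (x : Samples par.n par.m) {ω : Tape} (hω : ω ∈ validTapes) :
    HaltsWithin (.seq reduction D) par x ω (T + (reductionTime par + 1)) :=
  (runs_reduction ω par x).haltsWithin_seq
    (hD _ (reduce_mem_clweInputs par x ω) _ fun _ => hω _)

lemma n_pos_of_norm_eq {n : ℕ} {r : ℝ} (hr : 1 ≤ r) (S : PMF (Fin n → ℤ))
    (hS : ∀ s ∈ S.support, ‖WithLp.toLp 2 (fun j => (s j : ℝ))‖ = r) : 0 < n := by
  obtain ⟨s, hs⟩ := S.support_nonempty
  rcases n with _ | n
  · have h1 := norm_toLp_sq s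
    rw [hS s hs, Finset.univ_eq_empty, Finset.sum_empty] at h1
    nlinarith
  · exact n.succ_pos

lemma abs_acceptProb_sub_le_one (P : Prog) (par : Params) (μ ν : Measure (Samples par.n par.m))
    [IsProbabilityMeasure μ] [IsProbabilityMeasure ν] :
    |acceptProb P par μ - acceptProb P par ν| ≤ 1 := by
  have h : ∀ μ : Measure (Samples par.n par.m), IsProbabilityMeasure μ →
      0 ≤ acceptProb P par μ ∧ acceptProb P par μ ≤ 1 := fun μ _ =>
    ⟨measureReal_nonneg, measureReal_le_one⟩
  have h1 := h μ inferInstance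
  have h2 := h ν inferInstance
  rw [abs_le]
  constructor <;> linarith

end CLWE

end

/-! ### The reduction theorem -/

theorem theorem5p1 :
    ∃ C : ℝ, 0 < C ∧ ∃ (c : ℕ) (p : MvPolynomial (Fin 5) ℕ),
      ∀ f : ℕ → ℝ, CLWE.IsOmegaLog f →
        ∃ ν : ℕ → ℝ, CLWE.Negligible ν ∧
          ∀ D : CLWE.Prog, ∃ D' : CLWE.Prog, D'.size ≤ D.size + c ∧
            ∀ (par : CLWE.Params) (S : PMF (Fin par.n → ℤ)) (T : ℕ) (ε : ℝ),
              0 < par.m → 0 < par.q → 1 ≤ par.r → 0 < par.σ →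
              (∀ s ∈ S.support, ‖WithLp.toLp 2 (fun j => (s j : ℝ))‖ = par.r) →
              par.γ = par.r * √(Real.log par.m + Real.log par.n + f par.lam) →
              par.β = C * (par.σ / par.q) →
              3 * par.r * √(Real.log par.m + Real.log par.n + f par.lam) ≤ par.σ →
              CLWE.IsCLWEDistinguisher D par S T ε →
              CLWE.IsLWEDistinguisher D' par S (T + CLWE.polyTime p par) (ε - ν par.lam) := by
  refine ⟨√3, by positivity, CLWE.reduction.size + 1, CLWE.timePoly, fun f hf =>
    ⟨CLWE.loss f, CLWE.negligible_loss hf, fun D => ⟨.seq CLWE.reduction D, ?_, ?_⟩⟩⟩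
  · simp only [CLWE.Prog.size]
    omega
  intro par S T ε hm hq hr hσ hS hγ hβ hle hD
  obtain ⟨hhalt, hadv⟩ := hD
  -- The program finds the width `w` as the quotient `γ / r` of public parameters, so it need not
  -- compute `f` or a square root.
  have hw : par.w = √(Real.log par.m + Real.log par.n + f par.lam) := by
    rw [CLWE.Params.w, hγ, mul_div_cancel_left₀ _ (by linarith)]
  have hw0 : 0 ≤ par.w := by rw [hw]; positivity
  rw [← hw] at hle
  have hwσ : par.w ≤ par.σ := by nlinarith
  have hn := CLWE.n_pos_of_norm_eq hr S hS
  refine ⟨fun x _ ω hω => (CLWE.haltsWithin_reduction_seq hhalt x hω).mono ?_, ?_⟩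
  · have := CLWE.reductionTime_le hσ hq hw0 hwσ
    linarith
  · rw [CLWE.loss]
    split_ifs with h1
    · have hlm : 0 ≤ Real.log par.m := Real.log_natCast_nonneg _
      have hln : 0 ≤ Real.log par.n := Real.log_natCast_nonneg _
      -- The case assumption `1 ≤ f par.lam` yields `w ≥ 1`, as the two logarithms are nonnegative.
      have h : par.Admissible :=
        ⟨hn, hm, hq, hr, by rw [hw, Real.one_le_sqrt]; linarith, hle⟩
      have herr := h.totalError_le (F := f par.lam) (by rw [hw, Real.sq_sqrt (by linarith)])
      have h2 := abs_le.1 (h.abs_acceptProb_lwe_sub_le D hβ S hS)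
      have h3 := abs_le.1 (h.abs_acceptProb_null_sub_le D)
      -- The error is incurred once for LWE and once for uniform samples, hence the constants `8 = 2
      -- · 4` and `32 = 2 · 16` in `loss`.
      rcases le_abs'.1 hadv with h4 | h4
      · refine le_trans ?_ (neg_le_abs _)
        linarith [h2.1, h2.2, h3.1, h3.2]
      · refine le_trans ?_ (le_abs_self _)
        linarith [h2.1, h2.2, h3.1, h3.2]
    -- For `f par.lam < 1` the loss is 1. No advantage exceeds 1, so the claimed advantage is
    -- nonpositive.
    · have hp' : MeasureTheory.IsProbabilityMeasure (CLWE.nullSamples (n := par.n) par.m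
          (MeasureTheory.Measure.pi fun _ => CLWE.contGaussian 1) CLWE.unifTorus) := by
        unfold CLWE.nullSamples; infer_instance
      have hp : MeasureTheory.IsProbabilityMeasure (CLWE.clwe par.m
          (MeasureTheory.Measure.pi fun _ => CLWE.contGaussian 1) (CLWE.scaleSecret par.r S)
          par.γ par.β) := by
        rw [CLWE.clwe_eq]
        exact CLWE.isProbabilityMeasure_mixture S _
      have h2 := hadv.trans (CLWE.abs_acceptProb_sub_le_one D par _ _)
      exact le_trans (by linarith) (abs_nonneg _)
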